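/- For $J\in\{0,\tfrac12,1,\dots\}$ let $\mathcal H_J$ be the irreducible representation of $\mathrm{SU}(2)$ of dimension $2J+1$, with spin operators $\vec S=(S_x,S_y,S_z)$ and standard orthonormal basis $|m\rangle_J$, $m\in\{-J,\dots,J\}$. For $\omega\in S^2$ and $i\in\{-J,\dots,J\}$ let $|\omega;i\rangle_J\in\mathcal H_J$ be a normalized eigenvector of $\omega\cdot\vec S$ with eigenvalue $i$. Let $d\omega$ be the area measure on $S^2$ normalized to total mass $1$. For $\rho\in B(\mathcal H_J)$ and a function $f$ on $S^2$ put $$\mathrm{Hus}_J^i(\rho)(\omega)=\langle\omega;i|\rho|\omega;i\rangle,\qquad \mathrm{Hus}_J=\mathrm{Hus}_J^J,\qquad \mathrm{Op}_J(f)=(2J+1)\int_{S^2}f(\omega)\,|\omega;J\rangle\langle\omega;J|\,d\omega .$$ For spins $J,K$ and $M\in\{|K-J|,|K-J|+1,\dots,K+J\}$ let $P^M_{J,K}$ be the orthogonal projection of $\mathcal H_J\otimes\mathcal H_K$ onto its unique subrepresentation isomorphic to $\mathcal H_M$, and define the extreme $\mathrm{SU}(2)$-equivariant channel $$\Phi^M_{J,K}(\rho)=\frac{2J+1}{2M+1}\,\mathrm{Tr}_J\big[P^M_{J,K}(\rho^\beta\otimes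 1_K)\big],$$ where $\mathrm{Tr}_J$ is the partial trace over $\mathcal H_J$, $\rho^\beta=U\rho^*U^{-1}$, and $U$ is the anti-unitary operator $U\sum_m\alpha_m|m\rangle=\sum_m(-1)^{J-m}\overline{\alpha_m}\,|-m\rangle$. Let $\|\cdot\|_p$ be the Schatten $p$-norm for operators and the $L^p(S^2,d\omega)$ norm for functions, with $1/p=0$ for $p=\infty$. Theorem. Let $J,K\in\{0,\tfrac12,1,\dots\}$, $\rho\in B(\mathcal H_J)$ and $1\le p\le\infty$. For every $i\in\{-J,\dots,J\}$ with $|K-J|\le K+i$, $$\Big(\tfrac{2K+1}{2J+1}\Big)^{-1/p}\Big\|\tfrac{2K+1}{2J+1}\Phi^{K+i}_{J,K}(\rho)-\mathrm{Op}_K\mathrm{Hus}_J^{-i}(\rho)\Big\|_p\le 12\,\frac{(J-i)(J+i+1)}{2K-J+i+1}\,\|\rho\|_p,$$ $$(2J+1)^{1/p}\Big\|\tfrac{2K+1}{2J+1}\mathrm{Hus}_K\Phi^{K+i}_{J,K}(\rho)-\mathrm{Hus}_J^{-i}(\rho)\Big\|_p\le 2\,\frac{(J+i)(J-i+1)}{2K-J+i+1}\,\|\rho\|_p.$$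 In particular, if $2J\le K$, then for all $\lambda_i\ge0$ ($i\in\{-J,\dots,J\}$) with $\sum_i\lambda_i=1$, the channel $\Phi^{(\lambda)}_{J,K}=\sum_i\lambda_i\Phi^{K+i}_{J,K}$ and the map $\mathrm{Hus}_J^{(\lambda)}=\sum_i\lambda_i\mathrm{Hus}_J^{-i}$ satisfy $$\Big(\tfrac{2K+1}{2J+1}\Big)^{-1/p}\Big\|\tfrac{2K+1}{2J+1}\Phi^{(\lambda)}_{J,K}(\rho)-\mathrm{Op}_K\mathrm{Hus}_J^{(\lambda)}(\rho)\Big\|_p\le 6\,\frac{(2J+1)^2}{2K+1}\,\|\rho\|_p,$$ $$(2J+1)^{1/p}\Big\|\tfrac{2K+1}{2J+1}\mathrm{Hus}_K\Phi^{(\lambda)}_{J,K}(\rho)-\mathrm{Hus}_J^{(\lambda)}(\rho)\Big\|_p\le \frac{(2J+1)^2}{2K+1}\,\|\rho\|_p.$$ -/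

import Mathlib

open MeasureTheory
open scoped Matrix Kronecker ENNReal

noncomputable section

/- Spins are encoded by natural numbers: `n : ℕ` stands for the spin `n / 2`, and operators on the
`(n + 1)`-dimensional irreducible representation of SU(2) are matrices indexed by `Fin (n + 1)` in
the standard orthonormal basis; the index `a` stands for the `S_z`-eigenvector of eigenvalue
`a - n / 2`. -/

/-- The spin `n / 2` encoded by `n`. -/
def spin (n : ℕ) : ℝ := (n : ℝ) / 2

/-- The magnetic quantum number of the `a`-th basis vector; it runs through
`{-J, -J + 1, …, J}`, where `J = spin n`. -/
def mag (n : ℕ) (a : Fin (n + 1)) : ℝ := (a : ℝ) - spin n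

/-- Operators on the spin `n / 2` representation. -/
abbrev Operator (n : ℕ) : Type := Matrix (Fin (n + 1)) (Fin (n + 1)) ℂ

/-- `S_z |m⟩ = m |m⟩`. -/
def Sz (n : ℕ) : Operator n := Matrix.diagonal fun a => (mag n a : ℂ)

/-- `S_+ |m⟩ = √((J - m) (J + m + 1)) |m + 1⟩`. -/
def Splus (n : ℕ) : Operator n := Matrix.of fun b a =>
  if (b : ℕ) = (a : ℕ) + 1 then
    ((Real.sqrt ((spin n - mag n a) * (spin n + mag n a + 1)) : ℝ) : ℂ) else 0

/-- `S_- |m⟩ = √((J + m) (J - m + 1)) |m - 1⟩`. -/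
def Sminus (n : ℕ) : Operator n := Matrix.of fun b a =>
  if (b : ℕ) + 1 = (a : ℕ) then
    ((Real.sqrt ((spin n + mag n a) * (spin n - mag n a + 1)) : ℝ) : ℂ) else 0

/-- `S_x`, from `S_± = S_x ± i S_y`. -/
def Sx (n : ℕ) : Operator n := (2 : ℂ)⁻¹ • (Splus n + Sminus n)

/-- `S_y`, from `S_± = S_x ± i S_y`. -/
def Sy (n : ℕ) : Operator n := (2 * Complex.I)⁻¹ • (Splus n - Sminus n)

/-- The unit sphere in three-dimensional Euclidean space. -/
abbrev Sphere2 : Type := Metric.sphere (0 : EuclideanSpace ℝ (Fin 3)) 1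

/-- The surface measure of the unit sphere, normalized to total mass one. -/
def sphereMeasure : Measure Sphere2 :=
  ((volume : Measure (EuclideanSpace ℝ (Fin 3))).toSphere Set.univ)⁻¹ •
    (volume : Measure (EuclideanSpace ℝ (Fin 3))).toSphere

/-- The spin operator `ω · S` in the direction `ω`. -/
def spinAlong (n : ℕ) (ω : Sphere2) : Operator n :=
  ((ω.1 0 : ℝ) : ℂ) • Sx n + ((ω.1 1 : ℝ) : ℂ) • Sy n + ((ω.1 2 : ℝ) : ℂ) • Sz n

/-- `ψ` is a normalized eigenvector of `ω · S` with eigenvalue `i`. -/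
def IsSpinState (n : ℕ) (ω : Sphere2) (i : ℝ) (ψ : Fin (n + 1) → ℂ) : Prop :=
  star ψ ⬝ᵥ ψ = 1 ∧ spinAlong n ω *ᵥ ψ = (i : ℂ) • ψ

/-- The state `|ω; i⟩`: a normalized eigenvector of `ω · S` with eigenvalue `i ∈ {-J, …, J}`.
It is unique up to a phase, which plays no role below. -/
def spinState (n : ℕ) (ω : Sphere2) (i : ℝ) : Fin (n + 1) → ℂ :=
  Classical.epsilon (IsSpinState n ω i)

/-- The generalized Husimi function `ω ↦ ⟨ω; i| ρ |ω; i⟩`. -/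
def hus (n : ℕ) (i : ℝ) (ρ : Operator n) : Sphere2 → ℂ := fun ω =>
  star (spinState n ω i) ⬝ᵥ (ρ *ᵥ spinState n ω i)

/-- The coherent-state quantization `(2J + 1) ∫ f(ω) |ω; J⟩⟨ω; J| dω` (entry by entry). -/
def op (n : ℕ) (f : Sphere2 → ℂ) : Operator n := Matrix.of fun a b =>
  ((2 * spin n + 1 : ℝ) : ℂ) * ∫ ω, f ω *
    Matrix.vecMulVec (spinState n ω (spin n)) (star (spinState n ω (spin n))) a b ∂sphereMeasure

/-- The matrix of the antiunitary operator `U`, that is `U ψ = timeReversal *ᵥ star ψ`, where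
`U ∑ α_m |m⟩ = ∑ (-1)^(J - m) conj(α_m) |-m⟩`. -/
def timeReversal (n : ℕ) : Operator n := Matrix.of fun b a =>
  if b = Fin.rev a then (-1) ^ (n - (a : ℕ)) else 0

/-- The invariant bilinear form `β(ψ, φ) = ⟨U ψ, φ⟩`. -/
def betaForm (n : ℕ) (ψ φ : Fin (n + 1) → ℂ) : ℂ :=
  star (timeReversal n *ᵥ star ψ) ⬝ᵥ φ

/-- The transpose of `ρ` with respect to `β`: the operator `U⁻¹ ρ* U`, which equals `U ρ* U⁻¹`
because `U² = ±1`. Its defining property is `betaForm_betaTranspose`. -/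
def betaTranspose (n : ℕ) (ρ : Operator n) : Operator n :=
  (timeReversal n)ᵀ * ρᵀ * timeReversal n

theorem timeReversal_mul_transpose (n : ℕ) : timeReversal n * (timeReversal n)ᵀ = 1 := by
  refine mul_eq_one_comm.mp ?_
  ext a b
  simp only [timeReversal, Matrix.mul_apply, Matrix.transpose_apply, Matrix.of_apply,
    Matrix.one_apply]
  by_cases h : a = b
  · subst h
    simp [← pow_add, ← two_mul]
  · simp [h, Ne.symm h]

/-- The defining property of the transpose with respect to `β`. -/
theorem betaForm_betaTranspose (n : ℕ) (ρ : Operator n) (φ ψ : Fin (n + 1) → ℂ) :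
    betaForm n φ (ρ *ᵥ ψ) = betaForm n (betaTranspose n ρ *ᵥ φ) ψ := by
  have hreal : (timeReversal n)ᴴ = (timeReversal n)ᵀ := by
    ext a b
    simp only [timeReversal, Matrix.conjTranspose_apply, Matrix.transpose_apply, Matrix.of_apply]
    split_ifs <;> simp
  have key : ∀ v w : Fin (n + 1) → ℂ,
      betaForm n v w = v ⬝ᵥ ((timeReversal n)ᵀ *ᵥ w) := by
    intro v w
    rw [betaForm, Matrix.star_mulVec, star_star, hreal, ← Matrix.dotProduct_mulVec]
  have h2 : betaTranspose n ρ *ᵥ φ = φ ᵥ* (betaTranspose n ρ)ᵀ := by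
    rw [Matrix.vecMul_transpose]
  rw [key, key, h2, ← Matrix.dotProduct_mulVec, Matrix.mulVec_mulVec, Matrix.mulVec_mulVec]
  have h3 : (betaTranspose n ρ)ᵀ * (timeReversal n)ᵀ = (timeReversal n)ᵀ * ρ := by
    rw [betaTranspose, Matrix.transpose_mul, Matrix.transpose_mul, Matrix.transpose_transpose,
      Matrix.transpose_transpose, Matrix.mul_assoc, Matrix.mul_assoc,
      timeReversal_mul_transpose, Matrix.mul_one]
  rw [h3]

/-- Operators on the tensor product of the representations of spins `j / 2` and `k / 2`. -/
abbrev TensorOperator (j k : ℕ) : Type :=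
  Matrix (Fin (j + 1) × Fin (k + 1)) (Fin (j + 1) × Fin (k + 1)) ℂ

/-- The action of a generator on a tensor product: `A ⊗ 1 + 1 ⊗ B`. -/
def tensorGenerator (j k : ℕ) (A : Operator j) (B : Operator k) : TensorOperator j k :=
  A ⊗ₖ (1 : Operator k) + (1 : Operator j) ⊗ₖ B

/-- `T` is an equivariant isometric embedding of the representation of spin `m / 2` into the tensor
product of those of spins `j / 2` and `k / 2`. As SU(2) is connected, equivariance is the same as
intertwining the actions of the generators of its Lie algebra. -/
def IsEquivariantIsometry (j k m : ℕ)
    (T : Matrix (Fin (j + 1) × Fin (k + 1)) (Fin (m + 1)) ℂ) : Prop :=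
  Tᴴ * T = 1 ∧
    tensorGenerator j k (Sx j) (Sx k) * T = T * Sx m ∧
    tensorGenerator j k (Sy j) (Sy k) * T = T * Sy m ∧
    tensorGenerator j k (Sz j) (Sz k) * T = T * Sz m

/-- The equivariant isometric embedding `ι`. It exists exactly when `|k - j| ≤ m ≤ j + k` and
`j + k + m` is even, and it is then unique up to a phase. -/
def cgEmbedding (j k m : ℕ) : Matrix (Fin (j + 1) × Fin (k + 1)) (Fin (m + 1)) ℂ :=
  Classical.epsilon (IsEquivariantIsometry j k m)

/-- The orthogonal projection `P = ι ι*` onto the copy of the representation of spin `m / 2`. -/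
def cgProjection (j k m : ℕ) : TensorOperator j k :=
  cgEmbedding j k m * (cgEmbedding j k m)ᴴ

/-- The partial trace over the first tensor factor. -/
def partialTraceLeft {j k : ℕ} (X : TensorOperator j k) : Operator k :=
  Matrix.of fun b b' => ∑ a, X (a, b) (a, b')

/-- The extreme equivariant channel
`Φ^M_{J,K}(ρ) = (2J + 1) / (2M + 1) * Tr_J [P^M_{J,K} (ρ^β ⊗ 1)]`, where `J`, `K`, `M` are the spins
encoded by `j`, `k`, `m`. -/
def extremeChannel (j k m : ℕ) (ρ : Operator j) : Operator k :=
  (((2 * spin j + 1) / (2 * spin m + 1) : ℝ) : ℂ) •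
    partialTraceLeft (cgProjection j k m * (betaTranspose j ρ ⊗ₖ (1 : Operator k)))

/-- The code `2M = 2(K + i)` of the spin `M = K + i`, for the `a`-th element `i = mag j a` of
`{-J, …, J}`. The subtraction is exact whenever `K + i ≥ 0`; see `spin_shifted`. -/
def shifted (j k : ℕ) (a : Fin (j + 1)) : ℕ := k + 2 * (a : ℕ) - j

theorem spin_shifted (j k : ℕ) (a : Fin (j + 1)) (h : 0 ≤ spin k + mag j a) :
    spin (shifted j k a) = spin k + mag j a := by
  unfold mag spin at *
  have h1 : (j : ℝ) ≤ ((k + 2 * (a : ℕ) : ℕ) : ℝ) := by push_cast; linarith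
  have h2 : j ≤ k + 2 * (a : ℕ) := by exact_mod_cast h1
  unfold shifted
  rw [Nat.cast_sub h2]
  push_cast
  ring

/-- `Φ^{(λ)}_{J,K} = ∑_i λ_i Φ^{K+i}_{J,K}`, the sum over `i ∈ {-J, …, J}`; used for `J ≤ K`, where
all the spins `K + i` occur in the tensor product. -/
def mixedChannel (j k : ℕ) (w : Fin (j + 1) → ℝ) (ρ : Operator j) : Operator k :=
  ∑ a, (w a : ℂ) • extremeChannel j k (shifted j k a) ρ

/-- `Hus^{(λ)}_J = ∑_i λ_i Hus^{-i}_J`, the sum over `i ∈ {-J, …, J}`. -/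
def mixedHus (j : ℕ) (w : Fin (j + 1) → ℝ) (ρ : Operator j) : Sphere2 → ℂ := fun ω =>
  ∑ a, (w a : ℂ) * hus j (-mag j a) ρ ω

/-- The Schatten norm `(Tr (ρ* ρ)^(p/2))^(1/p)`, and the operator norm for `p = ∞`. -/
def schattenNorm {n : ℕ} (p : ℝ≥0∞) (ρ : Operator n) : ℝ :=
  if p = ∞ then ‖Matrix.toEuclideanCLM (𝕜 := ℂ) ρ‖
  else (cfc (fun x : ℝ => x ^ (p.toReal / 2)) (ρᴴ * ρ)).trace.re ^ (1 / p.toReal)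

end

/-! Put `r = (2K+1)/(2J+1)`. Both compositions in the theorem are averages of the exact objects over
Clebsch–Gordan probabilities, and these probabilities concentrate on one term when `K` is large. Let
`c(M, a)` (`cgWeight`) be the probability of total spin `M` in the product of the weight vector `a`
of spin `J` with the top vector of spin `K`.

Testing the channel against a coherent state, rotating that state to the top vector and using that
`P^M` conserves weight gives `hus_extremeChannel`: `r Hus_K Φ^M = ∑_a (2K+1)/(2M+1) c(M, a)
Hus_J^{-a}`. Dually, the integral over `ω` of the projection onto `|ω; a⟩` tensored with the
coherent projection commutes with SU(2). The tensor product is multiplicity free, so by Schur's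
lemma this integral is a combination of the `P^M`, with coefficients read off from traces. This
gives `op_hus`: `Op_K Hus_J^{-a} = r ∑_M c(M, a) Φ^M`. The weights `(2K+1)/(2M+1) c(M, a)` sum to
one over `a`, and the weights `c(M, a)` sum to one over `M`. Each error is therefore a combination
of differences, with total weight the mass off the principal pair `M = K + a`.

That mass is estimated by a two-term recursion for `c` (`cgWeight_succ`). The raising operator kills
the top vector of the second factor, so the norm of a raised product vector can be computed both in
the first factor and by the Casimir operator of spin `M`. Summing the recursion over `a`, or over
`M`, gives an exact identity in which the principal term has coefficient zero and every other term
with nonzero weight a coefficient bounded below. A Markov type argument then bounds the mass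
(`sum_erase_cgWeight_le`, `sum_range_erase_cgWeight_le`).

The individual terms are bounded in `p`-norm by interpolating between `p = 1` and `p = ∞`
(`eLpNorm_le_schattenNorm`, applied in `schattenNorm_extremeChannel_le` and `eLpNorm_hus_le`). The
triangle inequality for the differences costs a factor 2. The resulting bounds have denominators `2K
+ 2i + 2` and `2K + 2`, which are at least the common denominator of the statement. -/

/-! ### Interpolation for positive kernels, and singular values -/

/-- A Schur test: the row bound `R` is the `L^∞` estimate, the column bound `C` is the `L^1`
estimate, and convexity of `t ↦ t^q` interpolates between them, so no complex interpolation is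
needed. -/
theorem eLpNorm_le_of_enorm_le_sum {α E κ : Type*} {mα : MeasurableSpace α} {μ : Measure α}
    [NormedAddCommGroup E] [Fintype κ] [MeasurableSpace κ] [MeasurableSingletonClass κ]
    {p : ℝ≥0∞} (hp : 1 ≤ p) {f : α → E} {s : κ → ℝ} {D : κ → α → ℝ≥0∞}
    (hD : ∀ k, Measurable (D k)) {R C : ℝ≥0∞}
    (hf : ∀ x, ‖f x‖ₑ ≤ ∑ k, D k x * ‖s k‖ₑ) (hR : ∀ x, ∑ k, D k x ≤ R)
    (hC : ∀ k, ∫⁻ x, D k x ∂μ ≤ C) :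
    eLpNorm f p μ ≤ R ^ (1 - 1 / p.toReal) * C ^ (1 / p.toReal) * eLpNorm s p Measure.count := by
  rcases eq_or_ne p ∞ with rfl | hpt
  -- Here `p.toReal = 0`, and division by zero gives `1 / p.toReal = 0`, the intended convention for
  -- `1/∞`.
  · simp only [eLpNorm_exponent_top, ENNReal.toReal_top, div_zero, sub_zero, ENNReal.rpow_one,
      ENNReal.rpow_zero, mul_one]
    refine eLpNormEssSup_le_of_ae_enorm_bound (Filter.Eventually.of_forall fun x => (hf x).trans ?_)
    rw [eLpNormEssSup_count]
    calc ∑ k, D k x * ‖s k‖ₑ ≤ ∑ k, D k x * ⨆ a, ‖s a‖ₑ := by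
          gcongr with k
          exact le_iSup (fun a => ‖s a‖ₑ) k
      _ ≤ R * ⨆ a, ‖s a‖ₑ := by
          rw [← Finset.sum_mul]
          gcongr
          exact hR x
  have hp0 : p ≠ 0 := (zero_lt_one.trans_le hp).ne'
  have hq : 1 ≤ p.toReal := by simpa using (ENNReal.toReal_le_toReal ENNReal.one_ne_top hpt).2 hp
  have hq0 : 0 < p.toReal := by linarith
  set q := p.toReal
  rw [eLpNorm_eq_lintegral_rpow_enorm_toReal hp0 hpt, eLpNorm_eq_lintegral_rpow_enorm_toReal hp0 hpt,
    lintegral_count, tsum_fintype]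
  have h1 : ∀ x, ‖f x‖ₑ ^ q ≤ R ^ (q - 1) * ∑ k, D k x * ‖s k‖ₑ ^ q := by
    intro x
    -- Hölder with the weights `D k x`, whose total mass is at most `R`, moves the power `q` inside
    -- the sum at the cost of `R ^ (q - 1)`.
    have h := (hf x).trans (ENNReal.inner_le_weight_mul_Lp_of_nonneg Finset.univ hq
      (fun k => D k x) (fun k => ‖s k‖ₑ))
    calc ‖f x‖ₑ ^ q ≤ ((∑ k, D k x) ^ (1 - q⁻¹) * (∑ k, D k x * ‖s k‖ₑ ^ q) ^ q⁻¹) ^ q := by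
          gcongr
      _ = (∑ k, D k x) ^ (q - 1) * ∑ k, D k x * ‖s k‖ₑ ^ q := by
          rw [ENNReal.mul_rpow_of_nonneg _ _ hq0.le, ← ENNReal.rpow_mul, ← ENNReal.rpow_mul,
            inv_mul_cancel₀ hq0.ne', ENNReal.rpow_one, sub_mul, inv_mul_cancel₀ hq0.ne', one_mul]
      _ ≤ _ := by
          gcongr
          exact hR x
  calc (∫⁻ x, ‖f x‖ₑ ^ q ∂μ) ^ (1 / q)
      ≤ (∫⁻ x, R ^ (q - 1) * ∑ k, D k x * ‖s k‖ₑ ^ q ∂μ) ^ (1 / q) := 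
        ENNReal.rpow_le_rpow (lintegral_mono h1) (by positivity)
    _ ≤ (R ^ (q - 1) * (C * ∑ k, ‖s k‖ₑ ^ q)) ^ (1 / q) := by
        refine ENNReal.rpow_le_rpow ?_ (by positivity)
        have hm : ∀ k, Measurable fun x => D k x * ‖s k‖ₑ ^ q := fun k => (hD k).mul_const _
        rw [lintegral_const_mul _ (Finset.measurable_sum _ fun k _ => hm k),
          lintegral_finsetSum _ fun k _ => hm k]
        gcongr
        rw [Finset.mul_sum]
        refine Finset.sum_le_sum fun k _ => ?_
        rw [lintegral_mul_const _ (hD k)]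
        exact mul_le_mul' (hC k) le_rfl
    _ = _ := by
        have : 0 ≤ 1 / q := by positivity
        rw [ENNReal.mul_rpow_of_nonneg _ _ this, ENNReal.mul_rpow_of_nonneg _ _ this,
          ← ENNReal.rpow_mul, ← mul_assoc]
        congr 3
        field_simp

theorem unitary_of_orthonormalBasis {ι : Type*} [Fintype ι] [DecidableEq ι]
    (b : OrthonormalBasis ι ℂ (EuclideanSpace ℂ ι)) :
    (Matrix.of fun i k => b k i) ∈ Matrix.unitaryGroup ι ℂ := by
  rw [Matrix.mem_unitaryGroup_iff']
  ext k l
  have := b.inner_eq_ite k l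
  rw [Matrix.star_eq_conjTranspose, Matrix.mul_apply, Matrix.one_apply, ← this]
  simp [PiLp.inner_apply, mul_comm]

open scoped ComplexOrder in
-- The images under `A` of an eigenbasis of `Aᴴ * A` are pairwise orthogonal with squared lengths
-- the eigenvalues. The nonzero ones, normalized, form part of the left singular basis.
theorem exists_svd_gram {ι : Type*} [Fintype ι] [DecidableEq ι] (A : Matrix ι ι ℂ) :
    ∃ U ∈ Matrix.unitaryGroup ι ℂ, ∃ V ∈ Matrix.unitaryGroup ι ℂ,
      A = U * Matrix.diagonal (fun i => ((Real.sqrt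
        ((Matrix.isHermitian_conjTranspose_mul_self A).eigenvalues i) : ℝ) : ℂ)) * Vᴴ := by
  set hA := Matrix.isHermitian_conjTranspose_mul_self A
  set ev := hA.eigenvalues
  have hev : ∀ i, 0 ≤ ev i := (Matrix.posSemidef_conjTranspose_mul_self A).eigenvalues_nonneg
  set b := hA.eigenvectorBasis
  have hb : ∀ k, (Aᴴ * A) *ᵥ (b k).ofLp = ev k • (b k).ofLp := fun k => hA.mulVec_eigenvectorBasis k
  have hin : ∀ k l, inner ℂ (WithLp.toLp 2 (A *ᵥ (b k).ofLp)) (WithLp.toLp 2 (A *ᵥ (b l).ofLp)) =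
      if k = l then (ev k : ℂ) else 0 := by
    intro k l
    have h1 : inner ℂ (b k) (WithLp.toLp 2 ((Aᴴ * A) *ᵥ (b l).ofLp)) =
        if k = l then (ev k : ℂ) else 0 := by
      rw [hb, WithLp.toLp_smul, WithLp.toLp_ofLp, ← Complex.coe_smul, inner_smul_right,
        b.inner_eq_ite k l]
      split_ifs with h <;> simp [h]
    rw [← h1, EuclideanSpace.inner_eq_star_dotProduct, EuclideanSpace.inner_eq_star_dotProduct]
    simp only [Matrix.star_mulVec, ← Matrix.mulVec_mulVec]
    rw [dotProduct_comm, ← Matrix.dotProduct_mulVec, dotProduct_comm]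
  set s : ι → ℝ := fun k => Real.sqrt (ev k)
  have hs2 : ∀ k, (s k : ℂ) * s k = ev k := fun k => by
    rw [← Complex.ofReal_mul, Real.mul_self_sqrt (hev k)]
  have hort : Orthonormal ℂ (Set.domRestrict {k | s k ≠ 0}
      fun k => ((s k : ℂ)⁻¹) • WithLp.toLp 2 (A *ᵥ (b k).ofLp)) := by
    rw [orthonormal_iff_ite]
    rintro ⟨k, hk⟩ ⟨l, hl⟩
    simp only [Set.mem_ofPred_eq] at hk hl
    simp only [Set.domRestrict_apply, inner_smul_left, inner_smul_right, hin, Subtype.mk.injEq]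
    split_ifs with h
    · subst h
      have : (s k : ℂ) ≠ 0 := by exact_mod_cast hk
      rw [← hs2]
      simp only [map_inv₀, Complex.conj_ofReal]
      field_simp
    · simp
  -- Vectors with zero singular value cannot be normalized, so the family is completed to a basis
  -- arbitrarily. For these indices the relation below still holds because `A` kills the
  -- corresponding eigenvector.
  obtain ⟨c, hc⟩ := hort.exists_orthonormalBasis_extension_of_card_eq (by simp)
  have hc' : ∀ k, WithLp.toLp 2 (A *ᵥ (b k).ofLp) = (s k : ℂ) • c k := by
    intro k
    by_cases hk : s k = 0
    · have h := hin k k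
      rw [if_pos rfl, ← hs2, hk] at h
      rw [hk]
      simpa using h
    · rw [hc k hk, smul_smul, mul_inv_cancel₀ (by exact_mod_cast hk), one_smul]
  refine ⟨_, unitary_of_orthonormalBasis c, _, unitary_of_orthonormalBasis b, ?_⟩
  have hV := unitary_of_orthonormalBasis b
  set V := Matrix.of fun i k => b k i
  set U := Matrix.of fun i k => c k i
  have hAV : A * V = U * Matrix.diagonal (fun i => (s i : ℂ)) := by
    ext i k
    have := congrArg (fun v => v.ofLp i) (hc' k)
    rw [Matrix.mul_diagonal]
    simpa [Matrix.mulVec, dotProduct, Matrix.mul_apply, V, U, mul_comm] using this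
  rw [← hAV, Matrix.mul_assoc, ← Matrix.star_eq_conjTranspose,
    Matrix.mem_unitaryGroup_iff.1 hV, Matrix.mul_one]

open scoped Matrix.Norms.L2Operator in
theorem l2_opNorm_of_svd {ι : Type*} [Fintype ι] [DecidableEq ι] {A U V : Matrix ι ι ℂ}
    (hU : U ∈ Matrix.unitaryGroup ι ℂ) (hV : V ∈ Matrix.unitaryGroup ι ℂ) {d : ι → ℂ}
    (h : A = U * Matrix.diagonal d * Vᴴ) :
    ‖Matrix.toEuclideanCLM (𝕜 := ℂ) A‖ = ‖d‖ := by
  rw [← Matrix.l2_opNorm_diagonal d]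
  change ‖A‖ = _
  rw [h, ← Matrix.star_eq_conjTranspose]
  rw [CStarRing.norm_mul_mem_unitary (E := Matrix ι ι ℂ) _ (Unitary.star_mem hV)]
  exact CStarRing.norm_mem_unitary_mul (E := Matrix ι ι ℂ) _ hU

theorem trace_cfc_eq_sum_eigenvalues {ι : Type*} [Fintype ι] [DecidableEq ι] {A : Matrix ι ι ℂ}
    (hA : A.IsHermitian) (f : ℝ → ℝ) :
    (cfc f A).trace = ((∑ i, f (hA.eigenvalues i) : ℝ) : ℂ) := by
  rw [hA.cfc_eq, Matrix.IsHermitian.cfc, Unitary.conjStarAlgAut_apply, Matrix.trace_mul_cycle,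
    Unitary.coe_star_mul_self, Matrix.one_mul, Matrix.trace_diagonal]
  simp

open scoped ComplexOrder in
-- One decomposition serves all exponents: the Schatten norm is the `ℓ^p` norm of the singular
-- values under counting measure, so Schatten and function norms can be treated by the same
-- `eLpNorm` estimates.
theorem exists_svd {n : ℕ} (A : Operator n) :
    ∃ U ∈ Matrix.unitaryGroup (Fin (n + 1)) ℂ, ∃ V ∈ Matrix.unitaryGroup (Fin (n + 1)) ℂ,
    ∃ s : Fin (n + 1) → ℝ, (∀ i, 0 ≤ s i) ∧
      A = U * Matrix.diagonal (fun i => (s i : ℂ)) * Vᴴ ∧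
      ∀ p : ℝ≥0∞, 1 ≤ p → ENNReal.ofReal (schattenNorm p A) = eLpNorm s p Measure.count := by
  obtain ⟨U, hU, V, hV, h⟩ := exists_svd_gram A
  refine ⟨U, hU, V, hV, _, fun i => Real.sqrt_nonneg _, h, fun p hp => ?_⟩
  set s : Fin (n + 1) → ℝ := fun i =>
    Real.sqrt ((Matrix.isHermitian_conjTranspose_mul_self A).eigenvalues i) with hs
  have hev := (Matrix.posSemidef_conjTranspose_mul_self A).eigenvalues_nonneg
  rcases eq_or_ne p ∞ with rfl | hpt
  · rw [schattenNorm, if_pos rfl, l2_opNorm_of_svd hU hV h, eLpNorm_exponent_top,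
      eLpNormEssSup_count]
    have h1 : ‖(fun i => (s i : ℂ))‖ₑ = ⨆ i, ‖s i‖ₑ := by
      rw [enorm_eq_nnnorm, Pi.nnnorm_def, ENNReal.coe_finset_sup, Finset.sup_univ_eq_iSup]
      simp [enorm_eq_nnnorm]
    rw [← h1, ← ofReal_norm]
  · have hp0 : p ≠ 0 := (zero_lt_one.trans_le hp).ne'
    have hq0 : 0 < p.toReal := ENNReal.toReal_pos hp0 hpt
    rw [schattenNorm, if_neg hpt, eLpNorm_eq_lintegral_rpow_enorm_toReal hp0 hpt, lintegral_count,
      tsum_fintype, trace_cfc_eq_sum_eigenvalues (Matrix.isHermitian_conjTranspose_mul_self A),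
      Complex.ofReal_re, ← ENNReal.ofReal_rpow_of_nonneg (Finset.sum_nonneg fun i _ =>
        Real.rpow_nonneg (hev i) _) (by positivity),
      ENNReal.ofReal_sum_of_nonneg fun i _ => Real.rpow_nonneg (hev i) _]
    congr 2
    ext i
    rw [Real.enorm_eq_ofReal (Real.sqrt_nonneg _), ENNReal.ofReal_rpow_of_nonneg
      (Real.sqrt_nonneg _) hq0.le, Real.sqrt_eq_rpow, ← Real.rpow_mul (hev i)]
    congr 2
    ring

theorem sum_vecMulVec_col {ι : Type*} [Fintype ι] [DecidableEq ι] {X : Matrix ι ι ℂ}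
    (hX : X ∈ Matrix.unitaryGroup ι ℂ) :
    ∑ k, Matrix.vecMulVec (X.col k) (star (X.col k)) = 1 := by
  rw [← Matrix.mem_unitaryGroup_iff.1 hX]
  ext a b
  simp [Matrix.sum_apply, Matrix.vecMulVec_apply, Matrix.mul_apply, Matrix.star_apply]

theorem star_col_dotProduct_col {ι : Type*} [Fintype ι] [DecidableEq ι] {X : Matrix ι ι ℂ}
    (hX : X ∈ Matrix.unitaryGroup ι ℂ) (k : ι) : star (X.col k) ⬝ᵥ X.col k = 1 := by
  have := congrFun (congrFun (Matrix.mem_unitaryGroup_iff'.1 hX) k) k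
  simpa [Matrix.mul_apply, dotProduct, Matrix.star_apply] using this

theorem mul_diagonal_mul_conjTranspose {ι : Type*} [Fintype ι] [DecidableEq ι]
    (X Y : Matrix ι ι ℂ) (d : ι → ℂ) :
    X * Matrix.diagonal d * Yᴴ = ∑ k, d k • Matrix.vecMulVec (X.col k) (star (Y.col k)) := by
  ext a b
  rw [Matrix.mul_apply]
  simp only [Matrix.mul_diagonal, Matrix.sum_apply, Matrix.smul_apply,
    Matrix.vecMulVec_apply, Matrix.conjTranspose_apply, smul_eq_mul, Matrix.col_apply,
    Pi.star_apply]
  exact Finset.sum_congr rfl fun k _ => by ring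

/-- The linear functional `ρ ↦ ⟨u, ρ v⟩`. -/
noncomputable def sandwich {ι : Type*} [Fintype ι] (u v : ι → ℂ) : Matrix ι ι ℂ →ₗ[ℂ] ℂ where
  toFun ρ := star u ⬝ᵥ (ρ *ᵥ v)
  map_add' A B := by rw [Matrix.add_mulVec, dotProduct_add]
  map_smul' c A := by simp [Matrix.smul_mulVec, dotProduct_smul]

theorem sandwich_apply {ι : Type*} [Fintype ι] (u v : ι → ℂ) (ρ : Matrix ι ι ℂ) :
    sandwich u v ρ = star u ⬝ᵥ (ρ *ᵥ v) := rfl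

theorem sandwich_vecMulVec {ι : Type*} [Fintype ι] (u v x y : ι → ℂ) :
    sandwich u v (Matrix.vecMulVec x (star y)) = (star u ⬝ᵥ x) * (star y ⬝ᵥ v) := by
  rw [sandwich_apply, Matrix.vecMulVec_mulVec]
  simp [dotProduct_smul, mul_comm]

theorem sandwich_vecMulVec_self {ι : Type*} [Fintype ι] (u x : ι → ℂ) :
    sandwich u u (Matrix.vecMulVec x (star x)) = ((‖star u ⬝ᵥ x‖ ^ 2 : ℝ) : ℂ) := by
  rw [sandwich_vecMulVec, ← Complex.normSq_eq_norm_sq, Complex.normSq_eq_conj_mul_self, mul_comm]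
  congr 1
  rw [← Complex.star_def, Matrix.star_dotProduct]

/-- The value factors into two overlaps, and the inequality between geometric and arithmetic mean
separates them. This supplies the domination hypothesis of `eLpNorm_le_schattenNorm`. -/
theorem norm_sandwich_vecMulVec_le {ι : Type*} [Fintype ι] (u v x y : ι → ℂ) :
    ‖sandwich u v (Matrix.vecMulVec x (star y))‖ ≤
      ((sandwich u u (Matrix.vecMulVec x (star x))).re +
        (sandwich v v (Matrix.vecMulVec y (star y))).re) / 2 := by
  rw [sandwich_vecMulVec_self, sandwich_vecMulVec_self, sandwich_vecMulVec, norm_mul,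
    Complex.ofReal_re, Complex.ofReal_re]
  have : ‖star y ⬝ᵥ v‖ = ‖star v ⬝ᵥ y‖ := by
    rw [← norm_star, Matrix.star_dotProduct, star_star]
  rw [this]
  nlinarith [sq_nonneg (‖star u ⬝ᵥ x‖ - ‖star v ⬝ᵥ y‖)]

/-- A family of functionals dominated on rank one operators by two families of positive functionals
is bounded with respect to the Schatten norms. -/
theorem eLpNorm_le_schattenNorm {n : ℕ} {α : Type*} {mα : MeasurableSpace α} {μ : Measure α}
    {p : ℝ≥0∞} (hp : 1 ≤ p) {F G H : α → Operator n →ₗ[ℂ] ℂ} {R C : ℝ} (hR : 0 ≤ R) (hC : 0 ≤ C)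
    (hF : ∀ ω x y, ‖F ω (Matrix.vecMulVec x (star y))‖ ≤
      ((G ω (Matrix.vecMulVec x (star x))).re + (H ω (Matrix.vecMulVec y (star y))).re) / 2)
    (hG0 : ∀ ω x, 0 ≤ (G ω (Matrix.vecMulVec x (star x))).re)
    (hH0 : ∀ ω x, 0 ≤ (H ω (Matrix.vecMulVec x (star x))).re)
    (hGm : ∀ A, Measurable fun ω => G ω A) (hHm : ∀ A, Measurable fun ω => H ω A)
    (hGR : ∀ ω, (G ω 1).re ≤ R) (hHR : ∀ ω, (H ω 1).re ≤ R)
    (hGC : ∀ x, star x ⬝ᵥ x = 1 →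
      ∫⁻ ω, ENNReal.ofReal (G ω (Matrix.vecMulVec x (star x))).re ∂μ ≤ ENNReal.ofReal C)
    (hHC : ∀ x, star x ⬝ᵥ x = 1 →
      ∫⁻ ω, ENNReal.ofReal (H ω (Matrix.vecMulVec x (star x))).re ∂μ ≤ ENNReal.ofReal C)
    (A : Operator n) :
    eLpNorm (fun ω => F ω A) p μ ≤
      ENNReal.ofReal (R ^ (1 - 1 / p.toReal) * C ^ (1 / p.toReal) * schattenNorm p A) := by
  obtain ⟨X, hX, Y, hY, s, hs, hA, hsch⟩ := exists_svd A
  rw [mul_diagonal_mul_conjTranspose] at hA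
  have hq1 : 0 ≤ 1 - 1 / p.toReal := by
    rcases eq_or_ne p ∞ with rfl | hpt
    · simp
    · have : 1 ≤ p.toReal := by simpa using (ENNReal.toReal_le_toReal ENNReal.one_ne_top hpt).2 hp
      have : 1 / p.toReal ≤ 1 := by rw [div_le_one] <;> linarith
      linarith
  have hq2 : 0 ≤ 1 / p.toReal := by positivity
  rw [ENNReal.ofReal_mul (by positivity), ENNReal.ofReal_mul (by positivity), hsch p hp,
    ← ENNReal.ofReal_rpow_of_nonneg hR hq1, ← ENNReal.ofReal_rpow_of_nonneg hC hq2]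
  have hre : ∀ (K : Operator n →ₗ[ℂ] ℂ) (Z : Operator n) (_ : Z ∈ Matrix.unitaryGroup _ ℂ),
      ∑ k, (K (Matrix.vecMulVec (Z.col k) (star (Z.col k)))).re = (K 1).re := by
    intro K Z hZ
    rw [← sum_vecMulVec_col hZ, map_sum, Complex.re_sum]
  -- The kernel averages the two dominating functionals on the left and right singular vectors. Row
  -- sums give `G ω 1` and `H ω 1`, since each singular basis resolves the identity.
  refine eLpNorm_le_of_enorm_le_sum hp (D := fun k ω =>
    ENNReal.ofReal (((G ω (Matrix.vecMulVec (X.col k) (star (X.col k)))).re +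
      (H ω (Matrix.vecMulVec (Y.col k) (star (Y.col k)))).re) / 2)) ?_ ?_ ?_ ?_
  · intro k
    have h1 : Measurable fun ω => (G ω (Matrix.vecMulVec (X.col k) (star (X.col k)))).re :=
      Complex.measurable_re.comp (hGm _)
    have h2 : Measurable fun ω => (H ω (Matrix.vecMulVec (Y.col k) (star (Y.col k)))).re :=
      Complex.measurable_re.comp (hHm _)
    exact ((h1.add h2).div_const 2).ennreal_ofReal
  · intro ω
    calc ‖F ω A‖ₑ = ‖∑ k, (s k : ℂ) * F ω (Matrix.vecMulVec (X.col k) (star (Y.col k)))‖ₑ := by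
          conv_lhs => rw [hA]
          rw [map_sum]
          simp only [map_smul, smul_eq_mul]
      _ ≤ ∑ k, ‖(s k : ℂ) * F ω (Matrix.vecMulVec (X.col k) (star (Y.col k)))‖ₑ :=
          enorm_sum_le _ _
      _ ≤ _ := by
          refine Finset.sum_le_sum fun k _ => ?_
          rw [enorm_mul, mul_comm]
          refine mul_le_mul' ?_ ?_
          · rw [← ofReal_norm]
            exact ENNReal.ofReal_le_ofReal (hF ω _ _)
          · simp [← ofReal_norm]
  · intro ω
    rw [← ENNReal.ofReal_sum_of_nonneg fun k _ =>
      div_nonneg (add_nonneg (hG0 ω _) (hH0 ω _)) zero_le_two]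
    refine ENNReal.ofReal_le_ofReal ?_
    rw [← Finset.sum_div, Finset.sum_add_distrib, hre _ X hX, hre _ Y hY]
    linarith [hGR ω, hHR ω]
  · intro k
    have e : ∀ ω, ENNReal.ofReal (((G ω (Matrix.vecMulVec (X.col k) (star (X.col k)))).re +
        (H ω (Matrix.vecMulVec (Y.col k) (star (Y.col k)))).re) / 2) =
        (ENNReal.ofReal (G ω (Matrix.vecMulVec (X.col k) (star (X.col k)))).re +
        ENNReal.ofReal (H ω (Matrix.vecMulVec (Y.col k) (star (Y.col k)))).re) *
          ENNReal.ofReal 2⁻¹ := by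
      intro ω
      rw [← ENNReal.ofReal_add (hG0 ω _) (hH0 ω _), ← ENNReal.ofReal_mul
        (add_nonneg (hG0 ω _) (hH0 ω _)), div_eq_mul_inv]
    have h1 : Measurable fun ω => (G ω (Matrix.vecMulVec (X.col k) (star (X.col k)))).re :=
      Complex.measurable_re.comp (hGm _)
    have h2 : Measurable fun ω => (H ω (Matrix.vecMulVec (Y.col k) (star (Y.col k)))).re :=
      Complex.measurable_re.comp (hHm _)
    simp only [e]
    rw [lintegral_mul_const' _ _ ENNReal.ofReal_ne_top,
      lintegral_add_left h1.ennreal_ofReal]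
    calc _ ≤ (ENNReal.ofReal C + ENNReal.ofReal C) * ENNReal.ofReal 2⁻¹ := by
          gcongr
          · exact hGC _ (star_col_dotProduct_col hX k)
          · exact hHC _ (star_col_dotProduct_col hY k)
      _ = ENNReal.ofReal C := by
          rw [← ENNReal.ofReal_add hC hC, ← ENNReal.ofReal_mul (by positivity)]
          congr 1
          ring

/-! ### The triangle inequality for Schatten norms -/

theorem schattenNorm_nonneg {n : ℕ} {p : ℝ≥0∞} (hp : 1 ≤ p) (A : Operator n) :
    0 ≤ schattenNorm p A := by
  rcases eq_or_ne p ∞ with rfl | hpt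
  · rw [schattenNorm, if_pos rfl]
    positivity
  · rw [schattenNorm, if_neg hpt, trace_cfc_eq_sum_eigenvalues
      (Matrix.isHermitian_conjTranspose_mul_self A), Complex.ofReal_re]
    open scoped ComplexOrder in
    exact Real.rpow_nonneg (Finset.sum_nonneg fun i _ => Real.rpow_nonneg
      ((Matrix.posSemidef_conjTranspose_mul_self A).eigenvalues_nonneg i) _) _

/-- Parseval gives the constant 1 at both endpoints: the overlaps of a unit vector with an
orthonormal basis have squares summing to one, and the same holds with the roles exchanged. -/
theorem eLpNorm_le_of_orthonormal {n : ℕ} {p : ℝ≥0∞} (hp : 1 ≤ p) {U V : Operator n}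
    (hU : U ∈ Matrix.unitaryGroup _ ℂ) (hV : V ∈ Matrix.unitaryGroup _ ℂ) (A : Operator n) :
    eLpNorm (fun i => sandwich (U.col i) (V.col i) A) p Measure.count ≤
      ENNReal.ofReal (schattenNorm p A) := by
  have h0 : ∀ (u x : Fin (n + 1) → ℂ),
      0 ≤ (sandwich u u (Matrix.vecMulVec x (star x))).re := fun u x => by
    rw [sandwich_vecMulVec_self, Complex.ofReal_re]; positivity
  have h1 : ∀ Z ∈ Matrix.unitaryGroup (Fin (n + 1)) ℂ, ∀ i,
      (sandwich (Z.col i) (Z.col i) 1).re ≤ 1 := fun Z hZ i => by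
    rw [sandwich_apply, Matrix.one_mulVec, star_col_dotProduct_col hZ, Complex.one_re]
  have h2 : ∀ Z ∈ Matrix.unitaryGroup (Fin (n + 1)) ℂ, ∀ x : Fin (n + 1) → ℂ,
      star x ⬝ᵥ x = 1 → ∫⁻ i, ENNReal.ofReal (sandwich (Z.col i) (Z.col i)
        (Matrix.vecMulVec x (star x))).re ∂Measure.count ≤ ENNReal.ofReal 1 := by
    intro Z hZ x hx
    rw [lintegral_count, tsum_fintype, ← ENNReal.ofReal_sum_of_nonneg fun i _ => h0 _ _]
    refine ENNReal.ofReal_le_ofReal (le_of_eq ?_)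
    have : ∀ i, sandwich (Z.col i) (Z.col i) (Matrix.vecMulVec x (star x)) =
        sandwich x x (Matrix.vecMulVec (Z.col i) (star (Z.col i))) := fun i => by
      rw [sandwich_vecMulVec, sandwich_vecMulVec, mul_comm]
    rw [← Complex.re_sum]
    simp only [this]
    rw [← map_sum, sum_vecMulVec_col hZ, sandwich_apply, Matrix.one_mulVec, hx, Complex.one_re]
  simpa using eLpNorm_le_schattenNorm (μ := Measure.count) hp (R := 1) (C := 1)
    (F := fun i => sandwich (U.col i) (V.col i))
    (G := fun i => sandwich (U.col i) (U.col i)) (H := fun i => sandwich (V.col i) (V.col i))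
    zero_le_one zero_le_one (fun _ _ _ => norm_sandwich_vecMulVec_le _ _ _ _)
    (fun _ _ => h0 _ _) (fun _ _ => h0 _ _) (fun _ => measurable_of_finite _)
    (fun _ => measurable_of_finite _) (h1 U hU) (h1 V hV) (h2 U hU) (h2 V hV) A

/-- Equality in `eLpNorm_le_of_orthonormal` is attained at the singular bases. The Schatten norm is
thus a maximum of `ℓ^p` norms of linear functions of `A`, from which subadditivity follows by
Minkowski. -/
theorem exists_schattenNorm_eq_eLpNorm_sandwich {n : ℕ} (A : Operator n) :
    ∃ U ∈ Matrix.unitaryGroup (Fin (n + 1)) ℂ, ∃ V ∈ Matrix.unitaryGroup (Fin (n + 1)) ℂ,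
    ∀ p : ℝ≥0∞, 1 ≤ p → ENNReal.ofReal (schattenNorm p A) =
      eLpNorm (fun i => sandwich (U.col i) (V.col i) A) p Measure.count := by
  obtain ⟨U, hU, V, hV, s, hs, hA, hsch⟩ := exists_svd A
  refine ⟨U, hU, V, hV, fun p hp => ?_⟩
  rw [hsch p hp]
  have h : Uᴴ * A * V = Matrix.diagonal fun i => (s i : ℂ) := by
    have h1 := Matrix.mem_unitaryGroup_iff'.1 hU
    have h2 := Matrix.mem_unitaryGroup_iff'.1 hV
    rw [Matrix.star_eq_conjTranspose] at h1 h2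
    rw [hA, Matrix.mul_assoc, Matrix.mul_assoc, h2, Matrix.mul_one, ← Matrix.mul_assoc, h1,
      Matrix.one_mul]
  refine eLpNorm_congr_norm_ae (Filter.Eventually.of_forall fun i => ?_)
  have h3 := congrFun (congrFun h i) i
  rw [Matrix.diagonal_apply_eq] at h3
  have h4 : sandwich (U.col i) (V.col i) A = s i := by
    rw [← h3, sandwich_apply, Matrix.mul_assoc]
    simp only [dotProduct, Matrix.mulVec, Matrix.mul_apply, Matrix.conjTranspose_apply,
      Pi.star_apply, Matrix.col_apply]
  rw [h4, Complex.norm_real]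

theorem schattenNorm_add_le {n : ℕ} {p : ℝ≥0∞} (hp : 1 ≤ p) (A B : Operator n) :
    schattenNorm p (A + B) ≤ schattenNorm p A + schattenNorm p B := by
  obtain ⟨U, hU, V, hV, h⟩ := exists_schattenNorm_eq_eLpNorm_sandwich (A + B)
  have hA := schattenNorm_nonneg hp A
  have hB := schattenNorm_nonneg hp B
  rw [← ENNReal.ofReal_le_ofReal_iff (add_nonneg hA hB), h p hp, ENNReal.ofReal_add hA hB]
  simp only [map_add]
  refine (eLpNorm_add_le (measurable_of_finite _).aestronglyMeasurable
    (measurable_of_finite _).aestronglyMeasurable hp).trans ?_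
  exact add_le_add (eLpNorm_le_of_orthonormal hp hU hV A) (eLpNorm_le_of_orthonormal hp hU hV B)

theorem schattenNorm_smul_le {n : ℕ} {p : ℝ≥0∞} (hp : 1 ≤ p) (c : ℂ) (A : Operator n) :
    schattenNorm p (c • A) ≤ ‖c‖ * schattenNorm p A := by
  obtain ⟨U, hU, V, hV, h⟩ := exists_schattenNorm_eq_eLpNorm_sandwich (c • A)
  have hA := schattenNorm_nonneg hp A
  rw [← ENNReal.ofReal_le_ofReal_iff (by positivity), h p hp, ENNReal.ofReal_mul (norm_nonneg c)]
  simp only [map_smul]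
  refine (eLpNorm_const_smul_le (c := c)
    (f := fun i => sandwich (U.col i) (V.col i) A)).trans ?_
  rw [ofReal_norm]
  gcongr
  exact eLpNorm_le_of_orthonormal hp hU hV A

theorem schattenNorm_sub_le {n : ℕ} {p : ℝ≥0∞} (hp : 1 ≤ p) (A B : Operator n) :
    schattenNorm p (A - B) ≤ schattenNorm p A + schattenNorm p B := by
  rw [sub_eq_add_neg, ← neg_one_smul ℂ B]
  refine (schattenNorm_add_le hp _ _).trans ?_
  gcongr
  simpa using schattenNorm_smul_le hp (-1) B

theorem schattenNorm_sum_smul_le {n : ℕ} {p : ℝ≥0∞} (hp : 1 ≤ p) {ι : Type*} (t : Finset ι)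
    (w : ι → ℝ) (hw : ∀ a ∈ t, 0 ≤ w a) (A : ι → Operator n) :
    schattenNorm p (∑ a ∈ t, (w a : ℂ) • A a) ≤ ∑ a ∈ t, w a * schattenNorm p (A a) := by
  classical
  induction t using Finset.induction_on with
  | empty =>
    simpa using schattenNorm_smul_le hp 0 (0 : Operator n)
  | insert a t ha ih =>
    rw [Finset.sum_insert ha, Finset.sum_insert ha]
    refine (schattenNorm_add_le hp _ _).trans (add_le_add ?_
      (ih fun b hb => hw b (Finset.mem_insert_of_mem hb)))
    refine (schattenNorm_smul_le hp _ _).trans (le_of_eq ?_)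
    rw [Complex.norm_real, Real.norm_of_nonneg (hw a (Finset.mem_insert_self a t))]

/-! ### Ladder operators and commutation relations -/

theorem Splus_apply {n : ℕ} (b a : Fin (n + 1)) : Splus n b a =
    if (b : ℕ) = (a : ℕ) + 1 then ((Real.sqrt (((n : ℝ) - a) * (a + 1)) : ℝ) : ℂ) else 0 := by
  simp only [Splus, Matrix.of_apply, mag, spin]
  congr 4 <;> ring

theorem Sminus_apply {n : ℕ} (b a : Fin (n + 1)) : Sminus n b a =
    if (b : ℕ) + 1 = (a : ℕ) then ((Real.sqrt (((n : ℝ) - b) * (b + 1)) : ℝ) : ℂ) else 0 := by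
  simp only [Sminus, Matrix.of_apply, mag, spin]
  split_ifs with h
  · rw [← h]
    congr 2
    push_cast
    ring
  · rfl

theorem Splus_conjTranspose (n : ℕ) : (Splus n)ᴴ = Sminus n := by
  ext b a
  rw [Matrix.conjTranspose_apply, Splus_apply, Sminus_apply]
  simp only [eq_comm (a := (a : ℕ))]
  split_ifs <;> simp

theorem Sminus_conjTranspose (n : ℕ) : (Sminus n)ᴴ = Splus n := by
  rw [← Splus_conjTranspose, Matrix.conjTranspose_conjTranspose]

theorem mul_Splus_apply {ι : Type*} {n : ℕ} (T : Matrix ι (Fin (n + 1)) ℂ) (i : ι)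
    (a b : Fin (n + 1)) (h : (b : ℕ) = a + 1) :
    (T * Splus n) i a = ((Real.sqrt (((n : ℝ) - a) * (a + 1)) : ℝ) : ℂ) * T i b := by
  rw [Matrix.mul_apply, Finset.sum_eq_single b, Splus_apply, if_pos h, mul_comm]
  · intro c _ hc
    rw [Splus_apply, if_neg, mul_zero]
    intro h'
    exact hc (Fin.ext (h'.trans h.symm))
  · simp

theorem mul_Splus_apply_last {ι : Type*} {n : ℕ} (T : Matrix ι (Fin (n + 1)) ℂ) (i : ι) :
    (T * Splus n) i (Fin.last n) = 0 := by
  rw [Matrix.mul_apply]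
  refine Finset.sum_eq_zero fun c _ => ?_
  rw [Splus_apply, if_neg, mul_zero]
  have := c.is_lt
  simp only [Fin.val_last]
  omega

theorem mul_Sminus_apply {ι : Type*} {n : ℕ} (T : Matrix ι (Fin (n + 1)) ℂ) (i : ι)
    (a b : Fin (n + 1)) (h : (b : ℕ) + 1 = a) :
    (T * Sminus n) i a = ((Real.sqrt (((n : ℝ) - b) * (b + 1)) : ℝ) : ℂ) * T i b := by
  rw [Matrix.mul_apply, Finset.sum_eq_single b, Sminus_apply, if_pos h, mul_comm]
  · intro c _ hc
    rw [Sminus_apply, if_neg, mul_zero]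
    intro h'
    exact hc (Fin.ext (by omega))
  · simp

theorem mul_Sminus_apply_zero {ι : Type*} {n : ℕ} (T : Matrix ι (Fin (n + 1)) ℂ) (i : ι) :
    (T * Sminus n) i 0 = 0 := by
  rw [Matrix.mul_apply]
  refine Finset.sum_eq_zero fun c _ => ?_
  rw [Sminus_apply, if_neg, mul_zero]
  simp

theorem sqrt_ladder_mul_self {n : ℕ} (a : Fin (n + 1)) :
    ((Real.sqrt (((n : ℝ) - a) * (a + 1)) : ℝ) : ℂ) * ((Real.sqrt (((n : ℝ) - a) * (a + 1)) : ℝ) : ℂ)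
      = ((n : ℂ) - a) * (a + 1) := by
  have h : (a : ℝ) ≤ n := by exact_mod_cast Nat.lt_succ_iff.1 a.is_lt
  rw [← Complex.ofReal_mul, Real.mul_self_sqrt (mul_nonneg (by linarith) (by positivity))]
  push_cast
  rfl

theorem Sminus_mul_Splus (n : ℕ) :
    Sminus n * Splus n = Matrix.diagonal fun a : Fin (n + 1) => ((n : ℂ) - a) * (a + 1) := by
  ext b a
  induction a using Fin.lastCases with
  | last =>
    rw [mul_Splus_apply_last, Matrix.diagonal_apply]
    split_ifs with h
    · subst h; simp
    · rfl
  | cast a =>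
    rw [mul_Splus_apply (b := a.succ) _ _ _ (by simp), Sminus_apply, Matrix.diagonal_apply]
    by_cases h : b = a.castSucc
    · subst h
      rw [if_pos (by simp), if_pos rfl, sqrt_ladder_mul_self]
    · rw [if_neg, if_neg h, mul_zero]
      intro h'
      refine h (Fin.ext ?_)
      simp at h' ⊢
      omega

theorem Splus_mul_Sminus (n : ℕ) :
    Splus n * Sminus n = Matrix.diagonal fun a : Fin (n + 1) => ((n : ℂ) - a + 1) * a := by
  ext b a
  induction a using Fin.cases with
  | zero =>
    rw [mul_Sminus_apply_zero, Matrix.diagonal_apply]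
    split_ifs with h
    · subst h; simp
    · rfl
  | succ a =>
    rw [mul_Sminus_apply (b := a.castSucc) _ _ _ (by simp), Splus_apply, Matrix.diagonal_apply]
    by_cases h : b = a.succ
    · subst h
      rw [if_pos (by simp), if_pos rfl, sqrt_ladder_mul_self]
      simp only [Fin.val_castSucc, Fin.val_succ]
      push_cast
      ring
    · rw [if_neg, if_neg h, mul_zero]
      intro h'
      refine h (Fin.ext ?_)
      simp at h' ⊢
      omega

theorem Sz_commutator_Splus (n : ℕ) : Sz n * Splus n - Splus n * Sz n = Splus n := by
  ext b a
  simp only [Sz, Matrix.sub_apply, Matrix.diagonal_mul, Matrix.mul_diagonal, Splus_apply]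
  split_ifs with h
  · simp only [mag, h]
    push_cast
    ring
  · ring

theorem Sz_conjTranspose (n : ℕ) : (Sz n)ᴴ = Sz n := by
  rw [Sz, Matrix.diagonal_conjTranspose]
  congr 1
  ext a
  simp

theorem Sz_commutator_Sminus (n : ℕ) : Sz n * Sminus n - Sminus n * Sz n = -Sminus n := by
  have := congrArg Matrix.conjTranspose (Sz_commutator_Splus n)
  rw [Matrix.conjTranspose_sub, Matrix.conjTranspose_mul, Matrix.conjTranspose_mul,
    Splus_conjTranspose, Sz_conjTranspose] at this
  rw [← neg_sub, this]

theorem Splus_commutator_Sminus (n : ℕ) :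
    Splus n * Sminus n - Sminus n * Splus n = (2 : ℂ) • Sz n := by
  rw [Splus_mul_Sminus, Sminus_mul_Splus, Sz, Matrix.diagonal_sub, ← Matrix.diagonal_smul]
  congr 1
  ext a
  simp only [Pi.smul_apply, smul_eq_mul, mag, spin]
  push_cast
  ring

/-- Hermitian matrices satisfying the commutation relations of the Lie algebra of SU(2). -/
structure IsSpinTriple {ι : Type*} [Fintype ι] (X Y Z : Matrix ι ι ℂ) : Prop where
  hermX : Xᴴ = X
  hermY : Yᴴ = Y
  hermZ : Zᴴ = Z
  xy : X * Y - Y * X = Complex.I • Z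
  yz : Y * Z - Z * Y = Complex.I • X
  zx : Z * X - X * Z = Complex.I • Y

theorem Sx_add_Sy (n : ℕ) : Sx n + Complex.I • Sy n = Splus n := by
  have h2 : Complex.I * (2 * Complex.I)⁻¹ = (2 : ℂ)⁻¹ := by field_simp
  rw [Sx, Sy, smul_smul, h2]
  module

theorem Sx_sub_Sy (n : ℕ) : Sx n - Complex.I • Sy n = Sminus n := by
  have h2 : Complex.I * (2 * Complex.I)⁻¹ = (2 : ℂ)⁻¹ := by field_simp
  rw [Sx, Sy, smul_smul, h2]
  module

theorem inv_two_mul_I : (2 * Complex.I)⁻¹ = -(Complex.I * 2⁻¹) := by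
  rw [mul_inv, Complex.inv_I]; ring

theorem isSpinTriple_spin (n : ℕ) : IsSpinTriple (Sx n) (Sy n) (Sz n) where
  hermX := by
    rw [Sx, Matrix.conjTranspose_smul, Matrix.conjTranspose_add, Splus_conjTranspose,
      Sminus_conjTranspose, add_comm (Sminus n)]
    simp
  hermY := by
    rw [Sy, Matrix.conjTranspose_smul, Matrix.conjTranspose_sub, Splus_conjTranspose,
      Sminus_conjTranspose, inv_two_mul_I]
    simp only [star_neg, star_mul, Complex.star_def, Complex.conj_I, map_inv₀, Complex.conj_ofNat]
    module
  hermZ := Sz_conjTranspose n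
  xy := by
    have h := Splus_commutator_Sminus n
    have e : Sx n * Sy n - Sy n * Sx n =
        (-(2 : ℂ)⁻¹ * (2 * Complex.I)⁻¹ * 2) • (Splus n * Sminus n - Sminus n * Splus n) := by
      simp only [Sx, Sy, smul_mul_assoc, mul_smul_comm, add_mul, mul_add, sub_mul, mul_sub]
      module
    rw [e, h, smul_smul, inv_two_mul_I]
    congr 1
    ring
  yz := by
    have e : Sy n * Sz n - Sz n * Sy n =
        -((2 * Complex.I)⁻¹ • (Sz n * Splus n - Splus n * Sz n)) +
        (2 * Complex.I)⁻¹ • (Sz n * Sminus n - Sminus n * Sz n) := by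
      simp only [Sy, smul_mul_assoc, mul_smul_comm, sub_mul, mul_sub]
      module
    rw [e, Sz_commutator_Splus, Sz_commutator_Sminus, Sx, inv_two_mul_I]
    module
  zx := by
    have e : Sz n * Sx n - Sx n * Sz n =
        (2 : ℂ)⁻¹ • (Sz n * Splus n - Splus n * Sz n) +
        (2 : ℂ)⁻¹ • (Sz n * Sminus n - Sminus n * Sz n) := by
      simp only [Sx, smul_mul_assoc, mul_smul_comm, add_mul, mul_add]
      module
    have h2 : Complex.I * (2 * Complex.I)⁻¹ = (2 : ℂ)⁻¹ := by field_simp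
    rw [e, Sz_commutator_Splus, Sz_commutator_Sminus, Sy, smul_smul, h2]
    module

theorem tensorGenerator_add (j k : ℕ) (A A' : Operator j) (B B' : Operator k) :
    tensorGenerator j k (A + A') (B + B') = tensorGenerator j k A B + tensorGenerator j k A' B' := by
  simp only [tensorGenerator, Matrix.add_kronecker, Matrix.kronecker_add]
  abel

theorem tensorGenerator_smul (j k : ℕ) (c : ℂ) (A : Operator j) (B : Operator k) :
    tensorGenerator j k (c • A) (c • B) = c • tensorGenerator j k A B := by
  simp only [tensorGenerator, Matrix.smul_kronecker, Matrix.kronecker_smul, smul_add]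

theorem tensorGenerator_conjTranspose (j k : ℕ) (A : Operator j) (B : Operator k) :
    (tensorGenerator j k A B)ᴴ = tensorGenerator j k Aᴴ Bᴴ := by
  simp [tensorGenerator, Matrix.conjTranspose_kronecker]

theorem tensorGenerator_commutator (j k : ℕ) (A A' : Operator j) (B B' : Operator k) :
    tensorGenerator j k A B * tensorGenerator j k A' B' -
      tensorGenerator j k A' B' * tensorGenerator j k A B =
    tensorGenerator j k (A * A' - A' * A) (B * B' - B' * B) := by
  simp only [tensorGenerator, add_mul, mul_add, ← Matrix.mul_kronecker_mul, Matrix.mul_one,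
    Matrix.one_mul, sub_eq_add_neg, Matrix.add_kronecker, Matrix.kronecker_add,
    ← neg_one_smul ℂ (A' * A), ← neg_one_smul ℂ (B' * B), Matrix.smul_kronecker,
    Matrix.kronecker_smul]
  module

theorem IsSpinTriple.tensor {j k : ℕ} {X Y Z : Operator j} {X' Y' Z' : Operator k}
    (h : IsSpinTriple X Y Z) (h' : IsSpinTriple X' Y' Z') :
    IsSpinTriple (tensorGenerator j k X X') (tensorGenerator j k Y Y')
      (tensorGenerator j k Z Z') where
  hermX := by rw [tensorGenerator_conjTranspose, h.hermX, h'.hermX]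
  hermY := by rw [tensorGenerator_conjTranspose, h.hermY, h'.hermY]
  hermZ := by rw [tensorGenerator_conjTranspose, h.hermZ, h'.hermZ]
  xy := by rw [tensorGenerator_commutator, h.xy, h'.xy, tensorGenerator_smul]
  yz := by rw [tensorGenerator_commutator, h.yz, h'.yz, tensorGenerator_smul]
  zx := by rw [tensorGenerator_commutator, h.zx, h'.zx, tensorGenerator_smul]

namespace IsSpinTriple

variable {ι : Type*} [Fintype ι] {X Y Z : Matrix ι ι ℂ}

theorem raise_conjTranspose (h : IsSpinTriple X Y Z) :
    (X + Complex.I • Y)ᴴ = X - Complex.I • Y := by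
  rw [Matrix.conjTranspose_add, Matrix.conjTranspose_smul, h.hermX, h.hermY]
  simp [sub_eq_add_neg]

theorem raise_mul_lower (h : IsSpinTriple X Y Z) :
    (X + Complex.I • Y) * (X - Complex.I • Y) =
      (X - Complex.I • Y) * (X + Complex.I • Y) + (2 : ℂ) • Z := by
  have e : (X + Complex.I • Y) * (X - Complex.I • Y) -
      (X - Complex.I • Y) * (X + Complex.I • Y) = (-2 * Complex.I) • (X * Y - Y * X) := by
    simp only [smul_mul_assoc, mul_smul_comm, add_mul, mul_add, sub_mul, mul_sub, smul_sub]
    module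
  rw [← sub_eq_iff_eq_add', e, h.xy, smul_smul, mul_assoc, Complex.I_mul_I]
  norm_num

theorem mul_lower (h : IsSpinTriple X Y Z) :
    Z * (X - Complex.I • Y) = (X - Complex.I • Y) * Z - (X - Complex.I • Y) := by
  have e : Z * (X - Complex.I • Y) - (X - Complex.I • Y) * Z =
      (Z * X - X * Z) + Complex.I • (Y * Z - Z * Y) := by
    simp only [smul_mul_assoc, mul_smul_comm, sub_mul, mul_sub, smul_sub]
    module
  rw [sub_eq_add_neg ((X - Complex.I • Y) * Z), ← sub_eq_iff_eq_add', e, h.zx, h.yz, smul_smul,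
    Complex.I_mul_I]
  module

end IsSpinTriple

/-! ### Modules generated by a highest weight vector -/

namespace IsSpinTriple

variable {ι : Type*} [Fintype ι] {X Y Z : Matrix ι ι ℂ}

theorem star_mulVec_dotProduct {κ : Type*} [Fintype κ] (A : Matrix κ ι ℂ) (u : ι → ℂ)
    (v : κ → ℂ) : star (A *ᵥ u) ⬝ᵥ v = star u ⬝ᵥ (Aᴴ *ᵥ v) := by
  rw [Matrix.star_mulVec, ← Matrix.dotProduct_mulVec]

/-- The normalized descendants of a highest weight vector `h` of weight `m / 2`. -/
noncomputable def descend (X Y : Matrix ι ι ℂ) (m : ℕ) (h : ι → ℂ) : ℕ → ι → ℂ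
  | 0 => h
  | r + 1 => ((Real.sqrt (((r : ℝ) + 1) * ((m : ℝ) - r)) : ℝ) : ℂ)⁻¹ •
      ((X - Complex.I • Y) *ᵥ descend X Y m h r)

variable {m : ℕ} {h : ι → ℂ}

theorem sqrt_descend_ne_zero {r : ℕ} (hr : r < m) :
    ((Real.sqrt (((r : ℝ) + 1) * ((m : ℝ) - r)) : ℝ) : ℂ) ≠ 0 := by
  have : (r : ℝ) < m := by exact_mod_cast hr
  have h1 : 0 < ((r : ℝ) + 1) * ((m : ℝ) - r) := mul_pos (by positivity) (by linarith)
  exact_mod_cast (Real.sqrt_pos.2 h1).ne'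

theorem sqrt_descend_sq {r : ℕ} (hr : r < m) :
    ((Real.sqrt (((r : ℝ) + 1) * ((m : ℝ) - r)) : ℝ) : ℂ) *
      ((Real.sqrt (((r : ℝ) + 1) * ((m : ℝ) - r)) : ℝ) : ℂ) = ((r : ℂ) + 1) * (m - r) := by
  have : (r : ℝ) < m := by exact_mod_cast hr
  rw [← Complex.ofReal_mul, Real.mul_self_sqrt (mul_nonneg (by positivity) (by linarith))]
  push_cast
  rfl

theorem lower_descend {r : ℕ} (hr : r < m) :
    (X - Complex.I • Y) *ᵥ descend X Y m h r =
      ((Real.sqrt (((r : ℝ) + 1) * ((m : ℝ) - r)) : ℝ) : ℂ) • descend X Y m h (r + 1) := by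
  rw [descend, smul_smul, mul_inv_cancel₀ (sqrt_descend_ne_zero hr), one_smul]

theorem raise_descend_of {r : ℕ} (hr : r < m)
    (h2 : (X + Complex.I • Y) *ᵥ ((X - Complex.I • Y) *ᵥ descend X Y m h r) =
      (((r : ℂ) + 1) * (m - r)) • descend X Y m h r) :
    (X + Complex.I • Y) *ᵥ descend X Y m h (r + 1) =
      ((Real.sqrt (((r : ℝ) + 1) * ((m : ℝ) - r)) : ℝ) : ℂ) • descend X Y m h r := by
  rw [descend, Matrix.mulVec_smul, h2, smul_smul, ← sqrt_descend_sq hr, ← mul_assoc,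
    inv_mul_cancel₀ (sqrt_descend_ne_zero hr), one_mul]

/-- The three claims need a joint induction: the weight and the relation `EF = FE + 2Z` give the
next eigenvalue of `EF`, and that eigenvalue is exactly the squared norm that the normalization
divides out. -/
theorem descend_spec (hs : IsSpinTriple X Y Z) (hE : (X + Complex.I • Y) *ᵥ h = 0)
    (hZ : Z *ᵥ h = ((m : ℂ) / 2) • h) (h1 : star h ⬝ᵥ h = 1) {r : ℕ} (hr : r ≤ m) :
    Z *ᵥ descend X Y m h r = ((m : ℂ) / 2 - r) • descend X Y m h r ∧
    (X + Complex.I • Y) *ᵥ ((X - Complex.I • Y) *ᵥ descend X Y m h r) =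
      (((r : ℂ) + 1) * (m - r)) • descend X Y m h r ∧
    star (descend X Y m h r) ⬝ᵥ descend X Y m h r = 1 := by
  induction r with
  | zero =>
    refine ⟨by simpa [descend] using hZ, ?_, h1⟩
    rw [Matrix.mulVec_mulVec, hs.raise_mul_lower, Matrix.add_mulVec, ← Matrix.mulVec_mulVec]
    simp only [descend]
    rw [hE, Matrix.smul_mulVec, hZ, Matrix.mulVec_zero, smul_smul, zero_add]
    congr 1
    push_cast
    ring
  | succ r ih =>
    have hr' : r < m := hr
    obtain ⟨i1, i2, i3⟩ := ih hr'.le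
    have hz : Z *ᵥ descend X Y m h (r + 1) =
        ((m : ℂ) / 2 - (r + 1 : ℕ)) • descend X Y m h (r + 1) := by
      rw [descend, Matrix.mulVec_smul, Matrix.mulVec_mulVec, hs.mul_lower, Matrix.sub_mulVec,
        ← Matrix.mulVec_mulVec, i1, Matrix.mulVec_smul, smul_comm ((m : ℂ) / 2 - (r + 1 : ℕ))]
      congr 1
      push_cast
      module
    refine ⟨hz, ?_, ?_⟩
    · rw [Matrix.mulVec_mulVec, hs.raise_mul_lower, Matrix.add_mulVec, ← Matrix.mulVec_mulVec,
        raise_descend_of hr' i2, Matrix.mulVec_smul, lower_descend hr', Matrix.smul_mulVec, hz,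
        smul_smul, smul_smul, sqrt_descend_sq hr', ← add_smul]
      congr 1
      push_cast
      ring
    · have e : star (descend X Y m h (r + 1)) ⬝ᵥ ((X - Complex.I • Y) *ᵥ descend X Y m h r) =
          ((Real.sqrt (((r : ℝ) + 1) * ((m : ℝ) - r)) : ℝ) : ℂ) := by
        rw [← hs.raise_conjTranspose, ← star_mulVec_dotProduct, raise_descend_of hr' i2,
          star_smul, smul_dotProduct, i3]
        simp
      conv_lhs => rw [descend.eq_2 X Y m h r, dotProduct_smul, ← descend.eq_2 X Y m h r, e]
      rw [smul_eq_mul, inv_mul_cancel₀ (sqrt_descend_ne_zero hr')]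

/-- The squared norm of the lowered vector is the eigenvalue `(r + 1) * (m - r)` of `EF`, which
vanishes at `r = m`. -/
theorem lower_descend_last (hs : IsSpinTriple X Y Z) (hE : (X + Complex.I • Y) *ᵥ h = 0)
    (hZ : Z *ᵥ h = ((m : ℂ) / 2) • h) (h1 : star h ⬝ᵥ h = 1) :
    (X - Complex.I • Y) *ᵥ descend X Y m h m = 0 := by
  obtain ⟨-, i2, -⟩ := descend_spec hs hE hZ h1 le_rfl
  open scoped ComplexOrder in
  rw [← dotProduct_star_self_eq_zero]
  rw [star_mulVec_dotProduct, ← hs.raise_conjTranspose, Matrix.conjTranspose_conjTranspose,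
    hs.raise_conjTranspose, i2]
  simp

theorem exists_intertwiner (hs : IsSpinTriple X Y Z) (hE : (X + Complex.I • Y) *ᵥ h = 0)
    (hZ : Z *ᵥ h = ((m : ℂ) / 2) • h) (h1 : star h ⬝ᵥ h = 1) :
    ∃ T : Matrix ι (Fin (m + 1)) ℂ, Tᴴ * T = 1 ∧ X * T = T * Sx m ∧ Y * T = T * Sy m ∧
      Z * T = T * Sz m := by
  have spec := fun r (hr : r ≤ m) => descend_spec hs hE hZ h1 hr
  set w := descend X Y m h with hw
  -- Basis indices count weights from the bottom, whereas `descend` starts at the top; hence column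
  -- `a` is the descendant of order `m - a`.
  set T : Matrix ι (Fin (m + 1)) ℂ := Matrix.of fun i a => w (m - a) i with hT
  have hcol : ∀ (A : Matrix ι ι ℂ) i a, (A * T) i a = (A *ᵥ w (m - a)) i := fun A i a => by
    simp [Matrix.mul_apply, Matrix.mulVec, dotProduct, hT]
  have hTz : Z * T = T * Sz m := by
    ext i a
    have ha : (a : ℕ) ≤ m := Nat.lt_succ_iff.1 a.is_lt
    rw [hcol, (spec _ (Nat.sub_le _ _)).1, Sz, Matrix.mul_diagonal, Pi.smul_apply, smul_eq_mul,
      mul_comm]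
    simp only [hT, Matrix.of_apply, mag, spin, Nat.cast_sub ha]
    push_cast
    ring
  have hTp : (X + Complex.I • Y) * T = T * Splus m := by
    ext i a
    induction a using Fin.lastCases with
    | last =>
      rw [mul_Splus_apply_last, hcol]
      simp only [Fin.val_last, Nat.sub_self]
      rw [hw, descend, hE, Pi.zero_apply]
    | cast a =>
      have ha : (a : ℕ) < m := a.is_lt
      obtain ⟨r, hr⟩ : ∃ r, m = a + 1 + r := ⟨m - (a + 1), by omega⟩
      have hr' : r < m := by omega
      have e1 : m - (a.castSucc : ℕ) = r + 1 := by simp; omega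
      have e2 : m - (a.succ : ℕ) = r := by simp; omega
      rw [mul_Splus_apply (b := a.succ) _ _ _ (by simp), hcol, e1,
        raise_descend_of hr' (spec r hr'.le).2.1]
      simp only [hT, Matrix.of_apply, e2, Pi.smul_apply, smul_eq_mul]
      congr 3
      have hr2 : (m : ℝ) = a + 1 + r := by exact_mod_cast hr
      simp only [Fin.val_castSucc, hr2]
      ring
  have hTm : (X - Complex.I • Y) * T = T * Sminus m := by
    ext i a
    induction a using Fin.cases with
    | zero =>
      rw [mul_Sminus_apply_zero, hcol]
      simp only [Fin.val_zero, Nat.sub_zero]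
      rw [lower_descend_last hs hE hZ h1, Pi.zero_apply]
    | succ a =>
      have ha : (a : ℕ) < m := a.is_lt
      obtain ⟨r, hr⟩ : ∃ r, m = a + 1 + r := ⟨m - (a + 1), by omega⟩
      have hr' : r < m := by omega
      have e1 : m - (a.castSucc : ℕ) = r + 1 := by simp; omega
      have e2 : m - (a.succ : ℕ) = r := by simp; omega
      rw [mul_Sminus_apply (b := a.castSucc) _ _ _ (by simp), hcol, e2, lower_descend hr']
      simp only [hT, Matrix.of_apply, e1, Pi.smul_apply, smul_eq_mul]
      congr 3
      have hr2 : (m : ℝ) = a + 1 + r := by exact_mod_cast hr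
      simp only [Fin.val_castSucc, hr2]
      ring
  refine ⟨T, ?_, ?_, ?_, hTz⟩
  · have horth : ∀ a b : Fin (m + 1), (Tᴴ * T) a b = star (w (m - a)) ⬝ᵥ w (m - b) := fun a b => by
      simp [Matrix.mul_apply, dotProduct, hT]
    ext a b
    rw [Matrix.one_apply]
    split_ifs with hab
    · rw [hab, horth]
      exact (spec _ (Nat.sub_le _ _)).2.2
    -- Orthogonality of distinct columns comes from `Tᴴ * T` commuting with `Sz m`, whose
    -- eigenvalues are distinct.
    · have hc : Tᴴ * T * Sz m = Sz m * (Tᴴ * T) := by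
        rw [Matrix.mul_assoc, ← hTz, ← Matrix.mul_assoc, ← Matrix.mul_assoc]
        congr 1
        rw [← Sz_conjTranspose m, ← Matrix.conjTranspose_mul, ← hTz, Matrix.conjTranspose_mul,
          hs.hermZ]
      have := congrFun (congrFun hc a) b
      rw [Sz, Matrix.mul_diagonal, Matrix.diagonal_mul, mul_comm, ← sub_eq_zero, ← sub_mul,
        mul_eq_zero] at this
      refine this.resolve_left fun h0 => hab (Fin.ext ?_)
      have h3 : mag m b = mag m a := by exact_mod_cast sub_eq_zero.1 h0
      have h4 : ((b : ℕ) : ℝ) = (a : ℕ) := by simpa [mag] using h3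
      exact_mod_cast h4.symm
  · have e : X = (2 : ℂ)⁻¹ • ((X + Complex.I • Y) + (X - Complex.I • Y)) := by module
    rw [e, Matrix.smul_mul, Matrix.add_mul, hTp, hTm, Sx, Matrix.mul_smul, Matrix.mul_add]
  · have e : Y = (2 * Complex.I)⁻¹ • ((X + Complex.I • Y) - (X - Complex.I • Y)) := by
      have : (X + Complex.I • Y) - (X - Complex.I • Y) = (2 * Complex.I) • Y := by module
      rw [this, smul_smul, inv_mul_cancel₀ (by simp), one_smul]
    rw [e, Matrix.smul_mul, Matrix.sub_mul, hTp, hTm, Sy, Matrix.mul_smul, Matrix.mul_sub]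

end IsSpinTriple

/-! ### Highest weight vectors in a tensor product -/

theorem Splus_mulVec_zero {n : ℕ} (v : Fin (n + 1) → ℂ) : (Splus n *ᵥ v) 0 = 0 := by
  rw [Matrix.mulVec, dotProduct]
  refine Finset.sum_eq_zero fun c _ => ?_
  rw [Splus_apply, if_neg, zero_mul]
  simp

theorem Splus_mulVec_succ {n : ℕ} (v : Fin (n + 1) → ℂ) (a : Fin n) :
    (Splus n *ᵥ v) a.succ =
      ((Real.sqrt (((n : ℝ) - (a : ℕ)) * ((a : ℕ) + 1)) : ℝ) : ℂ) * v a.castSucc := by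
  rw [Matrix.mulVec, dotProduct, Finset.sum_eq_single a.castSucc, Splus_apply, if_pos (by simp)]
  · simp
  · intro c _ hc
    rw [Splus_apply, if_neg, zero_mul]
    intro h'
    refine hc (Fin.ext ?_)
    simp at h' ⊢
    omega
  · simp

theorem tensorGenerator_mulVec {j k : ℕ} (A : Operator j) (B : Operator k)
    (v : Fin (j + 1) × Fin (k + 1) → ℂ) (a : Fin (j + 1)) (b : Fin (k + 1)) :
    (tensorGenerator j k A B *ᵥ v) (a, b) =
      (A *ᵥ fun a' => v (a', b)) a + (B *ᵥ fun b' => v (a, b')) b := by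
  rw [tensorGenerator, Matrix.add_mulVec, Pi.add_apply]
  simp only [Matrix.mulVec, dotProduct, Fintype.sum_prod_type, Matrix.kroneckerMap_apply,
    Matrix.one_apply]
  congr 1
  · refine Finset.sum_congr rfl fun x _ => ?_
    simp
  · rw [Finset.sum_eq_single a]
    · simp
    · intro x _ hx
      simp [hx.symm]
    · simp

/-- Coefficients of an unnormalized highest weight vector of spin `(j + k) / 2 - s` in the tensor
product of the representations of spins `j / 2` and `k / 2`. -/
noncomputable def highestCoeff (j k s : ℕ) : ℕ → ℝ
  | 0 => 1
  | t + 1 => -(Real.sqrt (((s : ℝ) - t) * ((j : ℝ) - s + t + 1)) *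
      (Real.sqrt (((t : ℝ) + 1) * ((k : ℝ) - t)))⁻¹ * highestCoeff j k s t)

/-- The corresponding vector. -/
noncomputable def highestVector (j k s : ℕ) : Fin (j + 1) × Fin (k + 1) → ℂ := fun x =>
  if (x.1 : ℕ) + x.2 + s = j + k then (highestCoeff j k s (k - x.2) : ℂ) else 0

/-- Each component of the raised vector involves at most two entries on the antidiagonal that
supports `highestVector`; the recursion defining `highestCoeff` is the condition that these two
contributions cancel. -/
theorem raise_highestVector {j k s : ℕ} (hj : s ≤ j) (hk : s ≤ k) :
    tensorGenerator j k (Splus j) (Splus k) *ᵥ highestVector j k s = 0 := by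
  ext ⟨a, b⟩
  rw [tensorGenerator_mulVec, Pi.zero_apply]
  induction a using Fin.cases with
  | zero =>
    rw [Splus_mulVec_zero, zero_add]
    induction b using Fin.cases with
    | zero => rw [Splus_mulVec_zero]
    | succ b =>
      have := b.is_lt
      rw [Splus_mulVec_succ, highestVector, if_neg, mul_zero]
      simp
      omega
  | succ a =>
    have ha := a.is_lt
    rw [Splus_mulVec_succ]
    induction b using Fin.cases with
    | zero =>
      rw [Splus_mulVec_zero, add_zero, highestVector, if_neg, mul_zero]
      simp
      omega
    | succ b =>
      have hb := b.is_lt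
      rw [Splus_mulVec_succ]
      by_cases h : (a : ℕ) + b + 1 + s = j + k
      · obtain ⟨t, ht⟩ : ∃ t, k = b + 1 + t := ⟨k - (b + 1), by omega⟩
        have e1 : k - (b.succ : ℕ) = t := by simp; omega
        have e2 : k - (b.castSucc : ℕ) = t + 1 := by simp; omega
        rw [highestVector, if_pos (by simp; omega), highestVector, if_pos (by simp; omega)]
        simp only [e1, e2, highestCoeff]
        have hb' : ((b : ℕ) : ℝ) = (k : ℝ) - t - 1 := by
          have : (k : ℝ) = (b : ℕ) + 1 + t := by exact_mod_cast ht
          linarith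
        have ha' : ((a : ℕ) : ℝ) = (j : ℝ) - s + t := by
          have : ((a : ℕ) : ℝ) + (b : ℕ) + 1 + s = j + k := by exact_mod_cast h
          linarith
        have hkt : (0 : ℝ) < ((t : ℝ) + 1) * ((k : ℝ) - t) := by
          have : (0 : ℝ) ≤ (b : ℕ) := by positivity
          exact mul_pos (by positivity) (by linarith)
        rw [ha', hb']
        have hne := (Real.sqrt_pos.2 hkt).ne'
        rw [show (j : ℝ) - (j - s + t) = s - t by ring,
          show ((k : ℝ) - (k - t - 1)) * (k - t - 1 + 1) = (t + 1) * (k - t) by ring]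
        rw [← Complex.ofReal_mul, ← Complex.ofReal_mul, ← Complex.ofReal_add,
          Complex.ofReal_eq_zero]
        field_simp
        ring
      · rw [highestVector, if_neg (by simp; omega), highestVector, if_neg (by simp; omega)]
        simp

theorem weight_highestVector {j k s m : ℕ} (hm : m + 2 * s = j + k) :
    tensorGenerator j k (Sz j) (Sz k) *ᵥ highestVector j k s =
      ((m : ℂ) / 2) • highestVector j k s := by
  ext ⟨a, b⟩
  rw [tensorGenerator_mulVec, Sz, Sz, Matrix.mulVec_diagonal, Matrix.mulVec_diagonal,
    Pi.smul_apply, ← add_mul, smul_eq_mul]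
  by_cases h : (a : ℕ) + b + s = j + k
  · congr 1
    simp only [mag, spin]
    have h1 : ((a : ℕ) : ℂ) + (b : ℕ) + s = j + k := by exact_mod_cast h
    have h2 : (m : ℂ) + 2 * s = j + k := by exact_mod_cast hm
    push_cast
    linear_combination h1 - h2 / 2
  · rw [highestVector, if_neg h]
    simp

theorem highestVector_ne_zero {j k s : ℕ} (hj : s ≤ j) : highestVector j k s ≠ 0 := by
  intro h
  have := congrFun h (⟨j - s, by omega⟩, Fin.last k)
  rw [highestVector, if_pos (by simp; omega)] at this
  simp [highestCoeff] at this

theorem exists_isEquivariantIsometry {j k s m : ℕ} (hj : s ≤ j) (hk : s ≤ k)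
    (hm : m + 2 * s = j + k) : ∃ T, IsEquivariantIsometry j k m T := by
  have hs := (isSpinTriple_spin j).tensor (isSpinTriple_spin k)
  set v := highestVector j k s
  have hv : v ≠ 0 := highestVector_ne_zero hj
  set c : ℝ := (star v ⬝ᵥ v).re with hc
  open scoped ComplexOrder in
  have hpos : 0 < star v ⬝ᵥ v := Matrix.dotProduct_star_self_pos_iff.2 hv
  open scoped ComplexOrder in
  have hcv : star v ⬝ᵥ v = c := by
    rw [← Complex.re_add_im (star v ⬝ᵥ v), ← (Complex.lt_def.1 hpos).2]
    simp [hc]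
  open scoped ComplexOrder in
  have hc0 : 0 < c := (Complex.lt_def.1 hpos).1
  have hcs : ((Real.sqrt c : ℝ) : ℂ) * ((Real.sqrt c : ℝ) : ℂ) = c := by
    rw [← Complex.ofReal_mul, Real.mul_self_sqrt hc0.le]
  have hcs0 : ((Real.sqrt c : ℝ) : ℂ) ≠ 0 := by exact_mod_cast (Real.sqrt_pos.2 hc0).ne'
  have hE : tensorGenerator j k (Sx j) (Sx k) + Complex.I • tensorGenerator j k (Sy j) (Sy k) =
      tensorGenerator j k (Splus j) (Splus k) := by
    rw [← tensorGenerator_smul, ← tensorGenerator_add, Sx_add_Sy, Sx_add_Sy]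
  refine hs.exists_intertwiner (m := m) (h := ((Real.sqrt c : ℝ) : ℂ)⁻¹ • v) ?_ ?_ ?_
  · rw [hE, Matrix.mulVec_smul, raise_highestVector hj hk, smul_zero]
  · rw [Matrix.mulVec_smul, weight_highestVector hm, smul_comm]
  · rw [star_smul, smul_dotProduct, dotProduct_smul, hcv, ← hcs]
    simp only [star_inv₀, Complex.star_def, Complex.conj_ofReal, smul_eq_mul]
    field_simp

theorem cgEmbedding_spec {j k s m : ℕ} (hj : s ≤ j) (hk : s ≤ k) (hm : m + 2 * s = j + k) :
    IsEquivariantIsometry j k m (cgEmbedding j k m) :=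
  Classical.epsilon_spec (exists_isEquivariantIsometry hj hk hm)

/-! ### Schur's lemma and multiplicity freeness -/

/-- `A` intertwines the representations of spins `m' / 2` and `m / 2`. -/
def IsIntertwiner (m m' : ℕ) (A : Matrix (Fin (m + 1)) (Fin (m' + 1)) ℂ) : Prop :=
  Sx m * A = A * Sx m' ∧ Sy m * A = A * Sy m' ∧ Sz m * A = A * Sz m'

theorem casimir_spin (n : ℕ) :
    Sminus n * Splus n + Sz n * Sz n + Sz n = ((n : ℂ) / 2 * ((n : ℂ) / 2 + 1)) • 1 := by
  rw [Sminus_mul_Splus, Sz, Matrix.diagonal_mul_diagonal, Matrix.diagonal_add, Matrix.diagonal_add,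
    ← Matrix.diagonal_one, ← Matrix.diagonal_smul]
  congr 1
  ext a
  simp only [mag, spin, Pi.smul_apply, smul_eq_mul]
  push_cast
  ring

theorem IsIntertwiner.map_Splus {m m' : ℕ} {A : Matrix (Fin (m + 1)) (Fin (m' + 1)) ℂ}
    (h : IsIntertwiner m m' A) : Splus m * A = A * Splus m' := by
  rw [← Sx_add_Sy, ← Sx_add_Sy, Matrix.add_mul, Matrix.mul_add, Matrix.smul_mul, Matrix.mul_smul,
    h.1, h.2.1]

theorem IsIntertwiner.map_Sminus {m m' : ℕ} {A : Matrix (Fin (m + 1)) (Fin (m' + 1)) ℂ}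
    (h : IsIntertwiner m m' A) : Sminus m * A = A * Sminus m' := by
  rw [← Sx_sub_Sy, ← Sx_sub_Sy, Matrix.sub_mul, Matrix.mul_sub, Matrix.smul_mul, Matrix.mul_smul,
    h.1, h.2.1]

/-- An intertwiner transports the Casimir operator, whose scalar values `J (J + 1)` differ for
different spins. -/
theorem IsIntertwiner.eq_zero {m m' : ℕ} {A : Matrix (Fin (m + 1)) (Fin (m' + 1)) ℂ}
    (h : IsIntertwiner m m' A) (hm : m ≠ m') : A = 0 := by
  have e : (Sminus m * Splus m + Sz m * Sz m + Sz m) * A =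
      A * (Sminus m' * Splus m' + Sz m' * Sz m' + Sz m') := by
    rw [Matrix.add_mul, Matrix.add_mul, Matrix.mul_add, Matrix.mul_add, Matrix.mul_assoc, h.map_Splus,
      ← Matrix.mul_assoc, h.map_Sminus, Matrix.mul_assoc, Matrix.mul_assoc (Sz m), h.2.2,
      ← Matrix.mul_assoc (Sz m), h.2.2, Matrix.mul_assoc A (Sz m')]
  rw [casimir_spin, casimir_spin, Matrix.smul_mul, Matrix.mul_smul, Matrix.one_mul, Matrix.mul_one,
    ← sub_eq_zero, ← sub_smul, smul_eq_zero] at e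
  refine e.resolve_left fun h0 => ?_
  have h1 : ((m : ℂ) - m') * (m + m' + 2) = 0 := by linear_combination 4 * h0
  rcases mul_eq_zero.1 h1 with h2 | h2
  · exact hm (by exact_mod_cast sub_eq_zero.1 h2)
  · have h3 : ((m + m' + 2 : ℕ) : ℂ) = 0 := by exact_mod_cast h2
    rw [Nat.cast_eq_zero] at h3
    omega

/-- Commuting with `Sz` forces a diagonal matrix because the weights are distinct; commuting with
`Splus` equates consecutive diagonal entries because the ladder coefficients do not vanish. -/
theorem eq_smul_one_of_commute {n : ℕ} {A : Operator n} (hz : Sz n * A = A * Sz n)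
    (hp : Splus n * A = A * Splus n) : A = (A.trace / (n + 1)) • (1 : Operator n) := by
  have hd : ∀ a b, a ≠ b → A a b = 0 := by
    intro a b hab
    have := congrFun (congrFun hz a) b
    rw [Sz, Matrix.mul_diagonal, Matrix.diagonal_mul, mul_comm, ← sub_eq_zero, ← mul_sub,
      mul_eq_zero] at this
    refine this.resolve_right fun h0 => hab (Fin.ext ?_)
    have h3 : mag n a = mag n b := by exact_mod_cast sub_eq_zero.1 h0
    have h4 : ((a : ℕ) : ℝ) = (b : ℕ) := by simpa [mag] using h3
    exact_mod_cast h4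
  have hs : ∀ a : Fin n, A a.succ a.succ = A a.castSucc a.castSucc := by
    intro a
    have := congrFun (congrFun hp a.succ) a.castSucc
    rw [mul_Splus_apply (b := a.succ) _ _ _ (by simp), Matrix.mul_apply_eq_vecMul,
      ← Matrix.mul_apply_eq_vecMul, Matrix.mul_apply, Finset.sum_eq_single a.castSucc, Splus_apply,
      if_pos (by simp)] at this
    · refine (mul_left_cancel₀ ?_ this).symm
      have h1 : ((a : ℕ) : ℝ) < n := by exact_mod_cast a.is_lt
      have h2 : 0 < ((n : ℝ) - (a : ℕ)) * ((a : ℕ) + 1) := mul_pos (by linarith) (by positivity)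
      exact_mod_cast (Real.sqrt_pos.2 h2).ne'
    · intro c _ hc
      rw [hd c _ hc, mul_zero]
    · simp
  have hc : ∀ a, A a a = A 0 0 := by
    intro a
    induction a using Fin.induction with
    | zero => rfl
    | succ a ih => rw [hs, ih]
  have e : A = A 0 0 • (1 : Operator n) := by
    ext a b
    rw [Matrix.smul_apply, Matrix.one_apply, smul_eq_mul]
    split_ifs with h
    · rw [h, hc, mul_one]
    · rw [hd a b h, mul_zero]
  have ht : A.trace = A 0 0 * (n + 1) := by
    conv_lhs => rw [e]
    simp
  rw [ht, mul_div_cancel_right₀ _ (by exact_mod_cast Nat.succ_ne_zero n)]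
  exact e

theorem IsIntertwiner.eq_smul_one {m : ℕ} {A : Operator m} (h : IsIntertwiner m m A) :
    A = (A.trace / (m + 1)) • (1 : Operator m) :=
  eq_smul_one_of_commute h.2.2 h.map_Splus

namespace IsEquivariantIsometry

variable {j k m m' : ℕ} {T : Matrix (Fin (j + 1) × Fin (k + 1)) (Fin (m + 1)) ℂ}
  {T' : Matrix (Fin (j + 1) × Fin (k + 1)) (Fin (m' + 1)) ℂ}

theorem conjTranspose_mul (h : IsEquivariantIsometry j k m T) :
    Tᴴ * tensorGenerator j k (Sx j) (Sx k) = Sx m * Tᴴ ∧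
    Tᴴ * tensorGenerator j k (Sy j) (Sy k) = Sy m * Tᴴ ∧
    Tᴴ * tensorGenerator j k (Sz j) (Sz k) = Sz m * Tᴴ := by
  have hs := (isSpinTriple_spin j).tensor (isSpinTriple_spin k)
  have hm := isSpinTriple_spin m
  refine ⟨?_, ?_, ?_⟩
  · conv_lhs => rw [← hs.hermX]
    conv_rhs => rw [← hm.hermX]
    rw [← Matrix.conjTranspose_mul, ← Matrix.conjTranspose_mul, h.2.1]
  · conv_lhs => rw [← hs.hermY]
    conv_rhs => rw [← hm.hermY]
    rw [← Matrix.conjTranspose_mul, ← Matrix.conjTranspose_mul, h.2.2.1]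
  · conv_lhs => rw [← hs.hermZ]
    conv_rhs => rw [← hm.hermZ]
    rw [← Matrix.conjTranspose_mul, ← Matrix.conjTranspose_mul, h.2.2.2]

/-- A block of an invariant operator is an intertwiner. It is used with `W = 1` for the
orthogonality of the components and with an integrated projection for its expansion in the
`cgProjection`. -/
theorem isIntertwiner (h : IsEquivariantIsometry j k m T) (h' : IsEquivariantIsometry j k m' T')
    {W : TensorOperator j k}
    (hx : tensorGenerator j k (Sx j) (Sx k) * W = W * tensorGenerator j k (Sx j) (Sx k))
    (hy : tensorGenerator j k (Sy j) (Sy k) * W = W * tensorGenerator j k (Sy j) (Sy k))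
    (hz : tensorGenerator j k (Sz j) (Sz k) * W = W * tensorGenerator j k (Sz j) (Sz k)) :
    IsIntertwiner m m' (Tᴴ * W * T') := by
  obtain ⟨c1, c2, c3⟩ := h.conjTranspose_mul
  refine ⟨?_, ?_, ?_⟩
  · rw [← Matrix.mul_assoc, ← Matrix.mul_assoc, ← c1, Matrix.mul_assoc Tᴴ, hx, Matrix.mul_assoc,
      Matrix.mul_assoc, Matrix.mul_assoc, h'.2.1]
    simp only [Matrix.mul_assoc]
  · rw [← Matrix.mul_assoc, ← Matrix.mul_assoc, ← c2, Matrix.mul_assoc Tᴴ, hy, Matrix.mul_assoc,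
      Matrix.mul_assoc, Matrix.mul_assoc, h'.2.2.1]
    simp only [Matrix.mul_assoc]
  · rw [← Matrix.mul_assoc, ← Matrix.mul_assoc, ← c3, Matrix.mul_assoc Tᴴ, hz, Matrix.mul_assoc,
      Matrix.mul_assoc, Matrix.mul_assoc, h'.2.2.2]
    simp only [Matrix.mul_assoc]

theorem conjTranspose_mul_eq_zero (h : IsEquivariantIsometry j k m T)
    (h' : IsEquivariantIsometry j k m' T') (hm : m ≠ m') : Tᴴ * T' = 0 := by
  have := (h.isIntertwiner h' (W := 1) (by simp) (by simp) (by simp)).eq_zero hm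
  rwa [Matrix.mul_one] at this

end IsEquivariantIsometry

theorem sum_range_dim (j k μ : ℕ) (h : μ ≤ min j k + 1) :
    ∑ s ∈ Finset.range μ, (((j + k - 2 * s : ℕ) : ℝ) + 1) = μ * (j + k + 2 - μ) := by
  induction μ with
  | zero => simp
  | succ μ ih =>
    rw [Finset.sum_range_succ, ih (by omega), Nat.cast_sub (by omega)]
    push_cast
    ring

/-- The Clebsch–Gordan decomposition. -/
theorem sum_cgProjection (j k : ℕ) :
    ∑ s ∈ Finset.range (min j k + 1), cgProjection j k (j + k - 2 * s) = 1 := by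
  have spec : ∀ s ∈ Finset.range (min j k + 1),
      IsEquivariantIsometry j k (j + k - 2 * s) (cgEmbedding j k (j + k - 2 * s)) := by
    intro s hs
    rw [Finset.mem_range] at hs
    exact cgEmbedding_spec (s := s) (by omega) (by omega) (by omega)
  set Q := ∑ s ∈ Finset.range (min j k + 1), cgProjection j k (j + k - 2 * s) with hQ
  have hherm : Qᴴ = Q := by
    rw [hQ, Matrix.conjTranspose_sum]
    refine Finset.sum_congr rfl fun s _ => ?_
    rw [cgProjection, Matrix.conjTranspose_mul, Matrix.conjTranspose_conjTranspose]
  have hidem : Q * Q = Q := by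
    conv_lhs => rw [hQ]
    rw [Finset.sum_mul]
    refine Finset.sum_congr rfl fun s hs => ?_
    rw [Finset.mul_sum, Finset.sum_eq_single s]
    · rw [cgProjection, Matrix.mul_assoc, ← Matrix.mul_assoc _ (cgEmbedding _ _ _), (spec s hs).1,
        Matrix.one_mul]
    · intro s' hs' hne
      rw [cgProjection, cgProjection, Matrix.mul_assoc, ← Matrix.mul_assoc _ (cgEmbedding _ _ _),
        (spec s hs).conjTranspose_mul_eq_zero (spec s' hs'), Matrix.zero_mul, Matrix.mul_zero]
      rw [Finset.mem_range] at hs hs'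
      omega
    · exact fun h => absurd hs h
  have htrace : Q.trace = (j + 1) * (k + 1) := by
    rw [hQ, Matrix.trace_sum]
    have e : ∀ s ∈ Finset.range (min j k + 1), (cgProjection j k (j + k - 2 * s)).trace =
        (((((j + k - 2 * s : ℕ) : ℝ) + 1 : ℝ)) : ℂ) := by
      intro s hs
      rw [cgProjection, Matrix.trace_mul_comm, (spec s hs).1, Matrix.trace_one]
      simp
    rw [Finset.sum_congr rfl e, ← Complex.ofReal_sum, sum_range_dim j k _ le_rfl]
    rcases le_total j k with h | h
    · rw [min_eq_left h]; push_cast; ring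
    · rw [min_eq_right h]; push_cast; ring
  -- The dimension count makes `1 - Q` an orthogonal projection of trace zero; its trace is its
  -- squared Hilbert–Schmidt norm, so it vanishes.
  have h0 : (1 - Q)ᴴ * (1 - Q) = 1 - Q := by
    rw [Matrix.conjTranspose_sub, hherm, Matrix.conjTranspose_one, sub_mul, mul_sub, mul_sub, hidem]
    simp
  open scoped ComplexOrder in
  have h1 : 1 - Q = 0 := by
    rw [← Matrix.trace_conjTranspose_mul_self_eq_zero_iff, h0, Matrix.trace_sub, htrace,
      Matrix.trace_one]
    simp
  exact (sub_eq_zero.1 h1).symm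

/-! ### Rotations as exponentials of generators -/

section NormedAlgebra

variable {𝔸 : Type*} [NormedRing 𝔸] [NormedAlgebra ℂ 𝔸] [CompleteSpace 𝔸]

/-- Conjugating the rotated combination back by the exponential gives a function of the angle with
derivative zero: the commutator with the generator undoes the derivative of the coefficients. -/
theorem exp_mul_eq_rotate_mul_exp {X Y Z : 𝔸} (hX : Z * X - X * Z = Complex.I • Y)
    (hY : Y * Z - Z * Y = Complex.I • X) (a b t : ℝ) :
    NormedSpace.exp (t • (-Complex.I • Z)) * (a • X + b • Y) =
      ((a * Real.cos t - b * Real.sin t) • X + (a * Real.sin t + b * Real.cos t) • Y) *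
        NormedSpace.exp (t • (-Complex.I • Z)) := by
  obtain ⟨A, hA⟩ : ∃ A, A = -Complex.I • Z := ⟨_, rfl⟩
  rw [← hA]
  have hAX : A * X - X * A = Y := by
    rw [hA, smul_mul_assoc, mul_smul_comm, ← smul_sub, hX, smul_smul]
    simp
  have hAY : A * Y - Y * A = -X := by
    rw [hA, smul_mul_assoc, mul_smul_comm, ← smul_sub, ← neg_sub (Y * Z), hY, smul_neg, smul_smul]
    simp
  have hder : ∀ u : ℝ, HasDerivAt (fun u : ℝ => NormedSpace.exp (u • (-A)) *
      ((a * Real.cos u - b * Real.sin u) • X + (a * Real.sin u + b * Real.cos u) • Y) *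
        NormedSpace.exp (u • A)) 0 u := by
    intro u
    have h1 := hasDerivAt_exp_smul_const (𝕂 := ℝ) (-A) u
    have h2 := hasDerivAt_exp_smul_const' (𝕂 := ℝ) A u
    have h3 : HasDerivAt (fun u : ℝ =>
        (a * Real.cos u - b * Real.sin u) • X + (a * Real.sin u + b * Real.cos u) • Y)
        ((a * -Real.sin u - b * Real.cos u) • X + (a * Real.cos u + b * -Real.sin u) • Y) u :=
      ((((Real.hasDerivAt_cos u).const_mul a).sub
        ((Real.hasDerivAt_sin u).const_mul b)).smul_const X).add
      ((((Real.hasDerivAt_sin u).const_mul a).add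
        ((Real.hasDerivAt_cos u).const_mul b)).smul_const Y)
    refine ((h1.mul h3).mul h2).congr_deriv ?_
    have e : ∀ P Q G G' : 𝔸, (A * G - G * A = G') →
        (P * -A * G + P * G') * Q + P * G * (A * Q) = 0 := by
      intro P Q G G' h
      rw [← h]
      noncomm_ring
    refine e _ _ _ _ ?_
    have : ∀ r s : ℝ, A * (r • X + s • Y) - (r • X + s • Y) * A =
        r • (A * X - X * A) + s • (A * Y - Y * A) := by
      intro r s
      rw [mul_add, add_mul, mul_smul_comm, mul_smul_comm, smul_mul_assoc, smul_mul_assoc]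
      module
    rw [this, hAX, hAY]
    module
  have hconst := is_const_of_deriv_eq_zero (fun u => (hder u).differentiableAt)
    (fun u => (hder u).deriv) t 0
  simp only [zero_smul, NormedSpace.exp_zero, Real.cos_zero, Real.sin_zero, mul_one, mul_zero,
    sub_zero, one_mul, zero_add] at hconst
  have hinv : NormedSpace.exp (t • A) * NormedSpace.exp (t • (-A)) = 1 := by
    let _ := NormedAlgebra.restrictScalars ℚ ℂ 𝔸
    rw [← NormedSpace.exp_add_of_commute ((Commute.refl A).neg_right.smul_left t |>.smul_right t),
      ← smul_add, add_neg_cancel, smul_zero, NormedSpace.exp_zero]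
  rw [← hconst, ← mul_assoc, ← mul_assoc, hinv, one_mul]

/-- Differentiating at `t = 0` recovers the generator. Invariance under rotations thereby becomes
the infinitesimal invariance used in Schur's lemma. -/
theorem commute_of_exp_commute {A W : 𝔸}
    (h : ∀ t : ℝ, NormedSpace.exp (t • A) * W = W * NormedSpace.exp (t • A)) : A * W = W * A := by
  have h1 := (hasDerivAt_exp_smul_const (𝕂 := ℝ) A 0).mul_const W
  have h2 := (hasDerivAt_exp_smul_const (𝕂 := ℝ) A 0).const_mul W
  simp only [h] at h1
  simpa using h1.unique h2

end NormedAlgebra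


theorem IsSpinTriple.cycle {ι : Type*} [Fintype ι] {X Y Z : Matrix ι ι ℂ} (h : IsSpinTriple X Y Z) :
    IsSpinTriple Z X Y where
  hermX := h.hermZ
  hermY := h.hermX
  hermZ := h.hermY
  xy := h.zx
  yz := h.xy
  zx := h.yz

section Rotation

variable {ι : Type*} [Fintype ι] [DecidableEq ι]

/-- The one-parameter group `exp (-i t A)`. -/
noncomputable def rotationExp (A : Matrix ι ι ℂ) (t : ℝ) : Matrix ι ι ℂ :=
  NormedSpace.exp (t • (-Complex.I • A))

theorem rotationExp_mem_unitaryGroup {A : Matrix ι ι ℂ} (hA : Aᴴ = A) (t : ℝ) :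
    rotationExp A t ∈ Matrix.unitaryGroup ι ℂ := by
  rw [Matrix.mem_unitaryGroup_iff, Matrix.star_eq_conjTranspose, rotationExp,
    ← Matrix.exp_conjTranspose, Matrix.conjTranspose_smul, Matrix.conjTranspose_smul, hA]
  have e : star t • star (-Complex.I) • A = -(t • (-Complex.I • A)) := by
    simp
  rw [e, ← Matrix.exp_add_of_commute _ _ (Commute.refl (t • (-Complex.I • A))).neg_right,
    add_neg_cancel, NormedSpace.exp_zero]

open scoped Matrix.Norms.L2Operator in
theorem IsSpinTriple.rotationExp_mul {X Y Z : Matrix ι ι ℂ} (h : IsSpinTriple X Y Z)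
    (a b c t : ℝ) :
    rotationExp Z t * ((a : ℂ) • X + (b : ℂ) • Y + (c : ℂ) • Z) =
      (((a * Real.cos t - b * Real.sin t : ℝ) : ℂ) • X +
        ((a * Real.sin t + b * Real.cos t : ℝ) : ℂ) • Y + (c : ℂ) • Z) * rotationExp Z t := by
  have h1 := exp_mul_eq_rotate_mul_exp h.zx h.yz a b t
  have h2 : Z * rotationExp Z t = rotationExp Z t * Z :=
    (((Commute.refl Z).smul_right (-Complex.I)).smul_right t).exp_right.eq
  rw [mul_add, add_mul _ _ (rotationExp Z t), mul_smul_comm, smul_mul_assoc, h2]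
  congr 1

open scoped Matrix.Norms.L2Operator in
theorem commute_of_rotationExp_commute {A W : Matrix ι ι ℂ}
    (h : ∀ t, rotationExp A t * W = W * rotationExp A t) : A * W = W * A := by
  have h1 := commute_of_exp_commute h
  rw [smul_mul_assoc, mul_smul_comm] at h1
  exact smul_right_injective _ (neg_ne_zero.2 Complex.I_ne_zero) h1

open scoped Matrix.Norms.L2Operator in
theorem rotationExp_commute {A W : Matrix ι ι ℂ} (h : A * W = W * A) (t : ℝ) :
    rotationExp A t * W = W * rotationExp A t :=
  (((show Commute W A from h.symm).smul_right (-Complex.I)).smul_right t).exp_right.eq.symm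

open scoped Matrix.Norms.L2Operator in
-- The two summands of the generator commute, so the exponential splits, and each factor is the
-- image of an exponential under a continuous ring homomorphism.
theorem rotationExp_tensorGenerator {j k : ℕ} (A : Operator j) (B : Operator k) (t : ℝ) :
    rotationExp (tensorGenerator j k A B) t = rotationExp A t ⊗ₖ rotationExp B t := by
  let f : Operator j →+* TensorOperator j k :=
    { toFun := fun M => M ⊗ₖ (1 : Operator k)
      map_one' := Matrix.one_kronecker_one
      map_mul' := fun M N => by rw [← Matrix.mul_kronecker_mul, Matrix.one_mul]
      map_zero' := Matrix.zero_kronecker _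
      map_add' := fun M N => Matrix.add_kronecker _ _ _ }
  let g : Operator k →+* TensorOperator j k :=
    { toFun := fun M => (1 : Operator j) ⊗ₖ M
      map_one' := Matrix.one_kronecker_one
      map_mul' := fun M N => by rw [← Matrix.mul_kronecker_mul, Matrix.one_mul]
      map_zero' := Matrix.kronecker_zero _
      map_add' := fun M N => Matrix.kronecker_add _ _ _ }
  let _ : NormedAlgebra ℚ (Operator j) := .restrictScalars ℚ ℂ _
  let _ : NormedAlgebra ℚ (Operator k) := .restrictScalars ℚ ℂ _
  have hf : Continuous f := by
    refine continuous_matrix fun a b => ?_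
    exact (continuous_id.matrix_elem a.1 b.1).mul continuous_const
  have hg : Continuous g := by
    refine continuous_matrix fun a b => ?_
    exact continuous_const.mul (continuous_id.matrix_elem a.2 b.2)
  have e : t • (-Complex.I • tensorGenerator j k A B) =
      f (t • (-Complex.I • A)) + g (t • (-Complex.I • B)) := by
    change _ = (t • (-Complex.I • A)) ⊗ₖ (1 : Operator k) + (1 : Operator j) ⊗ₖ (t • (-Complex.I • B))
    rw [tensorGenerator, Matrix.smul_kronecker, Matrix.smul_kronecker, Matrix.kronecker_smul,
      Matrix.kronecker_smul, smul_add, smul_add]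
  have hc : Commute (f (t • (-Complex.I • A))) (g (t • (-Complex.I • B))) := by
    change _ ⊗ₖ _ * _ ⊗ₖ _ = _ ⊗ₖ _ * _ ⊗ₖ _
    rw [← Matrix.mul_kronecker_mul, ← Matrix.mul_kronecker_mul]
    simp only [Matrix.one_mul, Matrix.mul_one]
  rw [rotationExp, e, Matrix.exp_add_of_commute _ _ hc, ← NormedSpace.map_exp f hf,
    ← NormedSpace.map_exp g hg]
  change (_ ⊗ₖ _) * (_ ⊗ₖ _) = _
  rw [← Matrix.mul_kronecker_mul, Matrix.one_mul, Matrix.mul_one]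
  rfl

end Rotation

/-! ### Rotation invariance of the sphere measure -/

/-- The map of the unit sphere induced by a linear isometry. -/
def sphereMap {E : Type*} [NormedAddCommGroup E] [NormedSpace ℝ E] (L : E ≃ₗᵢ[ℝ] E)
    (ω : Metric.sphere (0 : E) 1) : Metric.sphere (0 : E) 1 :=
  ⟨L ω, by simp⟩

theorem continuous_sphereMap {E : Type*} [NormedAddCommGroup E] [NormedSpace ℝ E]
    (L : E ≃ₗᵢ[ℝ] E) : Continuous (sphereMap L) :=
  Continuous.subtype_mk (L.continuous.comp continuous_subtype_val) _

open scoped Pointwise in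
-- The surface measure of a set is a multiple of the volume of the cone over it, and taking cones
-- commutes with preimages under a linear isometry.
theorem toSphere_measurePreserving {E : Type*} [NormedAddCommGroup E] [NormedSpace ℝ E]
    [MeasurableSpace E] [BorelSpace E] {μ : Measure E} (L : E ≃ₗᵢ[ℝ] E)
    (hL : MeasurePreserving L μ μ) : MeasurePreserving (sphereMap L) μ.toSphere μ.toSphere := by
  have hm : Measurable (sphereMap L) := (continuous_sphereMap L).measurable
  refine ⟨hm, ?_⟩
  ext s hs
  rw [Measure.map_apply hm hs, Measure.toSphere_apply' _ hs, Measure.toSphere_apply' _ (hm hs)]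
  have e : Set.Ioo (0 : ℝ) 1 • (Subtype.val '' (sphereMap L ⁻¹' s)) =
      L ⁻¹' (Set.Ioo (0 : ℝ) 1 • (Subtype.val '' s)) := by
    ext x
    simp only [Set.mem_smul, Set.mem_image, Set.mem_preimage]
    constructor
    · rintro ⟨r, hr, _, ⟨y, hy, rfl⟩, rfl⟩
      exact ⟨r, hr, _, ⟨_, hy, rfl⟩, by simp [sphereMap]⟩
    · rintro ⟨r, hr, _, ⟨y, hy, rfl⟩, hx⟩
      have hy' : sphereMap L (sphereMap L.symm y) = y := by
        ext; simp [sphereMap]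
      refine ⟨r, hr, _, ⟨sphereMap L.symm y, by rwa [hy'], rfl⟩, ?_⟩
      apply L.injective
      rw [← hx]
      simp [sphereMap]
  rw [e]
  congr 1
  exact hL.measure_preimage_equiv (f := L.toHomeomorph.toMeasurableEquiv) _

theorem sphereMap_measurePreserving
    (L : EuclideanSpace ℝ (Fin 3) ≃ₗᵢ[ℝ] EuclideanSpace ℝ (Fin 3)) :
    MeasurePreserving (sphereMap L) sphereMeasure sphereMeasure :=
  (toSphere_measurePreserving L L.measurePreserving).smul_measure _

instance : IsProbabilityMeasure sphereMeasure where
  measure_univ := by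
    rw [sphereMeasure, Measure.smul_apply, smul_eq_mul]
    refine ENNReal.inv_mul_cancel ?_ (measure_ne_top _ _)
    rw [Ne, Measure.measure_univ_eq_zero]
    exact Measure.toSphere_ne_zero _

theorem integral_sphereMap (L : EuclideanSpace ℝ (Fin 3) ≃ₗᵢ[ℝ] EuclideanSpace ℝ (Fin 3))
    (f : Sphere2 → ℂ) (hf : Continuous f) :
    ∫ ω, f (sphereMap L ω) ∂sphereMeasure = ∫ ω, f ω ∂sphereMeasure := by
  have h := sphereMap_measurePreserving L
  conv_rhs => rw [← h.map_eq]
  rw [integral_map h.aemeasurable hf.aestronglyMeasurable]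

/-- The rotation by `t` in the plane of the coordinates `x` and `y`. -/
noncomputable def planeRotation {x y z : Fin 3} (hxy : x ≠ y) (hyz : y ≠ z) (hzx : z ≠ x) (t : ℝ) :
    EuclideanSpace ℝ (Fin 3) ≃ₗᵢ[ℝ] EuclideanSpace ℝ (Fin 3) where
  toFun v := WithLp.toLp 2 fun i =>
    if i = x then v x * Real.cos t - v y * Real.sin t
    else if i = y then v x * Real.sin t + v y * Real.cos t else v i
  invFun v := WithLp.toLp 2 fun i =>
    if i = x then v x * Real.cos t + v y * Real.sin t
    else if i = y then -v x * Real.sin t + v y * Real.cos t else v i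
  map_add' u v := by
    ext i
    simp only [PiLp.add_apply]
    split_ifs <;> ring
  map_smul' c v := by
    ext i
    simp only [PiLp.smul_apply, smul_eq_mul, RingHom.id_apply]
    split_ifs <;> ring
  left_inv v := by
    have h := Real.sin_sq_add_cos_sq t
    ext i
    simp only [if_neg hxy.symm, if_true]
    split_ifs with h1 h2
    · subst h1; linear_combination v i * h
    · subst h2; linear_combination v i * h
    · rfl
  right_inv v := by
    have h := Real.sin_sq_add_cos_sq t
    ext i
    simp only [if_neg hxy.symm, if_true]
    split_ifs with h1 h2
    · subst h1; linear_combination v i * h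
    · subst h2; linear_combination v i * h
    · rfl
  norm_map' v := by
    have h := Real.sin_sq_add_cos_sq t
    have hsum : ∀ f : Fin 3 → ℝ, ∑ i, f i = f x + f y + f z := by
      intro f
      have : (Finset.univ : Finset (Fin 3)) = {x, y, z} := by
        revert x y z; decide
      rw [this, Finset.sum_insert (by simp [hxy, hzx.symm]), Finset.sum_insert (by simp [hyz]),
        Finset.sum_singleton, add_assoc]
    simp only [LinearEquiv.coe_mk, LinearMap.coe_mk, AddHom.coe_mk]
    rw [EuclideanSpace.norm_eq, EuclideanSpace.norm_eq, hsum, hsum]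
    simp only [if_neg hxy.symm, if_neg hyz.symm, if_neg hzx, if_true, Real.norm_eq_abs, sq_abs]
    congr 1
    linear_combination (v x ^ 2 + v y ^ 2) * h

/-- The rotation by `t` about the third axis. -/
noncomputable def rotZ (t : ℝ) : Sphere2 → Sphere2 :=
  sphereMap (planeRotation (x := 0) (y := 1) (z := 2) (by decide) (by decide) (by decide) t)

/-- The rotation by `t` about the second axis. -/
noncomputable def rotY (t : ℝ) : Sphere2 → Sphere2 :=
  sphereMap (planeRotation (x := 2) (y := 0) (z := 1) (by decide) (by decide) (by decide) t)

theorem rotationExp_Sz_mul_spinAlong (n : ℕ) (t : ℝ) (ω : Sphere2) :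
    rotationExp (Sz n) t * spinAlong n ω = spinAlong n (rotZ t ω) * rotationExp (Sz n) t :=
  (isSpinTriple_spin n).rotationExp_mul _ _ _ _

theorem rotationExp_Sy_mul_spinAlong (n : ℕ) (t : ℝ) (ω : Sphere2) :
    rotationExp (Sy n) t * spinAlong n ω = spinAlong n (rotY t ω) * rotationExp (Sy n) t := by
  have h := (isSpinTriple_spin n).cycle.rotationExp_mul (ω.1 2) (ω.1 0) (ω.1 1) t
  have e : ∀ ω, spinAlong n ω = ((ω.1 2 : ℝ) : ℂ) • Sz n + ((ω.1 0 : ℝ) : ℂ) • Sx n +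
      ((ω.1 1 : ℝ) : ℂ) • Sy n := fun ω => by rw [spinAlong]; abel
  rw [e, e]
  exact h

/-- A rotation taking the third axis to `ω`, in all representations at once. -/
theorem exists_frame (ω : Sphere2) : ∃ θ φ : ℝ, ∀ n,
    rotationExp (Sz n) φ * rotationExp (Sy n) θ * Sz n =
      spinAlong n ω * (rotationExp (Sz n) φ * rotationExp (Sy n) θ) := by
  have hω : ω.1 0 ^ 2 + ω.1 1 ^ 2 + ω.1 2 ^ 2 = 1 := by
    have h := ω.2
    rw [mem_sphere_zero_iff_norm, EuclideanSpace.norm_eq, Real.sqrt_eq_one, Fin.sum_univ_three] at h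
    simpa using h
  set z : ℂ := ⟨ω.1 0, ω.1 1⟩ with hz
  have hzn : ‖z‖ = Real.sin (Real.arccos (ω.1 2)) := by
    rw [Real.sin_arccos, Complex.norm_def, Complex.normSq_mk]
    congr 1
    linarith
  have hc : Real.cos (Real.arccos (ω.1 2)) = ω.1 2 :=
    Real.cos_arccos (by nlinarith [sq_nonneg (ω.1 0), sq_nonneg (ω.1 1)])
      (by nlinarith [sq_nonneg (ω.1 0), sq_nonneg (ω.1 1)])
  -- Spherical coordinates of `ω`, chosen before `n` so that the same rotation can act on both
  -- tensor factors. At the poles `‖z‖ = 0`, so the value of the argument does not matter.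
  refine ⟨Real.arccos (ω.1 2), Complex.arg z, fun n => ?_⟩
  have h1 := (isSpinTriple_spin n).cycle.rotationExp_mul 1 0 0 (Real.arccos (ω.1 2))
  have h2 := (isSpinTriple_spin n).rotationExp_mul ‖z‖ 0 (ω.1 2) (Complex.arg z)
  have hre : ‖z‖ * Real.cos (Complex.arg z) = ω.1 0 := Complex.norm_mul_cos_arg z
  have him : ‖z‖ * Real.sin (Complex.arg z) = ω.1 1 := Complex.norm_mul_sin_arg z
  simp only [Complex.ofReal_one, one_smul, Complex.ofReal_zero, zero_smul, add_zero, one_mul,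
    zero_mul, sub_zero, hc, ← hzn] at h1
  simp only [zero_mul, sub_zero, add_zero, hre, him, Complex.ofReal_zero, zero_smul] at h2
  rw [Matrix.mul_assoc, h1, ← Matrix.mul_assoc, add_comm (((ω.1 2 : ℝ) : ℂ) • Sz n), h2,
    Matrix.mul_assoc, spinAlong]

/-! ### Integrals of covariant operator fields -/

/-- The entrywise integral of a matrix valued function over the sphere. -/
noncomputable def matInt {ι κ : Type*} (F : Sphere2 → Matrix ι κ ℂ) : Matrix ι κ ℂ :=
  Matrix.of fun a b => ∫ ω, F ω a b ∂sphereMeasure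

theorem integrable_of_continuous {f : Sphere2 → ℂ} (hf : Continuous f) :
    Integrable f sphereMeasure :=
  hf.integrable_of_hasCompactSupport (HasCompactSupport.of_compactSpace f)

theorem matInt_sphereMap (L : EuclideanSpace ℝ (Fin 3) ≃ₗᵢ[ℝ] EuclideanSpace ℝ (Fin 3))
    {ι : Type*} {F : Sphere2 → Matrix ι ι ℂ} (hF : Continuous F) :
    matInt (fun ω => F (sphereMap L ω)) = matInt F := by
  ext a b
  exact integral_sphereMap L (fun ω => F ω a b) (hF.matrix_elem a b)

section MatInt

variable {ι κ : Type*} [Fintype ι]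

theorem matInt_map (φ : Matrix ι ι ℂ →ₗ[ℂ] Matrix κ κ ℂ) {F : Sphere2 → Matrix ι ι ℂ}
    (hF : Continuous F) : matInt (fun ω => φ (F ω)) = φ (matInt F) := by
  classical
  have e : ∀ M a b, φ M a b = ∑ i, ∑ j, M i j * φ (Matrix.single i j 1) a b := by
    intro M a b
    conv_lhs => rw [Matrix.matrix_eq_sum_single M]
    simp only [map_sum, Matrix.sum_apply]
    refine Finset.sum_congr rfl fun i _ => Finset.sum_congr rfl fun j _ => ?_
    rw [← mul_one (M i j), ← smul_eq_mul (M i j), ← Matrix.smul_single, map_smul,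
      Matrix.smul_apply, smul_eq_mul, smul_eq_mul, mul_one]
  ext a b
  rw [e]
  simp only [matInt, Matrix.of_apply]
  simp only [e (F _)]
  have hi : ∀ i j, Integrable (fun ω => F ω i j * φ (Matrix.single i j 1) a b) sphereMeasure :=
    fun i j => (integrable_of_continuous (hF.matrix_elem i j)).mul_const _
  rw [integral_finsetSum _ fun i _ => integrable_finsetSum _ fun j _ => hi i j]
  refine Finset.sum_congr rfl fun i _ => ?_
  rw [integral_finsetSum _ fun j _ => hi i j]
  exact Finset.sum_congr rfl fun j _ => integral_mul_const _ _

theorem matInt_mul_left (A : Matrix ι ι ℂ) {F : Sphere2 → Matrix ι ι ℂ} (hF : Continuous F) :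
    matInt (fun ω => A * F ω) = A * matInt F :=
  matInt_map (LinearMap.mulLeft ℂ A) hF

theorem matInt_mul_right (A : Matrix ι ι ℂ) {F : Sphere2 → Matrix ι ι ℂ} (hF : Continuous F) :
    matInt (fun ω => F ω * A) = matInt F * A :=
  matInt_map (LinearMap.mulRight ℂ A) hF

theorem trace_matInt {F : Sphere2 → Matrix ι ι ℂ} (hF : Continuous F) :
    (matInt F).trace = ∫ ω, (F ω).trace ∂sphereMeasure := by
  simp only [Matrix.trace, Matrix.diag, matInt, Matrix.of_apply]
  rw [integral_finsetSum _ fun i _ => integrable_of_continuous (hF.matrix_elem i i)]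

/-- A change of variables by the rotation shows that the integral commutes with every `rotationExp A
t`, hence with the generator. -/
theorem matInt_commute_of_covariant [DecidableEq ι] {A : Matrix ι ι ℂ} {F : Sphere2 → Matrix ι ι ℂ}
    (hF : Continuous F)
    (L : ℝ → EuclideanSpace ℝ (Fin 3) ≃ₗᵢ[ℝ] EuclideanSpace ℝ (Fin 3))
    (h : ∀ t ω, rotationExp A t * F ω = F (sphereMap (L t) ω) * rotationExp A t) :
    A * matInt F = matInt F * A := by
  refine commute_of_rotationExp_commute fun t => ?_
  rw [← matInt_mul_left _ hF]
  simp only [h]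
  rw [matInt_mul_right (F := fun ω => F (sphereMap (L t) ω)) _
    (hF.comp (continuous_sphereMap (L t))), matInt_sphereMap _ hF]

end MatInt

/-! ### Spectral projections of `ω · S` -/

theorem mul_aeval_of_mul_eq {ι : Type*} [Fintype ι] [DecidableEq ι] {g A B : Matrix ι ι ℂ}
    (h : g * A = B * g) (p : Polynomial ℂ) :
    g * Polynomial.aeval A p = Polynomial.aeval B p * g := by
  induction p using Polynomial.induction_on' with
  | add p q hp hq => rw [map_add, map_add, mul_add, add_mul, hp, hq]
  | monomial n c =>
    have : g * A ^ n = B ^ n * g := (SemiconjBy.pow_right (show SemiconjBy g A B from h) n)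
    rw [Polynomial.aeval_monomial, Polynomial.aeval_monomial, mul_assoc, ← this,
      ← mul_assoc, ← mul_assoc, Algebra.commutes]

/-- The spectral projection of `ω · S` of eigenvalue `mag n a`. -/
noncomputable def spinProj (n : ℕ) (a : Fin (n + 1)) (ω : Sphere2) : Operator n :=
  Polynomial.aeval (spinAlong n ω)
    (Lagrange.basis Finset.univ (fun b : Fin (n + 1) => (mag n b : ℂ)) a)

theorem mag_injective (n : ℕ) : Function.Injective fun b : Fin (n + 1) => (mag n b : ℂ) := by
  intro a b h
  have h3 : mag n a = mag n b := Complex.ofReal_injective h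
  have h4 : ((a : ℕ) : ℝ) = (b : ℕ) := by simpa [mag] using h3
  exact Fin.ext (by exact_mod_cast h4)

/-- The Lagrange polynomial at the distinct eigenvalues is 1 at one of them and 0 at the others. For
a general `ω`, `spinProj` is the conjugate of this matrix unit by a frame. -/
theorem aeval_Sz_basis (n : ℕ) (a : Fin (n + 1)) :
    Polynomial.aeval (Sz n)
      (Lagrange.basis Finset.univ (fun b : Fin (n + 1) => (mag n b : ℂ)) a) =
      Matrix.single a a 1 := by
  have h := Polynomial.aeval_algHom_apply (Matrix.diagonalAlgHom (n := Fin (n + 1)) (α := ℂ) ℂ)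
    (fun b => (mag n b : ℂ)) (Lagrange.basis Finset.univ (fun b : Fin (n + 1) => (mag n b : ℂ)) a)
  change Polynomial.aeval (Sz n) _ = Matrix.diagonal _ at h
  rw [h, ← Matrix.diagonal_single]
  congr 1
  ext b
  have h2 := Polynomial.aeval_algHom_apply (Pi.evalAlgHom ℂ (fun _ : Fin (n + 1) => ℂ) b)
    (fun b => (mag n b : ℂ)) (Lagrange.basis Finset.univ (fun b : Fin (n + 1) => (mag n b : ℂ)) a)
  simp only [Pi.evalAlgHom_apply, Polynomial.coe_aeval_eq_eval] at h2
  rw [← h2]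
  by_cases hab : b = a
  · subst hab
    rw [Lagrange.eval_basis_self ((mag_injective n).injOn) (Finset.mem_univ _), Pi.single_eq_same]
  · rw [Pi.single_eq_of_ne hab]
    exact Lagrange.eval_basis_of_ne (v := fun b : Fin (n + 1) => (mag n b : ℂ)) (Ne.symm hab)
      (Finset.mem_univ b)

theorem mul_spinProj_of_mul_eq {n : ℕ} {ω ω' : Sphere2} {g : Operator n}
    (h : g * spinAlong n ω = spinAlong n ω' * g) (a : Fin (n + 1)) :
    g * spinProj n a ω = spinProj n a ω' * g :=
  mul_aeval_of_mul_eq h _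

theorem spinProj_of_frame {n : ℕ} {ω : Sphere2} {g : Operator n}
    (hg : g ∈ Matrix.unitaryGroup (Fin (n + 1)) ℂ) (h : g * Sz n = spinAlong n ω * g)
    (a : Fin (n + 1)) : spinProj n a ω = g * Matrix.single a a 1 * gᴴ := by
  rw [← aeval_Sz_basis, mul_aeval_of_mul_eq h, Matrix.mul_assoc, ← Matrix.star_eq_conjTranspose,
    Matrix.mem_unitaryGroup_iff.1 hg, Matrix.mul_one]
  rfl

theorem continuous_spinAlong (n : ℕ) : Continuous (spinAlong n) := by
  have h : ∀ i, Continuous fun ω : Sphere2 => ((ω.1 i : ℝ) : ℂ) := fun i => by fun_prop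
  exact (((h 0).smul continuous_const).add ((h 1).smul continuous_const)).add
    ((h 2).smul continuous_const)

theorem continuous_spinProj (n : ℕ) (a : Fin (n + 1)) : Continuous (spinProj n a) :=
  (Polynomial.continuous_aeval _).comp (continuous_spinAlong n)

theorem frame_mem_unitaryGroup (n : ℕ) (θ φ : ℝ) :
    rotationExp (Sz n) φ * rotationExp (Sy n) θ ∈ Matrix.unitaryGroup (Fin (n + 1)) ℂ :=
  mul_mem (rotationExp_mem_unitaryGroup (isSpinTriple_spin n).hermZ φ)
    (rotationExp_mem_unitaryGroup (isSpinTriple_spin n).hermY θ)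

theorem exists_unitary_frame (n : ℕ) (ω : Sphere2) :
    ∃ g ∈ Matrix.unitaryGroup (Fin (n + 1)) ℂ, g * Sz n = spinAlong n ω * g := by
  obtain ⟨θ, φ, h⟩ := exists_frame ω
  exact ⟨_, frame_mem_unitaryGroup n θ φ, h n⟩

/-- The choice of eigenvector carries an arbitrary phase and no regularity in `ω`. Its rank one
projection is a polynomial in `spinAlong n ω`, so the phase disappears and continuity in `ω` is
automatic. -/
theorem vecMulVec_of_isSpinState {n : ℕ} {ω : Sphere2} {a : Fin (n + 1)} {ψ : Fin (n + 1) → ℂ}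
    (h : IsSpinState n ω (mag n a) ψ) : Matrix.vecMulVec ψ (star ψ) = spinProj n a ω := by
  obtain ⟨g, hg, hgz⟩ := exists_unitary_frame n ω
  have h1 : gᴴ * g = 1 := Matrix.mem_unitaryGroup_iff'.1 hg
  have h2 : g * gᴴ = 1 := Matrix.mem_unitaryGroup_iff.1 hg
  rw [spinProj_of_frame hg hgz]
  set φ := gᴴ *ᵥ ψ with hφ
  have hψ : ψ = g *ᵥ φ := by rw [hφ, Matrix.mulVec_mulVec, h2, Matrix.one_mulVec]
  have hz : Sz n *ᵥ φ = (mag n a : ℂ) • φ := by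
    have e : Sz n = gᴴ * (spinAlong n ω * g) := by
      rw [← hgz, ← Matrix.mul_assoc, h1, Matrix.one_mul]
    rw [e, ← Matrix.mulVec_mulVec, ← Matrix.mulVec_mulVec, ← hψ, h.2, Matrix.mulVec_smul]
  have hφ0 : ∀ b, b ≠ a → φ b = 0 := by
    intro b hb
    have := congrFun hz b
    rw [Sz, Matrix.mulVec_diagonal, Pi.smul_apply, smul_eq_mul, ← sub_eq_zero, ← sub_mul,
      mul_eq_zero] at this
    exact this.resolve_left fun h0 => hb (mag_injective n (sub_eq_zero.1 h0))
  have hn : star φ ⬝ᵥ φ = 1 := by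
    rw [hφ, Matrix.star_mulVec, Matrix.conjTranspose_conjTranspose, ← Matrix.dotProduct_mulVec,
      Matrix.mulVec_mulVec, h2, Matrix.one_mulVec, h.1]
  have hs : Matrix.vecMulVec φ (star φ) = Matrix.single a a 1 := by
    ext b c
    rw [Matrix.vecMulVec_apply, Pi.star_apply]
    by_cases hb : b = a
    · by_cases hc : c = a
      · rw [dotProduct, Finset.sum_eq_single a (fun x _ hx => by rw [hφ0 x hx, mul_zero])
          (by simp), Pi.star_apply] at hn
        rw [hb, hc, mul_comm, hn, Matrix.single_apply_same]
      · rw [hφ0 c hc, star_zero, mul_zero, Matrix.single_apply_of_ne]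
        exact fun h => hc h.2.symm
    · rw [hφ0 b hb, zero_mul, Matrix.single_apply_of_ne]
      exact fun h => hb h.1.symm
  rw [← hs, Matrix.mul_vecMulVec, Matrix.vecMulVec_mul, ← hψ, ← Matrix.star_mulVec, ← hψ]

theorem exists_isSpinState (n : ℕ) (ω : Sphere2) (a : Fin (n + 1)) :
    ∃ ψ, IsSpinState n ω (mag n a) ψ := by
  obtain ⟨g, hg, hgz⟩ := exists_unitary_frame n ω
  have h1 : gᴴ * g = 1 := Matrix.mem_unitaryGroup_iff'.1 hg
  refine ⟨g *ᵥ Pi.single a 1, ?_, ?_⟩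
  · rw [Matrix.star_mulVec, ← Matrix.dotProduct_mulVec, Matrix.mulVec_mulVec, h1,
      Matrix.one_mulVec]
    simp
  · rw [Matrix.mulVec_mulVec, ← hgz, ← Matrix.mulVec_mulVec, ← Matrix.mulVec_smul]
    congr 1
    ext b
    rw [Sz, Matrix.mulVec_diagonal, Pi.smul_apply, smul_eq_mul]
    by_cases hb : b = a
    · rw [hb]
    · rw [Pi.single_eq_of_ne hb, mul_zero, mul_zero]

theorem spinState_spec (n : ℕ) (ω : Sphere2) (a : Fin (n + 1)) :
    IsSpinState n ω (mag n a) (spinState n ω (mag n a)) :=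
  Classical.epsilon_spec (exists_isSpinState n ω a)

theorem hus_mag {n : ℕ} (a : Fin (n + 1)) (ρ : Operator n) (ω : Sphere2) :
    hus n (mag n a) ρ ω = (ρ * spinProj n a ω).trace := by
  rw [hus, ← vecMulVec_of_isSpinState (spinState_spec n ω a), Matrix.mul_vecMulVec,
    Matrix.trace_vecMulVec, dotProduct_comm]

theorem mag_last (n : ℕ) : mag n (Fin.last n) = spin n := by
  simp only [mag, spin, Fin.val_last]
  ring

theorem mag_rev {n : ℕ} (a : Fin (n + 1)) : mag n a.rev = -mag n a := by
  have h : (a : ℕ) ≤ n := Nat.lt_succ_iff.1 a.is_lt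
  simp only [mag, spin, Fin.val_rev, Nat.add_sub_add_right, Nat.cast_sub h]
  ring

theorem op_eq (n : ℕ) (f : Sphere2 → ℂ) :
    op n f = ((n : ℂ) + 1) • matInt fun ω => f ω • spinProj n (Fin.last n) ω := by
  ext a b
  simp only [op, matInt, Matrix.of_apply, Matrix.smul_apply, smul_eq_mul]
  congr 1
  · simp only [spin]; push_cast; ring
  · congr 1
    ext ω
    rw [← vecMulVec_of_isSpinState (spinState_spec n ω (Fin.last n)), mag_last]

theorem spinProj_trace (n : ℕ) (a : Fin (n + 1)) (ω : Sphere2) : (spinProj n a ω).trace = 1 := by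
  rw [← vecMulVec_of_isSpinState (spinState_spec n ω a), Matrix.trace_vecMulVec, dotProduct_comm,
    (spinState_spec n ω a).1]

theorem rotationExp_Sz_mul_spinProj (n : ℕ) (a : Fin (n + 1)) (t : ℝ) (ω : Sphere2) :
    rotationExp (Sz n) t * spinProj n a ω = spinProj n a (rotZ t ω) * rotationExp (Sz n) t :=
  mul_spinProj_of_mul_eq (rotationExp_Sz_mul_spinAlong n t ω) a

theorem rotationExp_Sy_mul_spinProj (n : ℕ) (a : Fin (n + 1)) (t : ℝ) (ω : Sphere2) :
    rotationExp (Sy n) t * spinProj n a ω = spinProj n a (rotY t ω) * rotationExp (Sy n) t :=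
  mul_spinProj_of_mul_eq (rotationExp_Sy_mul_spinAlong n t ω) a

/-- Since `X` is a multiple of the commutator of `Y` and `Z`, invariance need only be checked for
rotations about two axes. -/
theorem IsSpinTriple.commute_first {ι : Type*} [Fintype ι] {X Y Z W : Matrix ι ι ℂ}
    (h : IsSpinTriple X Y Z) (hy : Y * W = W * Y) (hz : Z * W = W * Z) : X * W = W * X := by
  have e : (Complex.I • X) * W = W * (Complex.I • X) := by
    rw [← h.yz, sub_mul, mul_sub, mul_assoc, hz, ← mul_assoc, hy, mul_assoc Z, hy, ← mul_assoc Z,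
      hz, mul_assoc, mul_assoc]
  rw [smul_mul_assoc, mul_smul_comm] at e
  exact smul_right_injective _ Complex.I_ne_zero e

/-- The resolution of the identity: the integral is invariant, hence scalar by Schur's lemma, and
its trace is one. -/
theorem matInt_spinProj (n : ℕ) (a : Fin (n + 1)) :
    matInt (spinProj n a) = ((n : ℂ) + 1)⁻¹ • 1 := by
  have hF := continuous_spinProj n a
  have hz : Sz n * matInt (spinProj n a) = matInt (spinProj n a) * Sz n :=
    matInt_commute_of_covariant hF _ (rotationExp_Sz_mul_spinProj n a)
  have hy : Sy n * matInt (spinProj n a) = matInt (spinProj n a) * Sy n :=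
    matInt_commute_of_covariant hF _ (rotationExp_Sy_mul_spinProj n a)
  have hx := (isSpinTriple_spin n).commute_first hy hz
  rw [IsIntertwiner.eq_smul_one ⟨hx, hy, hz⟩, trace_matInt hF]
  simp [spinProj_trace]

/-! ### Invariant tensor operators and their partial traces -/

/-- `W` commutes with the action of the generators on the tensor product. -/
structure CommutesWithTensor (j k : ℕ) (W : TensorOperator j k) : Prop where
  x : tensorGenerator j k (Sx j) (Sx k) * W = W * tensorGenerator j k (Sx j) (Sx k)
  y : tensorGenerator j k (Sy j) (Sy k) * W = W * tensorGenerator j k (Sy j) (Sy k)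
  z : tensorGenerator j k (Sz j) (Sz k) * W = W * tensorGenerator j k (Sz j) (Sz k)

theorem continuous_kronecker_spinProj (j k : ℕ) (a : Fin (j + 1)) (b : Fin (k + 1)) :
    Continuous fun ω => spinProj j a ω ⊗ₖ spinProj k b ω :=
  continuous_matrix fun x y => ((continuous_spinProj j a).matrix_elem x.1 y.1).mul
    ((continuous_spinProj k b).matrix_elem x.2 y.2)

theorem matInt_kronecker_commutes (j k : ℕ) (a : Fin (j + 1)) (b : Fin (k + 1)) :
    CommutesWithTensor j k (matInt fun ω => spinProj j a ω ⊗ₖ spinProj k b ω) := by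
  have hF := continuous_kronecker_spinProj j k a b
  have hz : tensorGenerator j k (Sz j) (Sz k) *
      matInt (fun ω => spinProj j a ω ⊗ₖ spinProj k b ω) =
      matInt (fun ω => spinProj j a ω ⊗ₖ spinProj k b ω) * tensorGenerator j k (Sz j) (Sz k) := by
    refine matInt_commute_of_covariant hF (fun t => planeRotation (x := 0) (y := 1) (z := 2)
      (by decide) (by decide) (by decide) t) fun t ω => ?_
    rw [rotationExp_tensorGenerator, ← Matrix.mul_kronecker_mul, ← Matrix.mul_kronecker_mul,
      rotationExp_Sz_mul_spinProj, rotationExp_Sz_mul_spinProj]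
    rfl
  have hy : tensorGenerator j k (Sy j) (Sy k) *
      matInt (fun ω => spinProj j a ω ⊗ₖ spinProj k b ω) =
      matInt (fun ω => spinProj j a ω ⊗ₖ spinProj k b ω) * tensorGenerator j k (Sy j) (Sy k) := by
    refine matInt_commute_of_covariant hF (fun t => planeRotation (x := 2) (y := 0) (z := 1)
      (by decide) (by decide) (by decide) t) fun t ω => ?_
    rw [rotationExp_tensorGenerator, ← Matrix.mul_kronecker_mul, ← Matrix.mul_kronecker_mul,
      rotationExp_Sy_mul_spinProj, rotationExp_Sy_mul_spinProj]
    rfl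
  exact ⟨((isSpinTriple_spin j).tensor (isSpinTriple_spin k)).commute_first hy hz, hy, hz⟩

/-- The partial trace over the second tensor factor. -/
def partialTraceRight {j k : ℕ} (X : TensorOperator j k) : Operator j :=
  Matrix.of fun a a' => ∑ b, X (a, b) (a', b)

theorem trace_partialTraceLeft_mul {j k : ℕ} (X : TensorOperator j k) (B : Operator k) :
    (partialTraceLeft X * B).trace = (X * ((1 : Operator j) ⊗ₖ B)).trace := by
  simp only [Matrix.trace, Matrix.diag, Matrix.mul_apply, partialTraceLeft, Matrix.of_apply,
    Fintype.sum_prod_type, Matrix.kroneckerMap_apply, Matrix.one_apply, Finset.sum_mul]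
  rw [Finset.sum_comm' (t' := Finset.univ) (s' := fun _ => Finset.univ) (by simp)]
  simp only [ite_mul, one_mul, zero_mul, mul_ite, mul_zero]
  conv_rhs => rw [Finset.sum_comm]
  rw [Finset.sum_comm]
  refine Finset.sum_congr rfl fun b _ => ?_
  conv_rhs => enter [2, a]; rw [Finset.sum_comm]
  simp only [Finset.sum_ite_eq', Finset.mem_univ, if_true]
  rw [Finset.sum_comm]

theorem trace_partialTraceRight_mul {j k : ℕ} (X : TensorOperator j k) (A : Operator j) :
    (partialTraceRight X * A).trace = (X * (A ⊗ₖ (1 : Operator k))).trace := by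
  simp only [Matrix.trace, Matrix.diag, Matrix.mul_apply, partialTraceRight, Matrix.of_apply,
    Fintype.sum_prod_type, Matrix.kroneckerMap_apply, Matrix.one_apply, Finset.sum_mul]
  simp only [mul_ite, mul_zero, mul_one]
  refine Finset.sum_congr rfl fun a _ => ?_
  rw [Finset.sum_comm]
  simp only [Finset.sum_ite_eq', Finset.mem_univ, if_true]

theorem eq_of_trace_mul {n : ℕ} {A B : Operator n} (h : ∀ C, (A * C).trace = (B * C).trace) :
    A = B :=
  Matrix.ext_iff_trace_mul_right.2 h

theorem kronecker_one_mul_one_kronecker {j k : ℕ} (A : Operator j) (B : Operator k) :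
    (A ⊗ₖ (1 : Operator k)) * ((1 : Operator j) ⊗ₖ B) = A ⊗ₖ B := by
  rw [← Matrix.mul_kronecker_mul, Matrix.mul_one, Matrix.one_mul]

theorem one_kronecker_mul_kronecker_one {j k : ℕ} (A : Operator j) (B : Operator k) :
    ((1 : Operator j) ⊗ₖ B) * (A ⊗ₖ (1 : Operator k)) = A ⊗ₖ B := by
  rw [← Matrix.mul_kronecker_mul, Matrix.mul_one, Matrix.one_mul]

/-- Paired with a test operator `C`, the element `1 ⊗ B` is replaced by the full generator minus `A
⊗ 1`. The generator moves past `W` by hypothesis and around the trace by cyclicity, while `A ⊗ 1`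
commutes with `1 ⊗ C`. -/
theorem partialTraceLeft_commute {j k : ℕ} {A : Operator j} {B : Operator k}
    {W : TensorOperator j k}
    (h : tensorGenerator j k A B * W = W * tensorGenerator j k A B) :
    B * partialTraceLeft W = partialTraceLeft W * B := by
  refine eq_of_trace_mul fun C => ?_
  have e : (1 : Operator j) ⊗ₖ B = tensorGenerator j k A B - A ⊗ₖ (1 : Operator k) := by
    rw [tensorGenerator]; abel
  rw [Matrix.mul_assoc B, Matrix.trace_mul_comm B, Matrix.mul_assoc, Matrix.mul_assoc,
    trace_partialTraceLeft_mul, trace_partialTraceLeft_mul]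
  have m1 : ∀ P Q : Operator k, (1 : Operator j) ⊗ₖ (P * Q) = (1 ⊗ₖ P) * (1 ⊗ₖ Q) := fun P Q => by
    rw [← Matrix.mul_kronecker_mul, Matrix.one_mul]
  rw [m1, m1, e, mul_sub, sub_mul, mul_sub, mul_sub, Matrix.trace_sub, Matrix.trace_sub]
  congr 1
  · rw [← Matrix.mul_assoc, Matrix.trace_mul_comm, ← Matrix.mul_assoc, h, Matrix.mul_assoc]
  · rw [kronecker_one_mul_one_kronecker, one_kronecker_mul_kronecker_one]

theorem partialTraceRight_commute {j k : ℕ} {A : Operator j} {B : Operator k}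
    {W : TensorOperator j k}
    (h : tensorGenerator j k A B * W = W * tensorGenerator j k A B) :
    A * partialTraceRight W = partialTraceRight W * A := by
  refine eq_of_trace_mul fun C => ?_
  have e : A ⊗ₖ (1 : Operator k) = tensorGenerator j k A B - (1 : Operator j) ⊗ₖ B := by
    rw [tensorGenerator]; abel
  rw [Matrix.mul_assoc A, Matrix.trace_mul_comm A, Matrix.mul_assoc, Matrix.mul_assoc,
    trace_partialTraceRight_mul, trace_partialTraceRight_mul]
  have m1 : ∀ P Q : Operator j, (P * Q) ⊗ₖ (1 : Operator k) = (P ⊗ₖ 1) * (Q ⊗ₖ 1) := fun P Q => by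
    rw [← Matrix.mul_kronecker_mul, Matrix.one_mul]
  rw [m1, m1, e, mul_sub, sub_mul, mul_sub, mul_sub, Matrix.trace_sub, Matrix.trace_sub]
  congr 1
  · rw [← Matrix.mul_assoc, Matrix.trace_mul_comm, ← Matrix.mul_assoc, h, Matrix.mul_assoc]
  · rw [kronecker_one_mul_one_kronecker, one_kronecker_mul_kronecker_one]

theorem trace_partialTraceLeft {j k : ℕ} (X : TensorOperator j k) :
    (partialTraceLeft X).trace = X.trace := by
  have := trace_partialTraceLeft_mul X 1
  rwa [Matrix.mul_one, Matrix.one_kronecker_one, Matrix.mul_one] at this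

theorem trace_partialTraceRight {j k : ℕ} (X : TensorOperator j k) :
    (partialTraceRight X).trace = X.trace := by
  have := trace_partialTraceRight_mul X 1
  rwa [Matrix.mul_one, Matrix.one_kronecker_one, Matrix.mul_one] at this

theorem CommutesWithTensor.partialTraceLeft_eq {j k : ℕ} {W : TensorOperator j k}
    (h : CommutesWithTensor j k W) :
    partialTraceLeft W = (W.trace / (k + 1)) • (1 : Operator k) := by
  rw [← trace_partialTraceLeft]
  exact IsIntertwiner.eq_smul_one ⟨partialTraceLeft_commute h.x, partialTraceLeft_commute h.y,
    partialTraceLeft_commute h.z⟩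

theorem CommutesWithTensor.partialTraceRight_eq {j k : ℕ} {W : TensorOperator j k}
    (h : CommutesWithTensor j k W) :
    partialTraceRight W = (W.trace / (j + 1)) • (1 : Operator j) := by
  rw [← trace_partialTraceRight]
  exact IsIntertwiner.eq_smul_one ⟨partialTraceRight_commute h.x, partialTraceRight_commute h.y,
    partialTraceRight_commute h.z⟩

/-! ### Clebsch–Gordan weights of product states -/

/-- The tensor product of two vectors. -/
def tensorVec {ι κ : Type*} (u : ι → ℂ) (w : κ → ℂ) : ι × κ → ℂ := fun x => u x.1 * w x.2

theorem tensorGenerator_mulVec_tensorVec {j k : ℕ} (A : Operator j) (B : Operator k)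
    (u : Fin (j + 1) → ℂ) (w : Fin (k + 1) → ℂ) :
    tensorGenerator j k A B *ᵥ tensorVec u w = tensorVec (A *ᵥ u) w + tensorVec u (B *ᵥ w) := by
  ext ⟨a, b⟩
  rw [tensorGenerator_mulVec]
  simp only [tensorVec, Pi.add_apply, Matrix.mulVec, dotProduct, Finset.sum_mul, Finset.mul_sum]
  congr 1
  · exact Finset.sum_congr rfl fun x _ => by ring
  · exact Finset.sum_congr rfl fun x _ => by ring

theorem Splus_mulVec_single_last (n : ℕ) : Splus n *ᵥ Pi.single (Fin.last n) 1 = 0 := by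
  ext b
  induction b using Fin.cases with
  | zero => rw [Splus_mulVec_zero, Pi.zero_apply]
  | succ b =>
    rw [Splus_mulVec_succ, Pi.single_eq_of_ne, mul_zero, Pi.zero_apply]
    exact (Fin.castSucc_lt_last b).ne

theorem Splus_mulVec_single_castSucc {n : ℕ} (a : Fin n) :
    Splus n *ᵥ Pi.single a.castSucc 1 =
      ((Real.sqrt (((n : ℝ) - (a : ℕ)) * ((a : ℕ) + 1)) : ℝ) : ℂ) • Pi.single a.succ 1 := by
  ext b
  induction b using Fin.cases with
  | zero =>
    rw [Splus_mulVec_zero, Pi.smul_apply, Pi.single_eq_of_ne (Fin.succ_ne_zero a).symm, smul_zero]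
  | succ b =>
    rw [Splus_mulVec_succ, Pi.smul_apply, smul_eq_mul]
    by_cases h : b = a
    · rw [h, Pi.single_eq_same, Pi.single_eq_same]
    · rw [Pi.single_eq_of_ne, Pi.single_eq_of_ne, mul_zero, mul_zero]
      · simpa using h
      · simpa using h

theorem Sz_mulVec_single {n : ℕ} (a : Fin (n + 1)) :
    Sz n *ᵥ Pi.single a 1 = (mag n a : ℂ) • Pi.single a 1 := by
  ext b
  rw [Sz, Matrix.mulVec_diagonal, Pi.smul_apply, smul_eq_mul]
  by_cases h : b = a
  · rw [h]
  · rw [Pi.single_eq_of_ne h, mul_zero, mul_zero]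

/-- The probability `⟨a, top| P |a, top⟩` of total spin `m / 2` in a product state. -/
noncomputable def cgWeight (j k m : ℕ) (a : Fin (j + 1)) : ℝ :=
  (cgProjection j k m (a, Fin.last k) (a, Fin.last k)).re

/-- The adjoint embedding applied to the product state `|a, top⟩`. -/
noncomputable def cgVec (j k m : ℕ) (a : Fin (j + 1)) : Fin (m + 1) → ℂ :=
  (cgEmbedding j k m)ᴴ *ᵥ tensorVec (Pi.single a 1) (Pi.single (Fin.last k) 1)

theorem tensorVec_single {j k : ℕ} (a : Fin (j + 1)) (b : Fin (k + 1)) :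
    tensorVec (Pi.single a 1) (Pi.single b 1) = Pi.single (a, b) (1 : ℂ) := by
  ext ⟨x, y⟩
  simp only [tensorVec, Pi.single_apply, Prod.mk.injEq]
  by_cases h1 : x = a <;> by_cases h2 : y = b <;> simp [h1, h2]

theorem star_cgVec_dotProduct (j k m : ℕ) (a : Fin (j + 1)) :
    star (cgVec j k m a) ⬝ᵥ cgVec j k m a =
      cgProjection j k m (a, Fin.last k) (a, Fin.last k) := by
  rw [cgVec, Matrix.star_mulVec, Matrix.conjTranspose_conjTranspose, ← Matrix.dotProduct_mulVec,
    Matrix.mulVec_mulVec, tensorVec_single, ← cgProjection]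
  simp

theorem cgWeight_eq (j k m : ℕ) (a : Fin (j + 1)) :
    (cgWeight j k m a : ℂ) = cgProjection j k m (a, Fin.last k) (a, Fin.last k) := by
  rw [cgWeight, ← star_cgVec_dotProduct]
  open scoped ComplexOrder in
  have h : 0 ≤ star (cgVec j k m a) ⬝ᵥ cgVec j k m a := dotProduct_star_self_nonneg _
  exact Complex.ext rfl (Complex.le_def.1 h).2

theorem cgWeight_nonneg (j k m : ℕ) (a : Fin (j + 1)) : 0 ≤ cgWeight j k m a := by
  rw [cgWeight, ← star_cgVec_dotProduct]
  open scoped ComplexOrder in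
  have h : 0 ≤ star (cgVec j k m a) ⬝ᵥ cgVec j k m a := dotProduct_star_self_nonneg _
  exact (Complex.le_def.1 h).1

section CGFacts

variable {j k m : ℕ}

theorem cgProjection_commutes (h : IsEquivariantIsometry j k m (cgEmbedding j k m)) :
    CommutesWithTensor j k (cgProjection j k m) := by
  obtain ⟨c1, c2, c3⟩ := h.conjTranspose_mul
  refine ⟨?_, ?_, ?_⟩
  · rw [cgProjection, ← Matrix.mul_assoc, h.2.1, Matrix.mul_assoc, ← c1, Matrix.mul_assoc]
  · rw [cgProjection, ← Matrix.mul_assoc, h.2.2.1, Matrix.mul_assoc, ← c2, Matrix.mul_assoc]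
  · rw [cgProjection, ← Matrix.mul_assoc, h.2.2.2, Matrix.mul_assoc, ← c3, Matrix.mul_assoc]

theorem cgProjection_trace (h : IsEquivariantIsometry j k m (cgEmbedding j k m)) :
    (cgProjection j k m).trace = m + 1 := by
  rw [cgProjection, Matrix.trace_mul_comm, h.1, Matrix.trace_one]
  simp

/-- The raising operator annihilates the top vector of the second factor, so only the first factor
is raised and a product state with the top vector results again. This is what makes the recursion
two-term. -/
theorem cgVec_raise (h : IsEquivariantIsometry j k m (cgEmbedding j k m)) (a : Fin (j + 1)) :
    Splus m *ᵥ cgVec j k m a = (cgEmbedding j k m)ᴴ *ᵥ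
      tensorVec (Splus j *ᵥ Pi.single a 1) (Pi.single (Fin.last k) 1) := by
  obtain ⟨c1, c2, c3⟩ := h.conjTranspose_mul
  have e : (cgEmbedding j k m)ᴴ * tensorGenerator j k (Splus j) (Splus k) =
      Splus m * (cgEmbedding j k m)ᴴ := by
    rw [← Sx_add_Sy, ← Sx_add_Sy, ← Sx_add_Sy, tensorGenerator_add, tensorGenerator_smul,
      Matrix.mul_add, Matrix.mul_smul, c1, c2, Matrix.add_mul, Matrix.smul_mul]
  have e2 : tensorVec (Splus j *ᵥ Pi.single a 1) (Pi.single (Fin.last k) 1) =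
      tensorGenerator j k (Splus j) (Splus k) *ᵥ
        tensorVec (Pi.single a 1) (Pi.single (Fin.last k) 1) := by
    rw [tensorGenerator_mulVec_tensorVec, Splus_mulVec_single_last]
    ext x
    simp [tensorVec]
  rw [e2, Matrix.mulVec_mulVec, e, ← Matrix.mulVec_mulVec, cgVec]

theorem cgVec_weight (h : IsEquivariantIsometry j k m (cgEmbedding j k m)) (a : Fin (j + 1)) :
    Sz m *ᵥ cgVec j k m a = (((mag j a + spin k : ℝ)) : ℂ) • cgVec j k m a := by
  obtain ⟨c1, c2, c3⟩ := h.conjTranspose_mul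
  have e : tensorGenerator j k (Sz j) (Sz k) *ᵥ
      tensorVec (Pi.single a 1) (Pi.single (Fin.last k) 1) =
      (((mag j a + spin k : ℝ)) : ℂ) • tensorVec (Pi.single a 1) (Pi.single (Fin.last k) 1) := by
    rw [tensorGenerator_mulVec_tensorVec, Sz_mulVec_single, Sz_mulVec_single, mag_last]
    ext x
    simp only [tensorVec, Pi.add_apply, Pi.smul_apply, smul_eq_mul]
    push_cast
    ring
  rw [cgVec, Matrix.mulVec_mulVec, ← c3, ← Matrix.mulVec_mulVec, e, Matrix.mulVec_smul]

theorem norm_raise_cgVec (h : IsEquivariantIsometry j k m (cgEmbedding j k m)) (a : Fin (j + 1)) :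
    star (Splus m *ᵥ cgVec j k m a) ⬝ᵥ (Splus m *ᵥ cgVec j k m a) =
      (((spin m - (mag j a + spin k)) * (spin m + (mag j a + spin k) + 1) *
        cgWeight j k m a : ℝ) : ℂ) := by
  have e : Sminus m * Splus m = ((m : ℂ) / 2 * ((m : ℂ) / 2 + 1)) • 1 - Sz m * Sz m - Sz m := by
    rw [← casimir_spin]; abel
  rw [Matrix.star_mulVec, ← Matrix.dotProduct_mulVec, Matrix.mulVec_mulVec, Splus_conjTranspose, e,
    Matrix.sub_mulVec, Matrix.sub_mulVec, ← Matrix.mulVec_mulVec, cgVec_weight h,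
    Matrix.mulVec_smul, cgVec_weight h, Matrix.smul_mulVec, Matrix.one_mulVec, smul_smul,
    ← sub_smul, ← sub_smul, dotProduct_smul, star_cgVec_dotProduct, ← cgWeight_eq, smul_eq_mul]
  simp only [spin]
  push_cast
  ring

/-- The squared norm of `Splus m *ᵥ cgVec j k m a` is computed in two ways: by the ladder
coefficient in the first factor, and by the Casimir operator of spin `m / 2` at the total weight. -/
theorem cgWeight_succ (h : IsEquivariantIsometry j k m (cgEmbedding j k m)) (a : Fin j) :
    ((j : ℝ) - (a : ℕ)) * ((a : ℕ) + 1) * cgWeight j k m a.succ =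
      (spin m - (mag j a.castSucc + spin k)) * (spin m + (mag j a.castSucc + spin k) + 1) *
        cgWeight j k m a.castSucc := by
  have h1 := norm_raise_cgVec h a.castSucc
  have e : Splus m *ᵥ cgVec j k m a.castSucc =
      ((Real.sqrt (((j : ℝ) - (a : ℕ)) * ((a : ℕ) + 1)) : ℝ) : ℂ) • cgVec j k m a.succ := by
    rw [cgVec_raise h, Splus_mulVec_single_castSucc, cgVec, ← Matrix.mulVec_smul]
    congr 1
    ext x
    simp [tensorVec, mul_assoc]
  have ha : ((a : ℕ) : ℝ) < j := by exact_mod_cast a.is_lt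
  have hs : 0 ≤ ((j : ℝ) - (a : ℕ)) * ((a : ℕ) + 1) := mul_nonneg (by linarith) (by positivity)
  rw [e, star_smul, smul_dotProduct, dotProduct_smul, star_cgVec_dotProduct, ← cgWeight_eq,
    Complex.star_def, Complex.conj_ofReal, smul_eq_mul, smul_eq_mul, ← mul_assoc,
    ← Complex.ofReal_mul, ← Complex.ofReal_mul, Real.mul_self_sqrt hs] at h1
  exact Complex.ofReal_injective h1

theorem cgWeight_last (h : IsEquivariantIsometry j k m (cgEmbedding j k m)) :
    (spin m - (mag j (Fin.last j) + spin k)) * (spin m + (mag j (Fin.last j) + spin k) + 1) *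
        cgWeight j k m (Fin.last j) = 0 := by
  have h1 := norm_raise_cgVec h (Fin.last j)
  have e : Splus m *ᵥ cgVec j k m (Fin.last j) = 0 := by
    rw [cgVec_raise h, Splus_mulVec_single_last]
    have : tensorVec (0 : Fin (j + 1) → ℂ) (Pi.single (Fin.last k) (1 : ℂ)) = 0 := by
      ext x; simp [tensorVec]
    rw [this, Matrix.mulVec_zero]
  rw [e, star_zero, zero_dotProduct] at h1
  exact (Complex.ofReal_eq_zero.1 h1.symm)

/-- The partial trace of an invariant projection is scalar; the sum is its diagonal entry at the top
vector. It normalizes the weights in the index `a`, as `sum_range_cgWeight` does in the total spin.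
-/
theorem sum_cgWeight (h : IsEquivariantIsometry j k m (cgEmbedding j k m)) :
    ∑ a, cgWeight j k m a = ((m : ℝ) + 1) / (k + 1) := by
  have h1 := congrFun (congrFun (cgProjection_commutes h).partialTraceLeft_eq (Fin.last k))
    (Fin.last k)
  rw [cgProjection_trace h, Matrix.smul_apply, Matrix.one_apply_eq, smul_eq_mul, mul_one,
    partialTraceLeft, Matrix.of_apply] at h1
  simp only [← cgWeight_eq] at h1
  apply Complex.ofReal_injective
  push_cast
  exact h1

end CGFacts

theorem sum_range_cgWeight (j k : ℕ) (a : Fin (j + 1)) :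
    ∑ s ∈ Finset.range (min j k + 1), cgWeight j k (j + k - 2 * s) a = 1 := by
  have h := congrFun (congrFun (sum_cgProjection j k) (a, Fin.last k)) (a, Fin.last k)
  rw [Matrix.sum_apply, Matrix.one_apply_eq] at h
  simp only [← cgWeight_eq] at h
  exact_mod_cast h

/-! ### Concentration of the weights -/

section Moments

variable {j k m : ℕ} {A : Fin (j + 1)}

theorem spin_sub_weight (hm : (m : ℝ) = k + 2 * (A : ℕ) - j) (a : Fin (j + 1)) :
    spin m - (mag j a + spin k) = (A : ℕ) - (a : ℕ) := by
  simp only [spin, mag, hm]; ring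

theorem spin_add_weight (hm : (m : ℝ) = k + 2 * (A : ℕ) - j) (a : Fin (j + 1)) :
    spin m + (mag j a + spin k) + 1 = k + (A : ℕ) + (a : ℕ) - j + 1 := by
  simp only [spin, mag, hm]; ring

/-- Beyond `A` the total weight exceeds the spin `m / 2`. In the recursion this appears as the
factor `A - a`, which vanishes at `a = A` and so kills all later weights. -/
theorem cgWeight_eq_zero (h : IsEquivariantIsometry j k m (cgEmbedding j k m))
    (hm : (m : ℝ) = k + 2 * (A : ℕ) - j) (a : Fin (j + 1)) (ha : A < a) :
    cgWeight j k m a = 0 := by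
  induction a using Fin.induction with
  | zero => exact absurd ha (Fin.not_lt_zero A)
  | succ a ih =>
    have hs := cgWeight_succ h a
    rw [spin_sub_weight hm] at hs
    have h0 : ((A : ℕ) - ((a.castSucc : Fin (j + 1)) : ℕ) : ℝ) * (spin m +
        (mag j a.castSucc + spin k) + 1) * cgWeight j k m a.castSucc = 0 := by
      rcases eq_or_lt_of_le (Fin.le_castSucc_iff.2 ha) with h1 | h1
      · rw [h1]; ring
      · rw [ih h1, mul_zero]
    rw [h0, mul_eq_zero] at hs
    refine hs.resolve_left (ne_of_gt ?_)
    have h1 : ((a : ℕ) : ℝ) < j := by exact_mod_cast a.is_lt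
    exact mul_pos (by linarith) (by positivity)

/-- The recursion summed over `a`. The terms quadratic in `a` on its two sides cancel, which leaves
an exact first moment for the distance `A - a`. -/
theorem sum_moment_cgWeight (h : IsEquivariantIsometry j k m (cgEmbedding j k m))
    (hm : (m : ℝ) = k + 2 * (A : ℕ) - j) :
    ((k : ℝ) + 2) * ∑ a : Fin (j + 1), ((A : ℕ) - (a : ℕ) : ℝ) * cgWeight j k m a =
      (A : ℕ) * ((j : ℝ) - (A : ℕ) + 1) * ∑ a, cgWeight j k m a := by
  -- The sums are shifted by one index. The boundary term at the top is zero by `cgWeight_last`, the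
  -- one at `a = 0` because of its factor `a`.
  have e1 : ∑ a : Fin (j + 1), ((A : ℕ) - (a : ℕ) : ℝ) * ((k : ℝ) + (A : ℕ) + (a : ℕ) - j + 1) *
      cgWeight j k m a = ∑ a : Fin (j + 1), ((j : ℝ) - (a : ℕ) + 1) * (a : ℕ) * cgWeight j k m a := by
    have hl := cgWeight_last h
    rw [spin_sub_weight hm, spin_add_weight hm] at hl
    rw [Fin.sum_univ_castSucc, hl, add_zero, Fin.sum_univ_succ]
    simp only [Fin.val_zero, Nat.cast_zero, mul_zero, zero_mul, zero_add]
    refine Finset.sum_congr rfl fun a _ => ?_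
    have hs := cgWeight_succ h a
    rw [spin_sub_weight hm, spin_add_weight hm] at hs
    rw [← hs, Fin.val_succ]
    push_cast
    ring
  rw [Finset.mul_sum, Finset.mul_sum, ← sub_eq_zero, ← Finset.sum_sub_distrib]
  rw [← sub_eq_zero, ← Finset.sum_sub_distrib] at e1
  rw [← e1]
  exact Finset.sum_congr rfl fun a _ => by ring

/-- Markov's inequality: where the weight is nonzero and `a ≠ A`, the distance `A - a` is at least
1, so the mass off `A` is at most the first moment. -/
theorem sum_erase_cgWeight_le (h : IsEquivariantIsometry j k m (cgEmbedding j k m))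
    (hm : (m : ℝ) = k + 2 * (A : ℕ) - j) :
    ∑ a ∈ Finset.univ.erase A, ((k : ℝ) + 1) / (m + 1) * cgWeight j k m a ≤
      (A : ℕ) * ((j : ℝ) - (A : ℕ) + 1) / (k + 2) := by
  have h1 := sum_moment_cgWeight h hm
  rw [sum_cgWeight h] at h1
  have h2 : ∑ a ∈ Finset.univ.erase A, cgWeight j k m a ≤
      ∑ a : Fin (j + 1), ((A : ℕ) - (a : ℕ) : ℝ) * cgWeight j k m a := by
    rw [← Finset.add_sum_erase _ _ (Finset.mem_univ A), sub_self, zero_mul, zero_add]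
    refine Finset.sum_le_sum fun a ha => ?_
    rcases lt_or_gt_of_ne (Finset.ne_of_mem_erase ha) with h3 | h3
    · have h4 : ((a : ℕ) : ℝ) + 1 ≤ (A : ℕ) := by exact_mod_cast h3
      exact le_mul_of_one_le_left (cgWeight_nonneg _ _ _ _) (by linarith)
    · rw [cgWeight_eq_zero h hm a h3, mul_zero]
  rw [← Finset.mul_sum, le_div_iff₀ (by positivity)]
  calc _ = ((k : ℝ) + 1) / (m + 1) * (((k : ℝ) + 2) *
        ∑ a ∈ Finset.univ.erase A, cgWeight j k m a) := by ring
    _ ≤ ((k : ℝ) + 1) / (m + 1) * (((k : ℝ) + 2) *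
        ∑ a : Fin (j + 1), ((A : ℕ) - (a : ℕ) : ℝ) * cgWeight j k m a) := by gcongr
    _ = _ := by
        rw [h1]
        field_simp

/-- Here `a = A` is fixed and the recursion is summed over the total spin; its other side sums to
`(j - A) * (A + 1)` because the weights of `A + 1` sum to one, both sides being zero when `A` is the
last index. The spin `K + A - J` (with `K = k / 2`, `J = j / 2`) is the term `s = j - A`, where the
coefficient vanishes. -/
theorem sum_range_erase_cgWeight_le (A : Fin (j + 1)) (hA : j ≤ k + (A : ℕ)) :
    ∑ s ∈ (Finset.range (min j k + 1)).erase (j - (A : ℕ)), cgWeight j k (j + k - 2 * s) A ≤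
      ((j : ℝ) - (A : ℕ)) * ((A : ℕ) + 1) / ((k : ℝ) - j + 2 * (A : ℕ) + 2) := by
  have hAj : (A : ℕ) ≤ j := Nat.lt_succ_iff.1 A.is_lt
  have hAj' : ((A : ℕ) : ℝ) ≤ j := by exact_mod_cast hAj
  have hA' : (j : ℝ) ≤ k + (A : ℕ) := by exact_mod_cast hA
  have hA0 : (0 : ℝ) ≤ (A : ℕ) := by positivity
  set q : ℕ → ℝ := fun s => cgWeight j k (j + k - 2 * s) A with hq
  have spec : ∀ s ∈ Finset.range (min j k + 1), IsEquivariantIsometry j k (j + k - 2 * s)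
      (cgEmbedding j k (j + k - 2 * s)) ∧ s ≤ j ∧ s ≤ k ∧
      ((j + k - 2 * s : ℕ) : ℝ) = j + k - 2 * s := by
    intro s hs
    rw [Finset.mem_range] at hs
    refine ⟨cgEmbedding_spec (s := s) (by omega) (by omega) (by omega), by omega, by omega, ?_⟩
    rw [Nat.cast_sub (by omega)]
    push_cast
    ring
  have hcoef : ∀ s ∈ Finset.range (min j k + 1),
      (spin (j + k - 2 * s) - (mag j A + spin k)) *
        (spin (j + k - 2 * s) + (mag j A + spin k) + 1) =
      ((j : ℝ) - s - (A : ℕ)) * (k - s + (A : ℕ) + 1) := by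
    intro s hs
    simp only [spin, mag, (spec s hs).2.2.2]
    ring
  have hrec : (∀ s ∈ Finset.range (min j k + 1),
      0 ≤ ((j : ℝ) - s - (A : ℕ)) * (k - s + (A : ℕ) + 1) * q s) ∧
      ∑ s ∈ Finset.range (min j k + 1),
        ((j : ℝ) - s - (A : ℕ)) * (k - s + (A : ℕ) + 1) * q s =
        ((j : ℝ) - (A : ℕ)) * ((A : ℕ) + 1) := by
    clear_value q
    induction A using Fin.lastCases with
    | last =>
      have h0 : ∀ s ∈ Finset.range (min j k + 1),
          ((j : ℝ) - s - ((Fin.last j : Fin (j + 1)) : ℕ)) *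
            (k - s + ((Fin.last j : Fin (j + 1)) : ℕ) + 1) * q s = 0 := by
        intro s hs
        rw [← hcoef s hs, hq]
        exact cgWeight_last (spec s hs).1
      refine ⟨fun s hs => (h0 s hs).ge, ?_⟩
      rw [Finset.sum_eq_zero h0]
      simp
    | cast a =>
      have h0 : ∀ s ∈ Finset.range (min j k + 1),
          ((j : ℝ) - s - (a.castSucc : ℕ)) * (k - s + (a.castSucc : ℕ) + 1) * q s =
          ((j : ℝ) - (a : ℕ)) * ((a : ℕ) + 1) * cgWeight j k (j + k - 2 * s) a.succ := by
        intro s hs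
        rw [← hcoef s hs, hq]
        exact (cgWeight_succ (spec s hs).1 a).symm
      refine ⟨fun s hs => ?_, ?_⟩
      · rw [h0 s hs]
        exact mul_nonneg (mul_nonneg (by simp) (by positivity)) (cgWeight_nonneg _ _ _ _)
      · rw [Finset.sum_congr rfl h0, ← Finset.mul_sum, sum_range_cgWeight, mul_one]
        rfl
  have hD : 0 < (k : ℝ) - j + 2 * (A : ℕ) + 2 := by linarith
  rw [le_div_iff₀ hD, ← hrec.2, Finset.sum_mul]
  have hmem : j - (A : ℕ) ∈ Finset.range (min j k + 1) := by
    rw [Finset.mem_range]; omega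
  rw [← Finset.add_sum_erase _ _ hmem, Nat.cast_sub hAj]
  have e0 : ((j : ℝ) - (j - (A : ℕ)) - (A : ℕ)) = 0 := by ring
  rw [e0, zero_mul, zero_mul, zero_add]
  refine Finset.sum_le_sum fun s hs => ?_
  have hs' := Finset.mem_of_mem_erase hs
  have hne := Finset.ne_of_mem_erase hs
  obtain ⟨-, hsj, hsk, -⟩ := spec s hs'
  have hsk' : (s : ℝ) ≤ k := by exact_mod_cast hsk
  have hq0 : 0 ≤ q s := cgWeight_nonneg _ _ _ _
  -- For smaller `s` the first factor is at least 1 and the second at least `k - j + 2 * A + 2`. For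
  -- larger `s` the coefficient is negative although its product with the weight is nonnegative, so
  -- the weight is zero.
  rcases lt_or_gt_of_ne hne with h1 | h1
  · have h2 : (s : ℝ) + 1 + (A : ℕ) ≤ j := by
      have : s + 1 + (A : ℕ) ≤ j := by omega
      exact_mod_cast this
    change q s * _ ≤ _
    rw [mul_comm]
    refine mul_le_mul_of_nonneg_right ?_ hq0
    nlinarith
  · have h2 : (j : ℝ) + 1 ≤ s + (A : ℕ) := by
      have : j + 1 ≤ s + (A : ℕ) := by omega
      exact_mod_cast this
    have h3 := hrec.1 s hs'
    have h4 : ((j : ℝ) - s - (A : ℕ)) * (k - s + (A : ℕ) + 1) < 0 :=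
      mul_neg_of_neg_of_pos (by linarith) (by linarith)
    have h5 : q s = 0 := by
      by_contra h6
      have : 0 < q s := lt_of_le_of_ne hq0 (Ne.symm h6)
      nlinarith
    change q s * _ ≤ _
    rw [h5]
    simp

end Moments

/-! ### Time reversal -/

theorem timeReversal_mul_Sz (n : ℕ) : timeReversal n * Sz n = -(Sz n * timeReversal n) := by
  ext b a
  rw [Matrix.neg_apply, Sz, Matrix.mul_diagonal, Matrix.diagonal_mul, timeReversal,
    Matrix.of_apply]
  split_ifs with h
  · rw [h, mag_rev]
    push_cast
    ring
  · simp

theorem mul_timeReversal_apply {n : ℕ} (M : Operator n) (b a : Fin (n + 1)) :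
    (M * timeReversal n) b a = M b a.rev * (-1) ^ (n - (a : ℕ)) := by
  rw [Matrix.mul_apply, Finset.sum_eq_single a.rev]
  · simp [timeReversal]
  · intro c _ hc
    simp [timeReversal, hc]
  · simp

theorem timeReversal_mul_Sminus (n : ℕ) :
    timeReversal n * Sminus n = -(Splus n * timeReversal n) := by
  ext b a
  rw [Matrix.neg_apply, mul_timeReversal_apply, Splus_apply]
  induction a using Fin.cases with
  | zero =>
    rw [mul_Sminus_apply_zero, if_neg]
    · simp
    · have := b.is_lt
      simp
      omega
  | succ a =>
    rw [mul_Sminus_apply (b := a.castSucc) _ _ _ (by simp), timeReversal, Matrix.of_apply]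
    have ha : (a : ℕ) < n := a.is_lt
    have hiff : (b = Fin.rev a.castSucc) ↔ ((b : ℕ) = (Fin.rev a.succ : ℕ) + 1) := by
      rw [Fin.ext_iff]
      simp [Fin.val_rev]
      omega
    by_cases h : b = Fin.rev a.castSucc
    · rw [if_pos h, if_pos (hiff.1 h)]
      have e1 : n - (a.castSucc : ℕ) = (n - (a.succ : ℕ)) + 1 := by simp; omega
      have e2 : (((Fin.rev a.succ : Fin (n + 1)) : ℕ) : ℝ) = n - (a : ℕ) - 1 := by
        simp only [Fin.val_rev, Fin.val_succ]
        rw [Nat.cast_sub (by omega)]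
        push_cast
        ring
      rw [e1, e2, pow_succ]
      have e3 : ((n : ℝ) - (n - (a : ℕ) - 1)) * (n - (a : ℕ) - 1 + 1) =
        ((n : ℝ) - (a.castSucc : ℕ)) * ((a.castSucc : ℕ) + 1) := by
        simp only [Fin.val_castSucc]
        ring
      rw [e3]
      ring
    · rw [if_neg h, if_neg (fun h' => h (hiff.2 h'))]
      simp

theorem timeReversal_conjTranspose (n : ℕ) : (timeReversal n)ᴴ = (timeReversal n)ᵀ := by
  ext a b
  simp only [timeReversal, Matrix.conjTranspose_apply, Matrix.transpose_apply, Matrix.of_apply]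
  split_ifs <;> simp

theorem timeReversal_transpose (n : ℕ) : (timeReversal n)ᵀ = (-1 : ℂ) ^ n • timeReversal n := by
  ext b a
  simp only [timeReversal, Matrix.transpose_apply, Matrix.of_apply, Matrix.smul_apply, smul_eq_mul]
  by_cases h : b = a.rev
  · have h' : a = b.rev := by rw [h, Fin.rev_rev]
    rw [if_pos h, if_pos h', ← pow_add]
    have ha : (a : ℕ) ≤ n := Nat.lt_succ_iff.1 a.is_lt
    have e : (b : ℕ) = n - a := by rw [h, Fin.val_rev]; omega
    have e2 : n + (n - (a : ℕ)) = (n - (b : ℕ)) + 2 * (n - a) := by omega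
    rw [e2, pow_add, pow_mul]
    simp
  · have h' : ¬ a = b.rev := fun h' => h (by rw [h', Fin.rev_rev])
    rw [if_neg h, if_neg h', mul_zero]

/-- The relation for `Sminus` is multiplied on both sides by the inverse of the time reversal, which
is its transpose and hence, up to a sign, the time reversal itself. -/
theorem timeReversal_mul_Splus (n : ℕ) :
    timeReversal n * Splus n = -(Sminus n * timeReversal n) := by
  have hU := timeReversal_mul_transpose n
  have hU' := mul_eq_one_comm.1 hU
  have h : Sminus n * (timeReversal n)ᵀ = -((timeReversal n)ᵀ * Splus n) := by
    calc Sminus n * (timeReversal n)ᵀ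
        = (timeReversal n)ᵀ * (timeReversal n * Sminus n) * (timeReversal n)ᵀ := by
          rw [← Matrix.mul_assoc, hU', Matrix.one_mul]
      _ = -((timeReversal n)ᵀ * Splus n) := by
          rw [timeReversal_mul_Sminus, Matrix.mul_neg, Matrix.neg_mul, ← Matrix.mul_assoc,
            Matrix.mul_assoc _ _ (timeReversal n)ᵀ, hU, Matrix.mul_one]
  rw [timeReversal_transpose, mul_smul_comm, smul_mul_assoc, ← smul_neg] at h
  have h2 := smul_right_injective _ (pow_ne_zero n (neg_ne_zero.2 one_ne_zero) : (-1 : ℂ) ^ n ≠ 0) h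
  rw [h2, neg_neg]

theorem Splus_transpose (n : ℕ) : (Splus n)ᵀ = Sminus n := by
  rw [← Splus_conjTranspose]
  ext a b
  rw [Matrix.transpose_apply, Matrix.conjTranspose_apply, Splus_apply]
  split_ifs <;> simp

theorem Sminus_transpose (n : ℕ) : (Sminus n)ᵀ = Splus n := by
  rw [← Splus_transpose, Matrix.transpose_transpose]

theorem timeReversal_mul_spinAlong_transpose (n : ℕ) (ω : Sphere2) :
    timeReversal n * (spinAlong n ω)ᵀ = -(spinAlong n ω * timeReversal n) := by
  have hz : (Sz n)ᵀ = Sz n := Matrix.diagonal_transpose _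
  simp only [spinAlong, Sx, Sy, Matrix.transpose_add, Matrix.transpose_smul, Matrix.transpose_sub,
    Splus_transpose, Sminus_transpose, hz, mul_add, mul_sub, mul_smul_comm, add_mul, sub_mul,
    smul_mul_assoc, timeReversal_mul_Sz, timeReversal_mul_Splus, timeReversal_mul_Sminus]
  module

theorem isHermitian_spinAlong (n : ℕ) (ω : Sphere2) :
    (spinAlong n ω)ᴴ = spinAlong n ω := by
  have h := isSpinTriple_spin n
  simp [spinAlong, Matrix.conjTranspose_add, Matrix.conjTranspose_smul, h.hermX, h.hermY, h.hermZ]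

/-- Time reversal changes the sign of every spin component, so it sends the eigenvalue `i` to `-i`.
This is the source of the index `-i` in the Husimi functions. -/
theorem isSpinState_timeReversal {n : ℕ} {ω : Sphere2} {a : Fin (n + 1)} {ψ : Fin (n + 1) → ℂ}
    (h : IsSpinState n ω (mag n a) ψ) :
    IsSpinState n ω (mag n a.rev) (timeReversal n *ᵥ star ψ) := by
  have h1 : (timeReversal n)ᴴ * timeReversal n = 1 := by
    rw [timeReversal_conjTranspose]
    exact mul_eq_one_comm.1 (timeReversal_mul_transpose n)
  refine ⟨?_, ?_⟩
  · rw [Matrix.star_mulVec, ← Matrix.dotProduct_mulVec, Matrix.mulVec_mulVec, h1,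
      Matrix.one_mulVec, star_star, dotProduct_comm, h.1]
  · have h2 : (spinAlong n ω)ᵀ *ᵥ star ψ = (mag n a : ℂ) • star ψ := by
      have := congrArg star h.2
      rw [Matrix.star_mulVec, isHermitian_spinAlong, star_smul, Complex.star_def,
        Complex.conj_ofReal] at this
      rw [Matrix.mulVec_transpose, this]
    have h3 : spinAlong n ω * timeReversal n = -(timeReversal n * (spinAlong n ω)ᵀ) := by
      rw [timeReversal_mul_spinAlong_transpose, neg_neg]
    rw [Matrix.mulVec_mulVec, h3, Matrix.neg_mulVec, ← Matrix.mulVec_mulVec, h2,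
      Matrix.mulVec_smul, mag_rev]
    push_cast
    module

theorem spinProj_rev (n : ℕ) (a : Fin (n + 1)) (ω : Sphere2) :
    spinProj n a.rev ω = timeReversal n * (spinProj n a ω)ᵀ * (timeReversal n)ᵀ := by
  have h := spinState_spec n ω a
  rw [← vecMulVec_of_isSpinState (isSpinState_timeReversal h), ← vecMulVec_of_isSpinState h,
    Matrix.transpose_vecMulVec, Matrix.mul_vecMulVec, Matrix.vecMulVec_mul, Matrix.star_mulVec,
    star_star, timeReversal_conjTranspose]

theorem trace_betaTranspose_mul_spinProj {n : ℕ} (ρ : Operator n) (a : Fin (n + 1))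
    (ω : Sphere2) :
    (betaTranspose n ρ * spinProj n a ω).trace = (ρ * spinProj n a.rev ω).trace := by
  rw [spinProj_rev, betaTranspose, ← Matrix.trace_transpose]
  simp only [Matrix.transpose_mul, Matrix.transpose_transpose]
  rw [← Matrix.mul_assoc, ← Matrix.mul_assoc, Matrix.trace_mul_comm, ← Matrix.mul_assoc,
    ← Matrix.mul_assoc]
  rw [Matrix.trace_mul_comm]

theorem trace_betaTranspose {n : ℕ} (ρ : Operator n) : (betaTranspose n ρ).trace = ρ.trace := by
  rw [betaTranspose, Matrix.trace_mul_cycle, timeReversal_mul_transpose, Matrix.one_mul,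
    Matrix.trace_transpose]

theorem betaTranspose_one (n : ℕ) : betaTranspose n 1 = 1 := by
  rw [betaTranspose, Matrix.transpose_one, Matrix.mul_one]
  exact mul_eq_one_comm.1 (timeReversal_mul_transpose n)

/-! ### Expansion of the two compositions in Clebsch–Gordan weights -/

/-- Conservation of the total weight: with the same second index, different first indices have
different total weights. -/
theorem CommutesWithTensor.apply_eq_zero {j k : ℕ} {W : TensorOperator j k}
    (h : CommutesWithTensor j k W) {a a' : Fin (j + 1)} (haa : a ≠ a') (b : Fin (k + 1)) :
    W (a, b) (a', b) = 0 := by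
  have hd : tensorGenerator j k (Sz j) (Sz k) =
      Matrix.diagonal fun x : Fin (j + 1) × Fin (k + 1) => (mag j x.1 : ℂ) + mag k x.2 := by
    rw [tensorGenerator, Sz, Sz, ← Matrix.diagonal_one, ← Matrix.diagonal_one,
      Matrix.diagonal_kronecker_diagonal, Matrix.diagonal_kronecker_diagonal, Matrix.diagonal_add]
    simp
  have h1 := congrFun (congrFun h.z (a, b)) (a', b)
  rw [hd, Matrix.diagonal_mul, Matrix.mul_diagonal, mul_comm, ← sub_eq_zero, ← mul_sub,
    mul_eq_zero] at h1
  refine h1.resolve_right fun h2 => haa (mag_injective j ?_)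
  simpa using sub_eq_zero.1 h2

theorem trace_mul_kronecker_single {j k : ℕ} (W : TensorOperator j k) (C : Operator j)
    (b : Fin (k + 1)) :
    (W * (C ⊗ₖ Matrix.single b b (1 : ℂ))).trace = ∑ a, ∑ a', W (a, b) (a', b) * C a' a := by
  simp only [Matrix.trace, Matrix.diag, Matrix.mul_apply, Fintype.sum_prod_type,
    Matrix.kroneckerMap_apply, Matrix.single_apply]
  refine Finset.sum_congr rfl fun a _ => ?_
  rw [Finset.sum_eq_single b]
  · refine Finset.sum_congr rfl fun a' _ => ?_
    rw [Finset.sum_eq_single b]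
    · simp
    · intro y _ hy
      simp [hy.symm]
    · simp
  · intro y _ hy
    refine Finset.sum_eq_zero fun a' _ => Finset.sum_eq_zero fun y' _ => ?_
    simp [hy.symm]
  · simp

theorem CommutesWithTensor.frame_commute {j k : ℕ} {W : TensorOperator j k}
    (h : CommutesWithTensor j k W) (θ φ : ℝ) :
    ((rotationExp (Sz j) φ * rotationExp (Sy j) θ) ⊗ₖ
      (rotationExp (Sz k) φ * rotationExp (Sy k) θ)) * W =
    W * ((rotationExp (Sz j) φ * rotationExp (Sy j) θ) ⊗ₖ
      (rotationExp (Sz k) φ * rotationExp (Sy k) θ)) := by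
  rw [Matrix.mul_kronecker_mul, ← rotationExp_tensorGenerator, ← rotationExp_tensorGenerator,
    Matrix.mul_assoc, rotationExp_commute h.y, ← Matrix.mul_assoc, rotationExp_commute h.z,
    Matrix.mul_assoc]

/-- One rotation applied to both factors brings `ω` to the third axis and leaves the invariant
projection unchanged. There the second factor is the top vector, and weight conservation leaves only
the diagonal terms, which are the weights. -/
theorem trace_cgProjection_mul {j k m : ℕ} (h : IsEquivariantIsometry j k m (cgEmbedding j k m))
    (C : Operator j) (ω : Sphere2) :
    (cgProjection j k m * (C ⊗ₖ spinProj k (Fin.last k) ω)).trace =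
      ∑ a, (cgWeight j k m a : ℂ) * (C * spinProj j a ω).trace := by
  obtain ⟨θ, φ, hf⟩ := exists_frame ω
  have hc := cgProjection_commutes h
  have hW := hc.frame_commute θ φ
  have hgj := frame_mem_unitaryGroup j θ φ
  have hgk := frame_mem_unitaryGroup k θ φ
  have hpj := spinProj_of_frame hgj (hf j)
  have hpk := spinProj_of_frame hgk (hf k) (Fin.last k)
  generalize rotationExp (Sz j) φ * rotationExp (Sy j) θ = g at *
  generalize rotationExp (Sz k) φ * rotationExp (Sy k) θ = g' at *
  have h1 : g * gᴴ = 1 := Matrix.mem_unitaryGroup_iff.1 hgj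
  have h1' : gᴴ * g = 1 := Matrix.mem_unitaryGroup_iff'.1 hgj
  have h2 : g'ᴴ * g' = 1 := Matrix.mem_unitaryGroup_iff'.1 hgk
  have e1 : C ⊗ₖ spinProj k (Fin.last k) ω = (g ⊗ₖ g') *
      ((gᴴ * C * g) ⊗ₖ Matrix.single (Fin.last k) (Fin.last k) (1 : ℂ)) * (gᴴ ⊗ₖ g'ᴴ) := by
    rw [← Matrix.mul_kronecker_mul, ← Matrix.mul_kronecker_mul, hpk]
    congr 1
    rw [← Matrix.mul_assoc, ← Matrix.mul_assoc, h1, Matrix.one_mul, Matrix.mul_assoc, h1,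
      Matrix.mul_one]
  have e2 : (gᴴ ⊗ₖ g'ᴴ) * (g ⊗ₖ g') = 1 := by
    rw [← Matrix.mul_kronecker_mul, h1', h2, Matrix.one_kronecker_one]
  rw [e1, ← Matrix.mul_assoc, ← Matrix.mul_assoc, ← hW, Matrix.trace_mul_comm, ← Matrix.mul_assoc,
    ← Matrix.mul_assoc, e2, Matrix.one_mul, trace_mul_kronecker_single]
  refine Finset.sum_congr rfl fun a _ => ?_
  rw [Finset.sum_eq_single a, ← cgWeight_eq, hpj a]
  · congr 1
    rw [← Matrix.mul_assoc, Matrix.trace_mul_comm, ← Matrix.mul_assoc, ← Matrix.mul_assoc,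
      Matrix.trace_mul_single]
    simp
  · intro a' _ ha'
    rw [hc.apply_eq_zero ha'.symm, zero_mul]
  · simp

theorem trace_spinProj_mul_spinProj (n : ℕ) (a b : Fin (n + 1)) (ω : Sphere2) :
    (spinProj n a ω * spinProj n b ω).trace = if a = b then 1 else 0 := by
  obtain ⟨g, hg, hgz⟩ := exists_unitary_frame n ω
  have h1 : gᴴ * g = 1 := Matrix.mem_unitaryGroup_iff'.1 hg
  rw [spinProj_of_frame hg hgz, spinProj_of_frame hg hgz, Matrix.mul_assoc _ gᴴ, ← Matrix.mul_assoc
    gᴴ, ← Matrix.mul_assoc gᴴ, h1, Matrix.one_mul, Matrix.mul_assoc, ← Matrix.mul_assoc _ _ gᴴ,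
    Matrix.trace_mul_comm, Matrix.mul_assoc, h1, Matrix.mul_one]
  by_cases h : a = b
  · subst h
    simp
  · simp [h]

/-- The case of `trace_cgProjection_mul` in which the operator is the `β`-transpose of `ρ`; time
reversal then turns the eigenvalue `mag j a` into its negative. -/
theorem hus_extremeChannel {j k m : ℕ} (h : IsEquivariantIsometry j k m (cgEmbedding j k m))
    (ρ : Operator j) (ω : Sphere2) :
    (((2 * spin k + 1) / (2 * spin j + 1) : ℝ) : ℂ) *
      hus k (spin k) (extremeChannel j k m ρ) ω =
    ∑ a, ((((k : ℝ) + 1) / (m + 1) * cgWeight j k m a : ℝ) : ℂ) * hus j (-mag j a) ρ ω := by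
  rw [← mag_last, hus_mag, extremeChannel, smul_mul_assoc, Matrix.trace_smul,
    trace_partialTraceLeft_mul, Matrix.mul_assoc, kronecker_one_mul_one_kronecker,
    trace_cgProjection_mul h, smul_eq_mul, Finset.mul_sum, Finset.mul_sum]
  refine Finset.sum_congr rfl fun a _ => ?_
  rw [← mag_rev, hus_mag, trace_betaTranspose_mul_spinProj, ← mul_assoc, ← mul_assoc,
    ← Complex.ofReal_mul, ← Complex.ofReal_mul]
  congr 3
  simp only [mag, spin, Fin.val_last]
  field_simp
  ring

theorem trace_cgProjection_mul_matInt {j k m : ℕ}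
    (h : IsEquivariantIsometry j k m (cgEmbedding j k m)) (A : Fin (j + 1)) :
    (cgProjection j k m * matInt fun ω => spinProj j A ω ⊗ₖ spinProj k (Fin.last k) ω).trace =
      cgWeight j k m A := by
  have hF := continuous_kronecker_spinProj j k A (Fin.last k)
  rw [← matInt_mul_left _ hF, trace_matInt (continuous_const.matrix_mul hF)]
  simp only [trace_cgProjection_mul h, trace_spinProj_mul_spinProj]
  simp

/-- The integrated operator is invariant. Between different components its blocks vanish, and on
each component it is a scalar, equal to its trace there (`trace_cgProjection_mul_matInt`) divided by
the dimension. -/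
theorem matInt_kronecker_eq (j k : ℕ) (A : Fin (j + 1)) :
    (matInt fun ω => spinProj j A ω ⊗ₖ spinProj k (Fin.last k) ω) =
      ∑ s ∈ Finset.range (min j k + 1),
        ((cgWeight j k (j + k - 2 * s) A : ℂ) / ((j + k - 2 * s : ℕ) + 1)) •
          cgProjection j k (j + k - 2 * s) := by
  have spec : ∀ s ∈ Finset.range (min j k + 1),
      IsEquivariantIsometry j k (j + k - 2 * s) (cgEmbedding j k (j + k - 2 * s)) := by
    intro s hs
    rw [Finset.mem_range] at hs
    exact cgEmbedding_spec (s := s) (by omega) (by omega) (by omega)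
  have hc := matInt_kronecker_commutes j k A (Fin.last k)
  have htr := fun s hs => trace_cgProjection_mul_matInt (spec s hs) A
  set W := matInt fun ω => spinProj j A ω ⊗ₖ spinProj k (Fin.last k) ω
  calc W = (∑ s ∈ Finset.range (min j k + 1), cgProjection j k (j + k - 2 * s)) * W *
        ∑ s ∈ Finset.range (min j k + 1), cgProjection j k (j + k - 2 * s) := by
        rw [sum_cgProjection, Matrix.one_mul, Matrix.mul_one]
    _ = _ := by
        rw [Finset.sum_mul, Finset.sum_mul]
        refine Finset.sum_congr rfl fun s hs => ?_
        rw [Finset.mul_sum, Finset.sum_eq_single s]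
        · have h1 := ((spec s hs).isIntertwiner (spec s hs) hc.x hc.y hc.z).eq_smul_one
          have h2 := htr s hs
          rw [cgProjection, Matrix.mul_assoc, Matrix.trace_mul_comm] at h2
          rw [h2] at h1
          calc _ = cgEmbedding j k (j + k - 2 * s) * ((cgEmbedding j k (j + k - 2 * s))ᴴ * W *
                cgEmbedding j k (j + k - 2 * s)) * (cgEmbedding j k (j + k - 2 * s))ᴴ := by
                simp only [cgProjection, Matrix.mul_assoc]
            _ = _ := by
                rw [h1, Matrix.mul_smul, Matrix.mul_one, Matrix.smul_mul, ← cgProjection]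
        · intro s' hs' hne
          have hm : j + k - 2 * s ≠ j + k - 2 * s' := by
            rw [Finset.mem_range] at hs hs'
            omega
          have h1 := ((spec s hs).isIntertwiner (spec s' hs') hc.x hc.y hc.z).eq_zero hm
          calc _ = cgEmbedding j k (j + k - 2 * s) * ((cgEmbedding j k (j + k - 2 * s))ᴴ * W *
                cgEmbedding j k (j + k - 2 * s')) * (cgEmbedding j k (j + k - 2 * s'))ᴴ := by
                simp only [cgProjection, Matrix.mul_assoc]
            _ = 0 := by rw [h1, Matrix.mul_zero, Matrix.zero_mul]
        · exact fun h => absurd hs h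

/-- The partial trace as a linear map. -/
noncomputable def partialTraceLeftLin (j k : ℕ) : TensorOperator j k →ₗ[ℂ] Operator k where
  toFun := partialTraceLeft
  map_add' X Y := by
    ext b b'
    simp [partialTraceLeft, Finset.sum_add_distrib]
  map_smul' c X := by
    ext b b'
    simp [partialTraceLeft, Finset.mul_sum]

theorem partialTraceLeft_kronecker {j k : ℕ} (A : Operator j) (B : Operator k) :
    partialTraceLeft (A ⊗ₖ B) = A.trace • B := by
  ext b b'
  simp [partialTraceLeft, Matrix.trace, Finset.sum_mul]

/-- The Husimi value is itself a trace over the first factor, so quantizing it is a partial trace of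
the integral in `matInt_kronecker_eq` multiplied by `betaTranspose j ρ ⊗ₖ 1`. Expanding that
integral produces the channels. -/
theorem op_hus {j k : ℕ} (A : Fin (j + 1)) (ρ : Operator j) :
    op k (hus j (-mag j A) ρ) = ∑ s ∈ Finset.range (min j k + 1),
      ((((2 * spin k + 1) / (2 * spin j + 1) * cgWeight j k (j + k - 2 * s) A : ℝ)) : ℂ) •
        extremeChannel j k (j + k - 2 * s) ρ := by
  have hF := continuous_kronecker_spinProj j k A (Fin.last k)
  have e1 : (fun ω => hus j (-mag j A) ρ ω • spinProj k (Fin.last k) ω) = fun ω =>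
      (partialTraceLeftLin j k ∘ₗ LinearMap.mulRight ℂ (betaTranspose j ρ ⊗ₖ (1 : Operator k)))
        (spinProj j A ω ⊗ₖ spinProj k (Fin.last k) ω) := by
    ext1 ω
    change _ = partialTraceLeft (_ * _)
    rw [← Matrix.mul_kronecker_mul, Matrix.mul_one, partialTraceLeft_kronecker, ← mag_rev, hus_mag,
      ← trace_betaTranspose_mul_spinProj, Matrix.trace_mul_comm]
  rw [op_eq, e1, matInt_map _ hF, matInt_kronecker_eq, map_sum, Finset.smul_sum]
  refine Finset.sum_congr rfl fun s _ => ?_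
  rw [map_smul, extremeChannel, smul_smul, smul_smul]
  congr 1
  simp only [spin]
  push_cast
  field_simp

/-! ### Norm bounds for the channels and the Husimi maps -/

/-- The extreme channel as a linear map. -/
noncomputable def extremeChannelLin (j k m : ℕ) : Operator j →ₗ[ℂ] Operator k where
  toFun := extremeChannel j k m
  map_add' X Y := by
    simp only [extremeChannel, betaTranspose, Matrix.transpose_add, Matrix.mul_add, Matrix.add_mul,
      Matrix.add_kronecker]
    rw [← smul_add]
    congr 1
    exact (partialTraceLeftLin j k).map_add _ _
  map_smul' c X := by
    simp only [extremeChannel, betaTranspose, Matrix.transpose_smul, Matrix.mul_smul,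
      Matrix.smul_mul, Matrix.smul_kronecker, RingHom.id_apply]
    rw [smul_comm c]
    congr 1
    exact (partialTraceLeftLin j k).map_smul _ _

theorem extremeChannel_one {j k m : ℕ} (h : IsEquivariantIsometry j k m (cgEmbedding j k m)) :
    extremeChannel j k m 1 = ((((j : ℝ) + 1) / (k + 1) : ℝ) : ℂ) • 1 := by
  rw [extremeChannel, betaTranspose_one, Matrix.one_kronecker_one, Matrix.mul_one,
    (cgProjection_commutes h).partialTraceLeft_eq, cgProjection_trace h, smul_smul]
  congr 1
  simp only [spin]
  have : (m : ℂ) + 1 ≠ 0 := by exact_mod_cast Nat.succ_ne_zero m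
  push_cast
  field_simp

theorem trace_extremeChannel {j k m : ℕ} (h : IsEquivariantIsometry j k m (cgEmbedding j k m))
    (ρ : Operator j) : (extremeChannel j k m ρ).trace = ρ.trace := by
  rw [extremeChannel, Matrix.trace_smul, trace_partialTraceLeft, ← trace_partialTraceRight_mul,
    (cgProjection_commutes h).partialTraceRight_eq, cgProjection_trace h, smul_mul_assoc,
    Matrix.trace_smul, Matrix.one_mul, trace_betaTranspose, smul_smul]
  simp only [spin]
  have h1 : (m : ℂ) + 1 ≠ 0 := by exact_mod_cast Nat.succ_ne_zero m
  have h2 : (j : ℂ) + 1 ≠ 0 := by exact_mod_cast Nat.succ_ne_zero j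
  have e : (((2 * ((j : ℝ) / 2) + 1) / (2 * ((m : ℝ) / 2) + 1) : ℝ) : ℂ) *
      (((m : ℂ) + 1) / (j + 1)) = 1 := by
    push_cast
    field_simp
  rw [e, one_smul]

theorem vecMulVec_kronecker_vecMulVec {ι κ : Type*} (u u' : ι → ℂ) (w w' : κ → ℂ) :
    Matrix.vecMulVec u (star u') ⊗ₖ Matrix.vecMulVec w (star w') =
      Matrix.vecMulVec (tensorVec u w) (star (tensorVec u' w')) := by
  ext ⟨a, b⟩ ⟨a', b'⟩
  simp only [Matrix.kroneckerMap_apply, Matrix.vecMulVec_apply, tensorVec, Pi.star_apply, star_mul]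
  ring

theorem betaTranspose_vecMulVec {n : ℕ} (x y : Fin (n + 1) → ℂ) :
    betaTranspose n (Matrix.vecMulVec x (star y)) =
      Matrix.vecMulVec ((timeReversal n)ᵀ *ᵥ star y) (star ((timeReversal n)ᵀ *ᵥ star x)) := by
  rw [betaTranspose, Matrix.transpose_vecMulVec, Matrix.mul_vecMulVec, Matrix.vecMulVec_mul,
    Matrix.star_mulVec, star_star, ← timeReversal_conjTranspose, Matrix.conjTranspose_conjTranspose]

theorem trace_mul_one_kronecker_vecMulVec {j k : ℕ} (X : TensorOperator j k)
    (u v : Fin (k + 1) → ℂ) :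
    sandwich u v (partialTraceLeft X) =
      (X * ((1 : Operator j) ⊗ₖ Matrix.vecMulVec v (star u))).trace := by
  rw [← trace_partialTraceLeft_mul, Matrix.mul_vecMulVec, Matrix.trace_vecMulVec, dotProduct_comm,
    sandwich_apply]

/-- The vector whose overlaps are the matrix elements of the extreme channel. -/
noncomputable def channelVec (j k m : ℕ) (x : Fin (j + 1) → ℂ) (u : Fin (k + 1) → ℂ) :
    Fin (m + 1) → ℂ :=
  (cgEmbedding j k m)ᴴ *ᵥ tensorVec ((timeReversal j)ᵀ *ᵥ star x) u

/-- A Gram form of the channel, expressing its complete positivity: off-diagonal matrix elements are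
inner products of `channelVec` and are dominated by diagonal ones. -/
theorem sandwich_extremeChannel {j k m : ℕ} (x y : Fin (j + 1) → ℂ) (u v : Fin (k + 1) → ℂ) :
    sandwich u v (extremeChannel j k m (Matrix.vecMulVec x (star y))) =
      (((2 * spin j + 1) / (2 * spin m + 1) : ℝ) : ℂ) *
        (star (channelVec j k m x u) ⬝ᵥ channelVec j k m y v) := by
  rw [extremeChannel, map_smul, smul_eq_mul, trace_mul_one_kronecker_vecMulVec, Matrix.mul_assoc,
    kronecker_one_mul_one_kronecker, betaTranspose_vecMulVec, vecMulVec_kronecker_vecMulVec,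
    Matrix.mul_vecMulVec, Matrix.trace_vecMulVec, dotProduct_comm, channelVec, channelVec,
    Matrix.star_mulVec, Matrix.conjTranspose_conjTranspose, ← Matrix.dotProduct_mulVec,
    Matrix.mulVec_mulVec, cgProjection]

theorem norm_star_dotProduct_le {ι : Type*} [Fintype ι] (u v : ι → ℂ) :
    ‖star u ⬝ᵥ v‖ ≤ ((star u ⬝ᵥ u).re + (star v ⬝ᵥ v).re) / 2 := by
  have e : ∀ w : ι → ℂ, (star w ⬝ᵥ w).re = ∑ i, ‖w i‖ ^ 2 := by
    intro w
    rw [dotProduct, Complex.re_sum]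
    refine Finset.sum_congr rfl fun i _ => ?_
    rw [Pi.star_apply, Complex.star_def, ← Complex.normSq_eq_conj_mul_self, Complex.ofReal_re,
      Complex.normSq_eq_norm_sq]
  rw [e, e, ← Finset.sum_add_distrib, Finset.sum_div]
  refine (norm_sum_le _ _).trans (Finset.sum_le_sum fun i _ => ?_)
  rw [norm_mul, Pi.star_apply, norm_star]
  nlinarith [sq_nonneg (‖u i‖ - ‖v i‖)]

theorem re_star_dotProduct_self_nonneg {ι : Type*} [Fintype ι] (u : ι → ℂ) :
    0 ≤ (star u ⬝ᵥ u).re := by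
  open scoped ComplexOrder in
  exact (Complex.le_def.1 (dotProduct_star_self_nonneg u)).1

theorem sum_sandwich_col {n : ℕ} {U : Operator n} (hU : U ∈ Matrix.unitaryGroup _ ℂ)
    (A : Operator n) : ∑ i, sandwich (U.col i) (U.col i) A = A.trace := by
  have e : ∀ i, sandwich (U.col i) (U.col i) A =
      (A * Matrix.vecMulVec (U.col i) (star (U.col i))).trace := fun i => by
    rw [Matrix.mul_vecMulVec, Matrix.trace_vecMulVec, dotProduct_comm, sandwich_apply]
  simp only [e]
  rw [← Matrix.trace_sum, ← Finset.mul_sum, sum_vecMulVec_col hU, Matrix.mul_one]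

/-- Interpolation between the value of the channel at the identity, `(j + 1) / (k + 1)`, at `p = ∞`,
and preservation of the trace at `p = 1`; positivity gives the required domination. -/
theorem schattenNorm_extremeChannel_le {j k m : ℕ}
    (h : IsEquivariantIsometry j k m (cgEmbedding j k m)) {p : ℝ≥0∞} (hp : 1 ≤ p)
    (ρ : Operator j) : schattenNorm p (extremeChannel j k m ρ) ≤
      (((j : ℝ) + 1) / (k + 1)) ^ (1 - 1 / p.toReal) * schattenNorm p ρ := by
  obtain ⟨U, hU, V, hV, hn⟩ := exists_schattenNorm_eq_eLpNorm_sandwich (extremeChannel j k m ρ)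
  have hρ := schattenNorm_nonneg hp ρ
  rw [← ENNReal.ofReal_le_ofReal_iff (by positivity), hn p hp]
  have hc : 0 ≤ (2 * spin j + 1) / (2 * spin m + 1) := by
    unfold spin; positivity
  have hself : ∀ (u : Fin (k + 1) → ℂ) (x : Fin (j + 1) → ℂ),
      (sandwich u u (extremeChannel j k m (Matrix.vecMulVec x (star x)))).re =
        (2 * spin j + 1) / (2 * spin m + 1) *
          (star (channelVec j k m x u) ⬝ᵥ channelVec j k m x u).re := fun u x => by
    rw [sandwich_extremeChannel, Complex.re_ofReal_mul]
  have h0 : ∀ (u : Fin (k + 1) → ℂ) (x : Fin (j + 1) → ℂ),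
      0 ≤ (sandwich u u (extremeChannel j k m (Matrix.vecMulVec x (star x)))).re := fun u x => by
    rw [hself]
    exact mul_nonneg hc (re_star_dotProduct_self_nonneg _)
  have h1 : ∀ Z ∈ Matrix.unitaryGroup (Fin (k + 1)) ℂ, ∀ i,
      (sandwich (Z.col i) (Z.col i) (extremeChannel j k m 1)).re ≤ ((j : ℝ) + 1) / (k + 1) := by
    intro Z hZ i
    rw [extremeChannel_one h, map_smul, sandwich_apply, Matrix.one_mulVec,
      star_col_dotProduct_col hZ, smul_eq_mul, mul_one, Complex.ofReal_re]
  have h2 : ∀ Z ∈ Matrix.unitaryGroup (Fin (k + 1)) ℂ, ∀ x : Fin (j + 1) → ℂ,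
      star x ⬝ᵥ x = 1 → ∫⁻ i, ENNReal.ofReal (sandwich (Z.col i) (Z.col i)
        (extremeChannel j k m (Matrix.vecMulVec x (star x)))).re ∂Measure.count ≤
        ENNReal.ofReal 1 := by
    intro Z hZ x hx
    rw [lintegral_count, tsum_fintype, ← ENNReal.ofReal_sum_of_nonneg fun i _ => h0 _ _,
      ← Complex.re_sum, sum_sandwich_col hZ, trace_extremeChannel h, Matrix.trace_vecMulVec,
      dotProduct_comm, hx, Complex.one_re]
  have := eLpNorm_le_schattenNorm (μ := Measure.count) hp (R := ((j : ℝ) + 1) / (k + 1))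
    (C := 1) (F := fun i => sandwich (U.col i) (V.col i) ∘ₗ extremeChannelLin j k m)
    (G := fun i => sandwich (U.col i) (U.col i) ∘ₗ extremeChannelLin j k m)
    (H := fun i => sandwich (V.col i) (V.col i) ∘ₗ extremeChannelLin j k m)
    (by positivity) zero_le_one
    (fun i x y => by
      change ‖sandwich _ _ (extremeChannel j k m _)‖ ≤ ((sandwich _ _ (extremeChannel j k m _)).re +
        (sandwich _ _ (extremeChannel j k m _)).re) / 2
      rw [hself, hself, sandwich_extremeChannel, norm_mul, Complex.norm_real,
        Real.norm_of_nonneg hc, ← mul_add, mul_div_assoc]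
      exact mul_le_mul_of_nonneg_left (norm_star_dotProduct_le _ _) hc)
    (fun _ _ => h0 _ _) (fun _ _ => h0 _ _) (fun _ => measurable_of_finite _)
    (fun _ => measurable_of_finite _) (h1 U hU) (h1 V hV) (h2 U hU) (h2 V hV) ρ
  rw [Real.one_rpow, mul_one] at this
  exact this

theorem continuous_hus {n : ℕ} (a : Fin (n + 1)) (ρ : Operator n) :
    Continuous (hus n (mag n a) ρ) := by
  have e : hus n (mag n a) ρ = fun ω => (ρ * spinProj n a ω).trace := by
    ext ω; exact hus_mag a ρ ω
  rw [e]
  exact (continuous_const.matrix_mul (continuous_spinProj n a)).matrix_trace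

theorem integral_hus {n : ℕ} (a : Fin (n + 1)) (ρ : Operator n) :
    ∫ ω, hus n (mag n a) ρ ω ∂sphereMeasure = ρ.trace / (n + 1) := by
  simp only [hus_mag]
  rw [← trace_matInt (continuous_const.matrix_mul (continuous_spinProj n a)),
    matInt_mul_left _ (continuous_spinProj n a), matInt_spinProj, mul_smul_comm, Matrix.mul_one,
    Matrix.trace_smul, smul_eq_mul, div_eq_inv_mul]

/-- The row bound 1 is the normalization of the spin states; the column bound `(n + 1)⁻¹` is the
resolution of the identity, through `integral_hus`. -/
theorem eLpNorm_hus_le {n : ℕ} (a : Fin (n + 1)) {p : ℝ≥0∞} (hp : 1 ≤ p) (ρ : Operator n) :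
    eLpNorm (hus n (mag n a) ρ) p sphereMeasure ≤
      ENNReal.ofReal (((n : ℝ) + 1)⁻¹ ^ (1 / p.toReal) * schattenNorm p ρ) := by
  have h0 : ∀ ω (x : Fin (n + 1) → ℂ), 0 ≤ (sandwich (spinState n ω (mag n a))
      (spinState n ω (mag n a)) (Matrix.vecMulVec x (star x))).re := fun ω x => by
    rw [sandwich_vecMulVec_self, Complex.ofReal_re]; positivity
  have h1 : ∀ ω, (sandwich (spinState n ω (mag n a)) (spinState n ω (mag n a)) 1).re ≤ 1 := by
    intro ω
    rw [sandwich_apply, Matrix.one_mulVec, (spinState_spec n ω a).1, Complex.one_re]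
  have h2 : ∀ x : Fin (n + 1) → ℂ, star x ⬝ᵥ x = 1 → ∫⁻ ω, ENNReal.ofReal
      (sandwich (spinState n ω (mag n a)) (spinState n ω (mag n a))
        (Matrix.vecMulVec x (star x))).re ∂sphereMeasure ≤ ENNReal.ofReal ((n : ℝ) + 1)⁻¹ := by
    intro x hx
    have hi := integrable_of_continuous (continuous_hus a (Matrix.vecMulVec x (star x)))
    refine (ofReal_integral_eq_lintegral_ofReal hi.re
      (Filter.Eventually.of_forall fun ω => h0 ω x)).ge.trans
      (ENNReal.ofReal_le_ofReal (le_of_eq ?_))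
    have h3 := integral_re hi
    rw [integral_hus, Matrix.trace_vecMulVec, dotProduct_comm, hx] at h3
    refine h3.trans ?_
    have h4 : (1 : ℂ) / (n + 1) = (((n : ℝ) + 1)⁻¹ : ℝ) := by push_cast; rw [one_div]
    rw [h4]
    rfl
  have hm : ∀ A : Operator n, Measurable fun ω =>
      sandwich (spinState n ω (mag n a)) (spinState n ω (mag n a)) A :=
    fun A => (continuous_hus a A).measurable
  have := eLpNorm_le_schattenNorm (μ := sphereMeasure) hp (R := 1) (C := ((n : ℝ) + 1)⁻¹)
    (F := fun ω => sandwich (spinState n ω (mag n a)) (spinState n ω (mag n a)))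
    zero_le_one (by positivity) (fun _ _ _ => norm_sandwich_vecMulVec_le _ _ _ _) h0 h0 hm hm h1 h1
    h2 h2 ρ
  rw [Real.one_rpow, one_mul] at this
  exact this

theorem aestronglyMeasurable_hus {n : ℕ} (a : Fin (n + 1)) (ρ : Operator n) :
    AEStronglyMeasurable (hus n (-mag n a) ρ) sphereMeasure := by
  rw [← mag_rev]
  exact (continuous_hus _ ρ).aestronglyMeasurable

theorem eLpNorm_hus_neg_le {n : ℕ} (a : Fin (n + 1)) {p : ℝ≥0∞} (hp : 1 ≤ p) (ρ : Operator n) :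
    eLpNorm (hus n (-mag n a) ρ) p sphereMeasure ≤
      ENNReal.ofReal (((n : ℝ) + 1)⁻¹ ^ (1 / p.toReal) * schattenNorm p ρ) := by
  rw [← mag_rev]
  exact eLpNorm_hus_le _ hp ρ

theorem eLpNorm_sum_mul_le {α ι : Type*} [MeasurableSpace α] {μ : Measure α} {p : ℝ≥0∞}
    (hp : 1 ≤ p) (t : Finset ι) {w : ι → ℝ} (hw : ∀ a ∈ t, 0 ≤ w a) {f : ι → α → ℂ}
    (hf : ∀ a ∈ t, AEStronglyMeasurable (f a) μ) {B : ι → ℝ} (hB : ∀ a ∈ t, 0 ≤ B a)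
    (hfB : ∀ a ∈ t, eLpNorm (f a) p μ ≤ ENNReal.ofReal (B a)) :
    eLpNorm (fun x => ∑ a ∈ t, (w a : ℂ) * f a x) p μ ≤ ENNReal.ofReal (∑ a ∈ t, w a * B a) := by
  have h1 : (fun x => ∑ a ∈ t, (w a : ℂ) * f a x) = ∑ a ∈ t, (w a : ℂ) • f a := by
    ext x
    simp
  rw [h1, ENNReal.ofReal_sum_of_nonneg fun a ha => mul_nonneg (hw a ha) (hB a ha)]
  refine (eLpNorm_sum_le (fun a ha => (hf a ha).const_smul _) hp).trans
    (Finset.sum_le_sum fun a ha => ?_)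
  rw [eLpNorm_const_smul, ENNReal.ofReal_mul (hw a ha)]
  refine mul_le_mul' (le_of_eq ?_) (hfB a ha)
  rw [← ofReal_norm]
  simp [abs_of_nonneg (hw a ha)]

/-! ### Error estimates -/

/-- The quantum number of `extremeChannel j k (shifted j k A)` is admissible. -/
theorem shifted_spec {j k : ℕ} {A : Fin (j + 1)} (hA : j ≤ k + (A : ℕ)) :
    IsEquivariantIsometry j k (shifted j k A) (cgEmbedding j k (shifted j k A)) := by
  have hAj : (A : ℕ) ≤ j := Nat.lt_succ_iff.1 A.2
  refine cgEmbedding_spec (s := j - (A : ℕ)) ?_ ?_ ?_ <;> (try simp only [shifted]) <;> omega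

theorem shifted_cast {j k : ℕ} {A : Fin (j + 1)} (hA : j ≤ k + (A : ℕ)) :
    (shifted j k A : ℝ) = k + 2 * (A : ℕ) - j := by
  unfold shifted
  rw [Nat.cast_sub (by omega)]
  push_cast
  ring

theorem dim_ratio (j k : ℕ) :
    (2 * spin k + 1) / (2 * spin j + 1) = ((k : ℝ) + 1) / (j + 1) := by
  simp only [spin]
  congr 1 <;> ring

theorem schattenNorm_smul_extremeChannel_sub_op_le {j k : ℕ} {A : Fin (j + 1)}
    (hA : j ≤ k + (A : ℕ)) {p : ℝ≥0∞} (hp : 1 ≤ p) (ρ : Operator j) :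
    ((2 * spin k + 1) / (2 * spin j + 1)) ^ (-(1 / p.toReal)) *
        schattenNorm p ((((2 * spin k + 1) / (2 * spin j + 1) : ℝ) : ℂ) •
          extremeChannel j k (shifted j k A) ρ - op k (hus j (-mag j A) ρ)) ≤
      2 * (((j : ℝ) - (A : ℕ)) * ((A : ℕ) + 1) / ((k : ℝ) - j + 2 * (A : ℕ) + 2)) *
        schattenNorm p ρ := by
  have hAj : (A : ℕ) ≤ j := Nat.lt_succ_iff.1 A.2
  set r : ℝ := (2 * spin k + 1) / (2 * spin j + 1) with hr
  have hr' : r = ((k : ℝ) + 1) / (j + 1) := dim_ratio j k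
  have hr0 : 0 < r := by rw [hr']; positivity
  set q : ℕ → ℝ := fun s => cgWeight j k (j + k - 2 * s) A with hq
  set S := Finset.range (min j k + 1) with hS
  set s₀ := j - (A : ℕ) with hs₀
  have hs₀S : s₀ ∈ S := by simp only [hS, Finset.mem_range]; omega
  have hm : shifted j k A = j + k - 2 * s₀ := by unfold shifted; omega
  have hq1 : ∑ s ∈ S, q s = 1 := sum_range_cgWeight j k A
  -- As the weights sum to one, the principal channel is averaged against them too; the term `s₀`
  -- then cancels and only the small mass remains.
  have hsub : (r : ℂ) • extremeChannel j k (shifted j k A) ρ - op k (hus j (-mag j A) ρ) =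
      ∑ s ∈ S.erase s₀, ((r * q s : ℝ) : ℂ) •
        (extremeChannel j k (shifted j k A) ρ - extremeChannel j k (j + k - 2 * s) ρ) := by
    have h1 : (r : ℂ) • extremeChannel j k (shifted j k A) ρ =
        ∑ s ∈ S, ((r * q s : ℝ) : ℂ) • extremeChannel j k (shifted j k A) ρ := by
      rw [← Finset.sum_smul, ← Complex.ofReal_sum, ← Finset.mul_sum, hq1, mul_one]
    rw [h1, op_hus, ← Finset.sum_sub_distrib, ← Finset.add_sum_erase _ _ hs₀S, hm, sub_self,
      zero_add]
    exact Finset.sum_congr rfl fun s _ => (smul_sub _ _ _).symm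
  set N : ℝ := (((j : ℝ) + 1) / (k + 1)) ^ (1 - 1 / p.toReal) * schattenNorm p ρ with hN
  have hle : ∀ s ∈ S, schattenNorm p (extremeChannel j k (j + k - 2 * s) ρ) ≤ N := fun s hs => by
    have hs' := Finset.mem_range.1 hs
    exact schattenNorm_extremeChannel_le
      (cgEmbedding_spec (s := s) (by omega) (by omega) (by omega)) hp ρ
  have hle₀ : schattenNorm p (extremeChannel j k (shifted j k A) ρ) ≤ N := by
    rw [hm]
    exact hle s₀ hs₀S
  -- The dimension factors cancel exactly: the exponents of `r` are `-1/p`, `1` and `-(1 - 1/p)`.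
  have hpow : r ^ (-(1 / p.toReal)) * (r * N) = schattenNorm p ρ := by
    have h2 : ((j : ℝ) + 1) / (k + 1) = r⁻¹ := by rw [hr', inv_div]
    rw [hN, h2, Real.inv_rpow hr0.le, ← Real.rpow_neg hr0.le, ← mul_assoc, ← mul_assoc,
      ← Real.rpow_add_one hr0.ne', ← Real.rpow_add hr0]
    simp [sub_eq_add_neg, add_comm, add_left_comm]
  have hbound : schattenNorm p ((r : ℂ) • extremeChannel j k (shifted j k A) ρ -
      op k (hus j (-mag j A) ρ)) ≤ (2 * ∑ s ∈ S.erase s₀, q s) * (r * N) := by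
    rw [hsub]
    refine (schattenNorm_sum_smul_le hp _ _
      (fun s _ => mul_nonneg hr0.le (cgWeight_nonneg _ _ _ _)) _).trans ?_
    rw [Finset.mul_sum, Finset.sum_mul]
    refine Finset.sum_le_sum fun s hs => ?_
    have h3 : schattenNorm p (extremeChannel j k (shifted j k A) ρ -
        extremeChannel j k (j + k - 2 * s) ρ) ≤ 2 * N :=
      (schattenNorm_sub_le hp _ _).trans
        ((add_le_add hle₀ (hle s (Finset.mem_of_mem_erase hs))).trans_eq (two_mul N).symm)
    exact (mul_le_mul_of_nonneg_left h3 (mul_nonneg hr0.le (cgWeight_nonneg _ _ _ _))).trans_eq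
      (by ring)
  calc _ ≤ r ^ (-(1 / p.toReal)) * ((2 * ∑ s ∈ S.erase s₀, q s) * (r * N)) :=
        mul_le_mul_of_nonneg_left hbound (by positivity)
    _ = 2 * (∑ s ∈ S.erase s₀, q s) * (r ^ (-(1 / p.toReal)) * (r * N)) := by ring
    _ ≤ _ := by
        rw [hpow]
        exact mul_le_mul_of_nonneg_right (mul_le_mul_of_nonneg_left
          (sum_range_erase_cgWeight_le A hA) zero_le_two) (schattenNorm_nonneg hp ρ)

theorem eLpNorm_hus_extremeChannel_sub_le {j k : ℕ} {A : Fin (j + 1)}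
    (hA : j ≤ k + (A : ℕ)) {p : ℝ≥0∞} (hp : 1 ≤ p) (ρ : Operator j) :
    eLpNorm (fun ω => (((2 * spin k + 1) / (2 * spin j + 1) : ℝ) : ℂ) *
        hus k (spin k) (extremeChannel j k (shifted j k A) ρ) ω - hus j (-mag j A) ρ ω)
        p sphereMeasure ≤
      ENNReal.ofReal (2 * ((A : ℕ) * ((j : ℝ) - (A : ℕ) + 1) / (k + 2)) *
        (((j : ℝ) + 1)⁻¹ ^ (1 / p.toReal) * schattenNorm p ρ)) := by
  have h := shifted_spec hA
  set m := shifted j k A with hm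
  set q : Fin (j + 1) → ℝ := fun a => ((k : ℝ) + 1) / (m + 1) * cgWeight j k m a with hq
  have hq0 : ∀ a, 0 ≤ q a := fun a => mul_nonneg (by positivity) (cgWeight_nonneg _ _ _ _)
  have hq1 : ∑ a, q a = 1 := by
    rw [hq, ← Finset.mul_sum, sum_cgWeight h]
    field_simp
  -- The same cancellation as for operators, now with the distribution over `a` at fixed total spin.
  have hsub : (fun ω => (((2 * spin k + 1) / (2 * spin j + 1) : ℝ) : ℂ) *
        hus k (spin k) (extremeChannel j k m ρ) ω - hus j (-mag j A) ρ ω) =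
      fun ω => ∑ a ∈ Finset.univ.erase A, (q a : ℂ) *
        (hus j (-mag j a) ρ - hus j (-mag j A) ρ) ω := by
    ext ω
    have h1 : hus j (-mag j A) ρ ω = ∑ a, (q a : ℂ) * hus j (-mag j A) ρ ω := by
      rw [← Finset.sum_mul, ← Complex.ofReal_sum, hq1, Complex.ofReal_one, one_mul]
    rw [hus_extremeChannel h, h1, ← Finset.sum_sub_distrib,
      ← Finset.add_sum_erase _ _ (Finset.mem_univ A), sub_self, zero_add]
    exact Finset.sum_congr rfl fun a _ => (mul_sub _ _ _).symm
  set N : ℝ := ((j : ℝ) + 1)⁻¹ ^ (1 / p.toReal) * schattenNorm p ρ with hN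
  have hN0 : 0 ≤ N := mul_nonneg (by positivity) (schattenNorm_nonneg hp ρ)
  rw [hsub]
  refine (eLpNorm_sum_mul_le hp _ (fun a _ => hq0 a)
    (fun a _ => (aestronglyMeasurable_hus a ρ).sub (aestronglyMeasurable_hus A ρ))
    (B := fun _ => N + N) (fun _ _ => add_nonneg hN0 hN0) fun a _ => ?_).trans ?_
  · refine (eLpNorm_sub_le (aestronglyMeasurable_hus a ρ) (aestronglyMeasurable_hus A ρ) hp).trans ?_
    rw [ENNReal.ofReal_add hN0 hN0]
    exact add_le_add (eLpNorm_hus_neg_le a hp ρ) (eLpNorm_hus_neg_le A hp ρ)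
  · refine ENNReal.ofReal_le_ofReal ?_
    rw [← Finset.sum_mul, ← two_mul, ← mul_assoc]
    refine mul_le_mul_of_nonneg_right ?_ hN0
    rw [mul_comm]
    exact mul_le_mul_of_nonneg_left (sum_erase_cgWeight_le h (shifted_cast hA)) zero_le_two

theorem op_mixedHus {j : ℕ} (k : ℕ) (w : Fin (j + 1) → ℝ) (ρ : Operator j) :
    op k (mixedHus j w ρ) = ∑ a, (w a : ℂ) • op k (hus j (-mag j a) ρ) := by
  ext x y
  simp only [op_eq, matInt, mixedHus, Matrix.sum_apply, Matrix.smul_apply, Matrix.of_apply,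
    smul_eq_mul, Finset.sum_mul]
  rw [integral_finsetSum, Finset.mul_sum]
  · refine Finset.sum_congr rfl fun a _ => ?_
    simp only [mul_assoc]
    rw [integral_const_mul]
    ring
  · intro a _
    refine integrable_of_continuous ?_
    rw [← mag_rev]
    exact (continuous_const.mul (continuous_hus _ ρ)).mul
      ((continuous_spinProj k _).matrix_elem x y)

theorem hus_sum_smul {n : ℕ} {ι : Type*} (t : Finset ι) (c : ι → ℂ) (X : ι → Operator n) (i : ℝ)
    (ω : Sphere2) : hus n i (∑ a ∈ t, c a • X a) ω = ∑ a ∈ t, c a * hus n i (X a) ω := by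
  simp [hus, Matrix.sum_mulVec, Matrix.smul_mulVec, dotProduct_sum]

/-- A product with given sum is at most a quarter of the square of the sum, and `d ≥ (k + 1) / 2`
doubles this. The final factor `1 / 2` absorbs the 2 from the triangle inequality. -/
theorem mul_le_quarter_sq_div {j k : ℕ} {x y d : ℝ} (hxy : x + y = (j : ℝ) + 1)
    (hd : ((k : ℝ) + 1) / 2 ≤ d) : x * y / d ≤ ((j : ℝ) + 1) ^ 2 / (k + 1) / 2 := by
  have hk : (0 : ℝ) < (k : ℝ) + 1 := by positivity
  rw [div_div, div_le_div_iff₀ (by linarith) (by positivity), ← hxy]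
  nlinarith [mul_nonneg (sq_nonneg (x - y)) hk.le,
    mul_le_mul_of_nonneg_left hd (sq_nonneg (x + y))]

theorem theorem4 (j k : ℕ) (ρ : Operator j) (p : ℝ≥0∞) (hp : 1 ≤ p) :
    (∀ a : Fin (j + 1), |spin k - spin j| ≤ spin k + mag j a →
      (((2 * spin k + 1) / (2 * spin j + 1)) ^ (-(1 / p.toReal)) *
          schattenNorm p
            ((((2 * spin k + 1) / (2 * spin j + 1) : ℝ) : ℂ) •
                extremeChannel j k (shifted j k a) ρ -
              op k (hus j (-mag j a) ρ)) ≤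
        12 * ((spin j - mag j a) * (spin j + mag j a + 1) /
          (2 * spin k - spin j + mag j a + 1)) * schattenNorm p ρ) ∧
      (ENNReal.ofReal ((2 * spin j + 1) ^ (1 / p.toReal)) *
          eLpNorm (fun ω =>
            (((2 * spin k + 1) / (2 * spin j + 1) : ℝ) : ℂ) *
                hus k (spin k) (extremeChannel j k (shifted j k a) ρ) ω -
              hus j (-mag j a) ρ ω) p sphereMeasure ≤
        ENNReal.ofReal
          (2 * ((spin j + mag j a) * (spin j - mag j a + 1) /
            (2 * spin k - spin j + mag j a + 1)) * schattenNorm p ρ))) ∧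
    (2 * spin j ≤ spin k →
      ∀ w : Fin (j + 1) → ℝ, (∀ a, 0 ≤ w a) → ∑ a, w a = 1 →
      (((2 * spin k + 1) / (2 * spin j + 1)) ^ (-(1 / p.toReal)) *
          schattenNorm p
            ((((2 * spin k + 1) / (2 * spin j + 1) : ℝ) : ℂ) • mixedChannel j k w ρ -
              op k (mixedHus j w ρ)) ≤
        6 * ((2 * spin j + 1) ^ 2 / (2 * spin k + 1)) * schattenNorm p ρ) ∧
      (ENNReal.ofReal ((2 * spin j + 1) ^ (1 / p.toReal)) *
          eLpNorm (fun ω =>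
            (((2 * spin k + 1) / (2 * spin j + 1) : ℝ) : ℂ) *
                hus k (spin k) (mixedChannel j k w ρ) ω -
              mixedHus j w ρ ω) p sphereMeasure ≤
        ENNReal.ofReal
          ((2 * spin j + 1) ^ 2 / (2 * spin k + 1) * schattenNorm p ρ))) := by
  have hS : 0 ≤ schattenNorm p ρ := schattenNorm_nonneg hp ρ
  have hfun : ∀ (x : ℝ) {e : ℝ≥0∞}, 0 ≤ x →
      e ≤ ENNReal.ofReal (x * (((j : ℝ) + 1)⁻¹ ^ (1 / p.toReal) * schattenNorm p ρ)) →
      ENNReal.ofReal ((2 * spin j + 1) ^ (1 / p.toReal)) * e ≤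
        ENNReal.ofReal (x * schattenNorm p ρ) := by
    intro x e hx he
    have h1 : (2 * spin j + 1 : ℝ) = (j : ℝ) + 1 := by simp only [spin]; ring
    have hj : (0 : ℝ) < (j : ℝ) + 1 := by positivity
    refine (mul_le_mul_right he _).trans_eq ?_
    rw [h1, ← ENNReal.ofReal_mul (by positivity), Real.inv_rpow hj.le]
    congr 1
    field_simp
  constructor
  · intro A hA
    have hAj : (((A : ℕ) : ℕ) : ℝ) ≤ j := by exact_mod_cast Nat.lt_succ_iff.1 A.2
    have hA' : j ≤ k + (A : ℕ) := by
      -- Only the bound by `J - K` carries information; the bound by `K - J` says `-J ≤ i`, which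
      -- always holds.
      have h2 := (neg_le_abs (spin k - spin j)).trans hA
      simp only [spin, mag] at h2
      have h3 : (j : ℝ) ≤ k + (A : ℕ) := by linarith
      exact_mod_cast h3
    have hd : (j : ℝ) ≤ k + (A : ℕ) := by exact_mod_cast hA'
    have hA0 : (0 : ℝ) ≤ (A : ℕ) := Nat.cast_nonneg _
    have e1 : spin j - mag j A = (j : ℝ) - (A : ℕ) := by simp only [spin, mag]; ring
    have e2 : spin j + mag j A = (A : ℕ) := by simp only [spin, mag]; ring
    have e3 : 2 * spin k - spin j + mag j A + 1 = (k : ℝ) - j + (A : ℕ) + 1 := by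
      simp only [spin, mag]; ring
    rw [e1, e2, e3]
    constructor
    · refine (schattenNorm_smul_extremeChannel_sub_op_le hA' hp ρ).trans
        (mul_le_mul_of_nonneg_right ?_ hS)
      have h4 : 0 ≤ ((j : ℝ) - (A : ℕ)) * ((A : ℕ) + 1) :=
        mul_nonneg (by linarith) (by linarith)
      -- The estimate obtained has constant 2, below 12, and denominator `k - j + 2 * A + 2`, which
      -- is at least the stated `k - j + A + 1`.
      refine mul_le_mul (by norm_num) ?_ (div_nonneg h4 (by linarith)) (by norm_num)
      exact div_le_div_of_nonneg_left h4 (by linarith) (by linarith)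
    · have h4 : 0 ≤ (A : ℕ) * ((j : ℝ) - (A : ℕ) + 1) := mul_nonneg hA0 (by linarith)
      refine hfun _ (mul_nonneg zero_le_two (div_nonneg h4 (by linarith)))
        ((eLpNorm_hus_extremeChannel_sub_le hA' hp ρ).trans (ENNReal.ofReal_le_ofReal
          (mul_le_mul_of_nonneg_right (mul_le_mul_of_nonneg_left ?_ zero_le_two)
            (mul_nonneg (by positivity) hS))))
      -- Here the stated denominator is at most `k + 2` because `A ≤ j`.
      exact div_le_div_of_nonneg_left h4 (by linarith) (by linarith)
  · intro hjk w hw hw1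
    have hjk' : 2 * (j : ℝ) ≤ k := by simp only [spin] at hjk; linarith
    have hjk'' : 2 * j ≤ k := by exact_mod_cast hjk'
    have hA : ∀ A : Fin (j + 1), j ≤ k + (A : ℕ) := fun A => by omega
    have e1 : (2 * spin j + 1 : ℝ) = (j : ℝ) + 1 := by simp only [spin]; ring
    have e2 : (2 * spin k + 1 : ℝ) = (k : ℝ) + 1 := by simp only [spin]; ring
    set C : ℝ := ((j : ℝ) + 1) ^ 2 / (k + 1) with hC
    have hC0 : 0 ≤ C := by positivity
    constructor
    · have hsum : (((2 * spin k + 1) / (2 * spin j + 1) : ℝ) : ℂ) • mixedChannel j k w ρ -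
          op k (mixedHus j w ρ) = ∑ a, (w a : ℂ) •
            ((((2 * spin k + 1) / (2 * spin j + 1) : ℝ) : ℂ) •
              extremeChannel j k (shifted j k a) ρ - op k (hus j (-mag j a) ρ)) := by
        rw [op_mixedHus, mixedChannel, Finset.smul_sum, ← Finset.sum_sub_distrib]
        exact Finset.sum_congr rfl fun a _ => by rw [smul_sub, smul_comm]
      rw [hsum]
      have hr : 0 ≤ ((2 * spin k + 1) / (2 * spin j + 1)) ^ (-(1 / p.toReal)) := by
        rw [e1, e2]; positivity
      refine (mul_le_mul_of_nonneg_left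
        (schattenNorm_sum_smul_le hp _ _ (fun a _ => hw a) _) hr).trans ?_
      have hrhs : 6 * C * schattenNorm p ρ = ∑ a, w a * (6 * C * schattenNorm p ρ) := by
        rw [← Finset.sum_mul, hw1, one_mul]
      rw [Finset.mul_sum, e1, e2, ← hC, hrhs]
      refine Finset.sum_le_sum fun a _ => ?_
      rw [mul_left_comm]
      refine mul_le_mul_of_nonneg_left ?_ (hw a)
      have h2 := schattenNorm_smul_extremeChannel_sub_op_le (hA a) hp ρ
      rw [e1, e2] at h2
      refine h2.trans (mul_le_mul_of_nonneg_right ?_ hS)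
      -- The denominator is at least `(k + 1) / 2` because `2 * j ≤ k`. The sharper denominator of
      -- the error estimate is used directly, giving `C`, which is below `6 * C`.
      have h3 := mul_le_quarter_sq_div (j := j) (k := k) (x := (j : ℝ) - (a : ℕ))
        (y := (a : ℕ) + 1) (d := (k : ℝ) - j + 2 * (a : ℕ) + 2) (by ring)
        (by linarith [Nat.cast_nonneg (α := ℝ) (a : ℕ)])
      linarith
    · have hsum : (fun ω => (((2 * spin k + 1) / (2 * spin j + 1) : ℝ) : ℂ) *
            hus k (spin k) (mixedChannel j k w ρ) ω - mixedHus j w ρ ω) =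
          fun ω => ∑ a, (w a : ℂ) * ((((2 * spin k + 1) / (2 * spin j + 1) : ℝ) : ℂ) *
            hus k (spin k) (extremeChannel j k (shifted j k a) ρ) ω -
              hus j (-mag j a) ρ ω) := by
        ext ω
        rw [mixedChannel, hus_sum_smul, mixedHus, Finset.mul_sum, ← Finset.sum_sub_distrib]
        exact Finset.sum_congr rfl fun a _ => by ring
      rw [hsum]
      have hN : 0 ≤ ((j : ℝ) + 1)⁻¹ ^ (1 / p.toReal) * schattenNorm p ρ :=
        mul_nonneg (by positivity) hS
      have hmeas : ∀ X : Operator k, AEStronglyMeasurable (hus k (spin k) X) sphereMeasure :=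
        fun X => by
          rw [← mag_last]
          exact (continuous_hus _ X).aestronglyMeasurable
      rw [e1, e2, ← hC]
      have h1 := hfun C (e := eLpNorm (fun ω => ∑ a, (w a : ℂ) *
        ((((2 * spin k + 1) / (2 * spin j + 1) : ℝ) : ℂ) *
            hus k (spin k) (extremeChannel j k (shifted j k a) ρ) ω -
              hus j (-mag j a) ρ ω)) p sphereMeasure) hC0 ?_
      · rwa [e1, e2] at h1
      refine (eLpNorm_sum_mul_le hp _ (fun a _ => hw a)
        (f := fun a ω => (((2 * spin k + 1) / (2 * spin j + 1) : ℝ) : ℂ) *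
            hus k (spin k) (extremeChannel j k (shifted j k a) ρ) ω - hus j (-mag j a) ρ ω)
        (fun a _ => ((hmeas _).const_mul _).sub (aestronglyMeasurable_hus a ρ))
        (B := fun _ => C * (((j : ℝ) + 1)⁻¹ ^ (1 / p.toReal) * schattenNorm p ρ))
        (fun _ _ => mul_nonneg hC0 hN) fun a _ => ?_).trans_eq
          (by rw [← Finset.sum_mul, hw1, one_mul])
      refine (eLpNorm_hus_extremeChannel_sub_le (hA a) hp ρ).trans
        (ENNReal.ofReal_le_ofReal (mul_le_mul_of_nonneg_right ?_ hN))
      -- Twice the bound by `C / 2` is exactly the constant `C` of the statement.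
      have h3 := mul_le_quarter_sq_div (j := j) (k := k) (x := (a : ℕ))
        (y := (j : ℝ) - (a : ℕ) + 1) (d := (k : ℝ) + 2) (by ring)
        (by linarith [Nat.cast_nonneg (α := ℝ) k])
      linarith
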